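/- Let $\nu>0$, $C<0$ and let $U(y)=C(y^2-y)$ be the Poiseuille profile in the channel $\mathbb R\times(0,1)$, whose fields are taken $2\pi$-periodic in $x$; put $Q=(0,2\pi)\times(0,1)$. Let $H$ be the complex Hilbert space of fields $(u,v)\in L^2(Q;\mathbb C)^2$, extended $2\pi$-periodically in $x$, with $u_x+v_y=0$, with $v=0$ on the walls $y=0$ and $y=1$, and with $\int_0^{2\pi}u(x,y)\,dx=\int_0^{2\pi}v(x,y)\,dx=0$ for a.e. $y$. Let $\Pi:L^2(Q;\mathbb C)^2\to H$ be the orthogonal (Leray) projector, and let $\mathcal A:D(\mathcal A)\subset H\to H$ be the Oseen operator $$\mathcal A(u,v)=\Pi\{-\nu\Delta u+u_xU+vU',\ -\nu\Delta v+v_xU\},$$ where $D(\mathcal A)$ consists of the $(u,v)\in H$ whose components are in the $x$-periodic Sobolev space $H^2$ and such that $u=v=0$ on $y=0$ and $y=1$. Let $\mathcal A^*$ be the adjoint of $\mathcal A$ in $H$, and let $\lambda\in\mathbb C$ with $\operatorname{Re}\lambda\le 0$. (i) If $\varphi\in D(\mathcal A)$, $\varphi\ne0$ and $\mathcal A\varphi=\lambda\varphi$,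 then the normal derivative $\partial\varphi/\partial n$ exists (as an $L^2$ trace) on the walls $\{y=0\}\cup\{y=1\}$ and does not vanish identically there. (ii) If $\varphi^*\in D(\mathcal A^*)$, $\varphi^*\ne0$ and $\mathcal A^*\varphi^*=\overline\lambda\varphi^*$, then the normal derivative $\partial\varphi^*/\partial n$ exists (as an $L^2$ trace) on the walls $\{y=0\}\cup\{y=1\}$ and does not vanish identically there. -/

import Mathlib

open MeasureTheory Set
open scoped ContDiff InnerProductSpace ComplexConjugate

noncomputable section

namespace PeriodicChannel

/-! ### Spaces of `2π`-periodic functions on the channel `ℝ × (0,1)` -/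

/-- The periodicity cell `Q = (0,2π) × (0,1)`. -/
abbrev cell : Set (ℝ × ℝ) := Ioo 0 (2 * Real.pi) ×ˢ Ioo 0 1

/-- Complex square integrable functions on the channel that are `2π`-periodic in `x`;
such a function is determined by its restriction to the periodicity cell. -/
abbrev L2Cell : Type := Lp ℂ 2 (volume.restrict cell)

/-- Complex square integrable `2π`-periodic functions on one wall. -/
abbrev L2Wall : Type := Lp ℂ 2 (volume.restrict (Ioo (0 : ℝ) (2 * Real.pi)))

/-- Square integrable complex vector fields `(u, v)`, with the `L²` scalar product. -/
abbrev VectorL2 : Type := WithLp 2 (L2Cell × L2Cell)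

/-- Classical partial derivative in `x`. -/
def dX (φ : ℝ × ℝ → ℂ) (p : ℝ × ℝ) : ℂ := fderiv ℝ φ p (1, 0)

/-- Classical partial derivative in `y`. -/
def dY (φ : ℝ × ℝ → ℂ) (p : ℝ × ℝ) : ℂ := fderiv ℝ φ p (0, 1)

/-- Functions that are smooth up to the walls and `2π`-periodic in `x`. -/
structure IsPeriodicSmooth (φ : ℝ × ℝ → ℂ) : Prop where
  contDiff : ContDiff ℝ ∞ φ
  periodic : ∀ x y, φ (x + 2 * Real.pi, y) = φ (x, y)

/-- Periodic test functions that vanish near the walls. -/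
structure IsInteriorTest (φ : ℝ × ℝ → ℂ) : Prop extends IsPeriodicSmooth φ where
  support : ∃ a b : ℝ, 0 < a ∧ b < 1 ∧ ∀ x y, y ∉ Icc a b → φ (x, y) = 0

/-- `g` is the weak derivative `∂f/∂x` of the periodic function `f` in the open channel. -/
def IsWeakDx (f g : L2Cell) : Prop :=
  ∀ φ, IsInteriorTest φ → ∫ p in cell, f p * dX φ p = -∫ p in cell, g p * φ p

/-- `g` is the weak derivative `∂f/∂y` of the periodic function `f` in the open channel. -/
def IsWeakDy (f g : L2Cell) : Prop :=
  ∀ φ, IsInteriorTest φ → ∫ p in cell, f p * dY φ p = -∫ p in cell, g p * φ p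

open Classical in
/-- The weak derivative `∂f/∂x` (zero if it does not exist in `L²`). -/
def weakDx (f : L2Cell) : L2Cell := if h : ∃ g, IsWeakDx f g then h.choose else 0

open Classical in
/-- The weak derivative `∂f/∂y` (zero if it does not exist in `L²`). -/
def weakDy (f : L2Cell) : L2Cell := if h : ∃ g, IsWeakDy f g then h.choose else 0

/-- The periodic Sobolev space `H²`: all weak derivatives of order at most two are in `L²`. -/
def MemH2 (f : L2Cell) : Prop :=
  ∃ fx fy fxx fxy fyy : L2Cell, IsWeakDx f fx ∧ IsWeakDy f fy ∧
    IsWeakDx fx fxx ∧ IsWeakDy fx fxy ∧ IsWeakDy fy fyy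

/-- `f` has a weak derivative `∂f/∂y` in `L²`, and its traces on the walls `y = 0` and `y = 1`
are `t₀` and `t₁`: this is Green's formula against functions that need not vanish at the walls. -/
def HasWallTrace (f : L2Cell) (t₀ t₁ : L2Wall) : Prop :=
  ∃ g : L2Cell, IsWeakDy f g ∧ ∀ φ, IsPeriodicSmooth φ →
    (∫ p in cell, f p * dY φ p) + ∫ p in cell, g p * φ p =
      (∫ x in Ioo 0 (2 * Real.pi), t₁ x * φ (x, 1)) - ∫ x in Ioo 0 (2 * Real.pi), t₀ x * φ (x, 0)

/-- The field `w = (u, v)` has the outward normal derivative `∂w/∂n = g₀` on the wall `y = 0`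
(where `∂/∂n = -∂/∂y`) and `∂w/∂n = g₁` on the wall `y = 1` (where `∂/∂n = ∂/∂y`). -/
def HasNormalDeriv (w : VectorL2) (g₀ g₁ : L2Wall × L2Wall) : Prop :=
  ∃ uy vy : L2Cell, IsWeakDy w.fst uy ∧ IsWeakDy w.snd vy ∧
    HasWallTrace uy (-g₀.1) g₁.1 ∧ HasWallTrace vy (-g₀.2) g₁.2

/-! ### Uniqueness of weak derivatives -/

lemma memLp_of_continuous {ψ : ℝ × ℝ → ℂ} (hψ : Continuous ψ) :
    MemLp ψ 2 (volume.restrict cell) := by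
  have hK : IsCompact (Icc (0 : ℝ) (2 * Real.pi) ×ˢ Icc (0 : ℝ) 1) :=
    isCompact_Icc.prod isCompact_Icc
  have hsub : cell ⊆ Icc (0 : ℝ) (2 * Real.pi) ×ˢ Icc (0 : ℝ) 1 :=
    prod_mono Ioo_subset_Icc_self Ioo_subset_Icc_self
  have hfin : IsFiniteMeasure (volume.restrict cell) :=
    ⟨by
      rw [Measure.restrict_apply_univ]
      exact (measure_mono hsub).trans_lt hK.measure_lt_top⟩
  obtain ⟨M, hM⟩ := hK.exists_bound_of_continuousOn hψ.continuousOn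
  refine MemLp.of_bound hψ.aestronglyMeasurable M ?_
  filter_upwards [ae_restrict_mem (measurableSet_Ioo.prod measurableSet_Ioo)] with p hp
  exact hM p (hsub hp)

/-- Integration against a continuous function is a scalar product in `L²`. -/
lemma exists_inner_eq {ψ : ℝ × ℝ → ℂ} (hψ : Continuous ψ) :
    ∃ g : L2Cell, ∀ f : L2Cell, ∫ p in cell, f p * ψ p = ⟪g, f⟫_ℂ := by
  have hc : Continuous fun p => conj (ψ p) := Complex.continuous_conj.comp hψ
  refine ⟨(memLp_of_continuous hc).toLp _, fun f => ?_⟩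
  rw [L2.inner_def]
  refine integral_congr_ae ?_
  filter_upwards [(memLp_of_continuous hc).coeFn_toLp] with p hp
  rw [hp]
  simp

lemma pair_add {ψ : ℝ × ℝ → ℂ} (hψ : Continuous ψ) (f g : L2Cell) :
    ∫ p in cell, (f + g : L2Cell) p * ψ p =
      (∫ p in cell, f p * ψ p) + ∫ p in cell, g p * ψ p := by
  obtain ⟨h, hh⟩ := exists_inner_eq hψ
  rw [hh, hh, hh, inner_add_right]

lemma pair_smul {ψ : ℝ × ℝ → ℂ} (hψ : Continuous ψ) (c : ℂ) (f : L2Cell) :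
    ∫ p in cell, (c • f : L2Cell) p * ψ p = c * ∫ p in cell, f p * ψ p := by
  obtain ⟨h, hh⟩ := exists_inner_eq hψ
  rw [hh, hh, inner_smul_right]

lemma pair_zero {ψ : ℝ × ℝ → ℂ} (hψ : Continuous ψ) :
    ∫ p in cell, (0 : L2Cell) p * ψ p = 0 := by
  obtain ⟨h, hh⟩ := exists_inner_eq hψ
  rw [hh, inner_zero_right]

lemma continuous_pair {ψ : ℝ × ℝ → ℂ} (hψ : Continuous ψ) :
    Continuous fun f : L2Cell => ∫ p in cell, f p * ψ p := by
  obtain ⟨h, hh⟩ := exists_inner_eq hψ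
  simp only [hh]
  exact continuous_const.inner continuous_id

lemma IsPeriodicSmooth.continuous {φ : ℝ × ℝ → ℂ} (h : IsPeriodicSmooth φ) : Continuous φ :=
  h.contDiff.continuous

lemma IsPeriodicSmooth.continuous_dX {φ : ℝ × ℝ → ℂ} (h : IsPeriodicSmooth φ) :
    Continuous (dX φ) :=
  (h.contDiff.continuous_fderiv (by simp)).clm_apply continuous_const

lemma IsPeriodicSmooth.continuous_dY {φ : ℝ × ℝ → ℂ} (h : IsPeriodicSmooth φ) :
    Continuous (dY φ) :=
  (h.contDiff.continuous_fderiv (by simp)).clm_apply continuous_const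

/-- A smooth function with compact support in the cell extends to a periodic test function. -/
lemma exists_interiorTest (g : ℝ × ℝ → ℝ) (hg : ContDiff ℝ ∞ g) (hc : HasCompactSupport g)
    (hs : tsupport g ⊆ cell) :
    ∃ φ, IsInteriorTest φ ∧ ∀ p ∈ cell, φ p = (g p : ℂ) := by
  have hpi := Real.two_pi_pos
  have hz : ∀ p, p ∉ cell → g p = 0 := fun p hp => by
    by_contra h
    exact hp (hs (subset_tsupport g h))
  refine ⟨fun p => ((∑ᶠ n : ℤ, g (p.1 + n * (2 * Real.pi), p.2) : ℝ) : ℂ), ⟨⟨?_, ?_⟩, ?_⟩, ?_⟩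
  · refine Complex.ofRealCLM.contDiff.comp ?_
    rw [← contMDiff_iff_contDiff]
    refine contMDiff_finsum (fun n => ?_) ?_
    · rw [contMDiff_iff_contDiff]
      exact hg.comp ((contDiff_fst.add contDiff_const).prodMk contDiff_snd)
    · intro p
      refine ⟨Ioo (p.1 - 1) (p.1 + 1) ×ˢ univ,
        prod_mem_nhds (Ioo_mem_nhds (by linarith) (by linarith)) Filter.univ_mem, ?_⟩
      refine (finite_Icc ⌊(-(p.1 + 1)) / (2 * Real.pi)⌋
        ⌈(2 * Real.pi - (p.1 - 1)) / (2 * Real.pi)⌉).subset ?_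
      rintro n ⟨q, hq, hq'⟩
      have hm : (q.1 + n * (2 * Real.pi), q.2) ∈ cell := by
        by_contra h
        exact hq (hz _ h)
      have h1 := hm.1.1
      have h2 := hm.1.2
      have h3 := hq'.1.1
      have h4 := hq'.1.2
      simp only at h1 h2
      constructor
      · rw [← Int.cast_le (R := ℝ)]
        refine (Int.floor_le _).trans ?_
        rw [div_le_iff₀ hpi]
        linarith
      · rw [← Int.cast_le (R := ℝ)]
        refine le_trans ?_ (Int.le_ceil _)
        rw [le_div_iff₀ hpi]
        linarith
  · intro x y
    simp only
    congr 1
    rw [← finsum_comp_equiv (Equiv.addRight (1 : ℤ))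
      (f := fun n : ℤ => g (x + n * (2 * Real.pi), y))]
    refine finsum_congr fun n => ?_
    simp only [Equiv.coe_addRight, Int.cast_add, Int.cast_one]
    congr 2
    ring
  · have hK : IsCompact (Prod.snd '' tsupport g) := hc.isCompact.image continuous_snd
    rcases (tsupport g).eq_empty_or_nonempty with he | hne
    · refine ⟨1 / 2, 1 / 2, by norm_num, by norm_num, fun x y _ => ?_⟩
      have : ∀ p, g p = 0 := fun p => by
        by_contra h
        have := subset_tsupport g h
        rw [he] at this
        exact this
      simp [this]
    · obtain ⟨a, ha⟩ := hK.exists_isLeast (hne.image _)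
      obtain ⟨b, hb⟩ := hK.exists_isGreatest (hne.image _)
      obtain ⟨pa, hpa, rfl⟩ := ha.1
      obtain ⟨pb, hpb, rfl⟩ := hb.1
      refine ⟨pa.2, pb.2, (hs hpa).2.1, (hs hpb).2.2, fun x y hy => ?_⟩
      have : ∀ n : ℤ, g (x + n * (2 * Real.pi), y) = 0 := fun n => by
        by_contra h
        have hm := mem_image_of_mem Prod.snd (subset_tsupport g h)
        exact hy ⟨ha.2 hm, hb.2 hm⟩
      simp [this]
  · intro p hp
    simp only
    rw [finsum_eq_single _ (0 : ℤ)]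
    · simp
    · intro n hn
      refine hz _ fun h => ?_
      have h1 := h.1.1
      have h2 := h.1.2
      have h3 := hp.1.1
      have h4 := hp.1.2
      simp only at h1 h2
      rcases lt_or_gt_of_ne hn with h | h
      · have : (n : ℝ) ≤ -1 := by exact_mod_cast Int.le_sub_one_of_lt h
        nlinarith
      · have : (1 : ℝ) ≤ n := by exact_mod_cast h
        nlinarith

lemma eq_zero_of_test {f : L2Cell}
    (h : ∀ φ, IsInteriorTest φ → ∫ p in cell, f p * φ p = 0) : f = 0 := by
  have hU : IsOpen cell := isOpen_Ioo.prod isOpen_Ioo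
  have hfin : IsFiniteMeasure (volume.restrict cell) :=
    ⟨by
      rw [Measure.restrict_apply_univ]
      exact (measure_mono (prod_mono Ioo_subset_Icc_self Ioo_subset_Icc_self)).trans_lt
        (isCompact_Icc.prod isCompact_Icc).measure_lt_top⟩
  have hint : Integrable f (volume.restrict cell) := (Lp.memLp f).integrable (by norm_num)
  have hl : LocallyIntegrableOn (f : ℝ × ℝ → ℂ) cell volume :=
    IntegrableOn.locallyIntegrableOn hint
  have key := hU.ae_eq_zero_of_integral_contDiff_smul_eq_zero hl fun g hg hc hs => by
    obtain ⟨φ, hφ, he⟩ := exists_interiorTest g hg hc hs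
    rw [← h φ hφ, ← setIntegral_eq_integral_of_forall_compl_eq_zero (s := cell)]
    · refine setIntegral_congr_fun hU.measurableSet fun p hp => ?_
      simp only [he p hp, Complex.real_smul]
      ring
    · intro p hp
      have : g p = 0 := by
        by_contra h
        exact hp (hs (subset_tsupport g h))
      simp [this]
  rw [Lp.eq_zero_iff_ae_eq_zero]
  exact (ae_restrict_iff' hU.measurableSet).2 key

lemma eq_of_test {f g : L2Cell}
    (h : ∀ φ, IsInteriorTest φ → ∫ p in cell, f p * φ p = ∫ p in cell, g p * φ p) : f = g := by
  rw [← sub_eq_zero]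
  refine eq_zero_of_test fun φ hφ => ?_
  have hs : f - g = f + (-1 : ℂ) • g := by
    rw [neg_one_smul, sub_eq_add_neg]
  rw [hs, pair_add hφ.continuous, pair_smul hφ.continuous, h φ hφ]
  ring

lemma IsWeakDx.add {f f' g g' : L2Cell} (h : IsWeakDx f g) (h' : IsWeakDx f' g') :
    IsWeakDx (f + f') (g + g') := fun φ hφ => by
  rw [pair_add hφ.continuous_dX, pair_add hφ.continuous, h φ hφ, h' φ hφ]
  ring

lemma IsWeakDx.smul {f g : L2Cell} (c : ℂ) (h : IsWeakDx f g) : IsWeakDx (c • f) (c • g) :=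
  fun φ hφ => by
    rw [pair_smul hφ.continuous_dX, pair_smul hφ.continuous, h φ hφ]
    ring

lemma IsWeakDy.add {f f' g g' : L2Cell} (h : IsWeakDy f g) (h' : IsWeakDy f' g') :
    IsWeakDy (f + f') (g + g') := fun φ hφ => by
  rw [pair_add hφ.continuous_dY, pair_add hφ.continuous, h φ hφ, h' φ hφ]
  ring

lemma IsWeakDy.smul {f g : L2Cell} (c : ℂ) (h : IsWeakDy f g) : IsWeakDy (c • f) (c • g) :=
  fun φ hφ => by
    rw [pair_smul hφ.continuous_dY, pair_smul hφ.continuous, h φ hφ]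
    ring

lemma isWeakDx_zero : IsWeakDx 0 0 := fun φ hφ => by
  rw [pair_zero hφ.continuous_dX, pair_zero hφ.continuous, neg_zero]

lemma isWeakDy_zero : IsWeakDy 0 0 := fun φ hφ => by
  rw [pair_zero hφ.continuous_dY, pair_zero hφ.continuous, neg_zero]

lemma IsWeakDx.eq {f g : L2Cell} (h : IsWeakDx f g) : weakDx f = g := by
  have he : ∃ g, IsWeakDx f g := ⟨g, h⟩
  rw [weakDx, dif_pos he]
  refine eq_of_test fun φ hφ => ?_
  rw [← neg_inj, ← he.choose_spec φ hφ, h φ hφ]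

lemma IsWeakDy.eq {f g : L2Cell} (h : IsWeakDy f g) : weakDy f = g := by
  have he : ∃ g, IsWeakDy f g := ⟨g, h⟩
  rw [weakDy, dif_pos he]
  refine eq_of_test fun φ hφ => ?_
  rw [← neg_inj, ← he.choose_spec φ hφ, h φ hφ]

lemma memH2_zero : MemH2 0 :=
  ⟨0, 0, 0, 0, 0, isWeakDx_zero, isWeakDy_zero, isWeakDx_zero, isWeakDy_zero, isWeakDy_zero⟩

lemma MemH2.add {f g : L2Cell} (hf : MemH2 f) (hg : MemH2 g) : MemH2 (f + g) := by
  obtain ⟨_, _, _, _, _, a1, a2, a3, a4, a5⟩ := hf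
  obtain ⟨_, _, _, _, _, b1, b2, b3, b4, b5⟩ := hg
  exact ⟨_, _, _, _, _, a1.add b1, a2.add b2, a3.add b3, a4.add b4, a5.add b5⟩

lemma MemH2.smul {f : L2Cell} (c : ℂ) (hf : MemH2 f) : MemH2 (c • f) := by
  obtain ⟨_, _, _, _, _, a1, a2, a3, a4, a5⟩ := hf
  exact ⟨_, _, _, _, _, a1.smul c, a2.smul c, a3.smul c, a4.smul c, a5.smul c⟩

lemma wallPair_zero (ψ : ℝ → ℂ) : ∫ x in Ioo 0 (2 * Real.pi), (0 : L2Wall) x * ψ x = 0 := by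
  rw [← integral_zero ℝ ℂ (μ := volume.restrict (Ioo 0 (2 * Real.pi)))]
  refine integral_congr_ae ?_
  filter_upwards [Lp.coeFn_zero ℂ 2 (volume.restrict (Ioo (0 : ℝ) (2 * Real.pi)))] with x hx
  rw [hx]
  simp

lemma hasWallTrace_zero : HasWallTrace 0 0 0 :=
  ⟨0, isWeakDy_zero, fun φ hφ => by
    rw [pair_zero hφ.continuous_dY, pair_zero hφ.continuous, wallPair_zero, wallPair_zero]
    simp⟩

lemma HasWallTrace.add_zero {f g : L2Cell} (hf : HasWallTrace f 0 0) (hg : HasWallTrace g 0 0) :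
    HasWallTrace (f + g) 0 0 := by
  obtain ⟨f', hf', h1⟩ := hf
  obtain ⟨g', hg', h2⟩ := hg
  refine ⟨f' + g', hf'.add hg', fun φ hφ => ?_⟩
  have e1 := h1 φ hφ
  have e2 := h2 φ hφ
  rw [wallPair_zero, wallPair_zero] at e1 e2 ⊢
  rw [pair_add hφ.continuous_dY, pair_add hφ.continuous]
  linear_combination e1 + e2

lemma HasWallTrace.smul_zero {f : L2Cell} (c : ℂ) (hf : HasWallTrace f 0 0) :
    HasWallTrace (c • f) 0 0 := by
  obtain ⟨f', hf', h1⟩ := hf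
  refine ⟨c • f', hf'.smul c, fun φ hφ => ?_⟩
  have e1 := h1 φ hφ
  rw [wallPair_zero, wallPair_zero] at e1 ⊢
  rw [pair_smul hφ.continuous_dY, pair_smul hφ.continuous]
  linear_combination c * e1

/-! ### The space `H` and the linearized operator -/

/-- The (complexified) space `H` of square integrable periodic fields `w = (u, v)` with
`u_x + v_y = 0`, with `v = 0` on both walls, and with vanishing `0`-th Fourier coefficient in `x`.
The first condition (orthogonality to all gradients of functions smooth up to the walls) says
weakly that the divergence and the normal trace vanish; the second one says that
`∫₀^{2π} u(x,y) dx = ∫₀^{2π} v(x,y) dx = 0` for almost every `y`. -/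
def H : Submodule ℂ VectorL2 where
  carrier := {w |
    (∀ q, IsPeriodicSmooth q →
      (∫ p in cell, w.fst p * dX q p) + ∫ p in cell, w.snd p * dY q p = 0) ∧
    ∀ η : ℝ → ℂ, ContDiff ℝ ∞ η →
      ∫ p in cell, w.fst p * η p.2 = 0 ∧ ∫ p in cell, w.snd p * η p.2 = 0}
  zero_mem' := by
    refine ⟨fun q hq => ?_, fun η hη => ?_⟩
    · rw [WithLp.zero_fst, WithLp.zero_snd, pair_zero hq.continuous_dX,
        pair_zero hq.continuous_dY, add_zero]
    · have hc : Continuous fun p : ℝ × ℝ => η p.2 := hη.continuous.comp continuous_snd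
      rw [WithLp.zero_fst, WithLp.zero_snd]
      exact ⟨pair_zero hc, pair_zero hc⟩
  add_mem' := by
    rintro w z ⟨hw, hw'⟩ ⟨hz, hz'⟩
    refine ⟨fun q hq => ?_, fun η hη => ?_⟩
    · rw [WithLp.add_fst, WithLp.add_snd, pair_add hq.continuous_dX, pair_add hq.continuous_dY]
      linear_combination hw q hq + hz q hq
    · have hc : Continuous fun p : ℝ × ℝ => η p.2 := hη.continuous.comp continuous_snd
      rw [WithLp.add_fst, WithLp.add_snd, pair_add hc, pair_add hc, (hw' η hη).1, (hz' η hη).1,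
        (hw' η hη).2, (hz' η hη).2]
      simp
  smul_mem' := by
    rintro c w ⟨hw, hw'⟩
    refine ⟨fun q hq => ?_, fun η hη => ?_⟩
    · rw [WithLp.smul_fst, WithLp.smul_snd, pair_smul hq.continuous_dX,
        pair_smul hq.continuous_dY]
      linear_combination c * hw q hq
    · have hc : Continuous fun p : ℝ × ℝ => η p.2 := hη.continuous.comp continuous_snd
      rw [WithLp.smul_fst, WithLp.smul_snd, pair_smul hc, pair_smul hc, (hw' η hη).1,
        (hw' η hη).2]
      simp

lemma isClosed_H : IsClosed (H : Set VectorL2) := by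
  have c1 : Continuous fun w : VectorL2 => w.fst := continuous_fst.comp (WithLp.prod_continuous_ofLp 2 _ _)
  have c2 : Continuous fun w : VectorL2 => w.snd := continuous_snd.comp (WithLp.prod_continuous_ofLp 2 _ _)
  have : (H : Set VectorL2) =
      (⋂ (q) (_ : IsPeriodicSmooth q), {w : VectorL2 |
        (∫ p in cell, w.fst p * dX q p) + ∫ p in cell, w.snd p * dY q p = 0}) ∩
      ⋂ (η : ℝ → ℂ) (_ : ContDiff ℝ ∞ η), ({w : VectorL2 | ∫ p in cell, w.fst p * η p.2 = 0} ∩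
        {w : VectorL2 | ∫ p in cell, w.snd p * η p.2 = 0}) := by
    ext w
    simp only [mem_inter_iff, mem_iInter]
    rfl
  rw [this]
  refine IsClosed.inter (isClosed_iInter fun q => isClosed_iInter fun hq => ?_)
    (isClosed_iInter fun η => isClosed_iInter fun hη => ?_)
  · exact isClosed_eq (((continuous_pair hq.continuous_dX).comp c1).add
      ((continuous_pair hq.continuous_dY).comp c2)) continuous_const
  · have hc : Continuous fun p : ℝ × ℝ => η p.2 := hη.continuous.comp continuous_snd
    exact (isClosed_eq ((continuous_pair hc).comp c1) continuous_const).inter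
      (isClosed_eq ((continuous_pair hc).comp c2) continuous_const)

instance completeSpace_H : CompleteSpace H := isClosed_H.completeSpace_coe

/-- The Poiseuille profile `U(y) = C (y² - y)`. -/
def poiseuille (C : ℝ) (y : ℝ) : ℝ := C * (y ^ 2 - y)

lemma contDiff_poiseuille (C : ℝ) : ContDiff ℝ ∞ (poiseuille C) := by
  unfold poiseuille
  fun_prop

lemma continuous_poiseuille (C : ℝ) : Continuous (poiseuille C) :=
  (contDiff_poiseuille C).continuous

lemma continuous_deriv_poiseuille (C : ℝ) : Continuous (deriv (poiseuille C)) :=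
  (contDiff_poiseuille C).continuous_deriv (by simp)

lemma memLp_mulY {c : ℝ → ℝ} (hc : Continuous c) (f : L2Cell) :
    MemLp (fun p : ℝ × ℝ => (c p.2 : ℂ) * f p) 2 (volume.restrict cell) := by
  have hcc : Continuous fun p : ℝ × ℝ => (c p.2 : ℂ) :=
    Complex.continuous_ofReal.comp (hc.comp continuous_snd)
  obtain ⟨M, hM⟩ := (isCompact_Icc (a := (0 : ℝ)) (b := 1)).exists_bound_of_continuousOn
    hc.continuousOn
  refine (Lp.memLp f).of_le_mul (c := M) (hcc.aestronglyMeasurable.mul (Lp.aestronglyMeasurable f))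
    ?_
  filter_upwards [ae_restrict_mem (measurableSet_Ioo.prod measurableSet_Ioo)] with p hp
  rw [norm_mul, Complex.norm_real]
  gcongr
  exact hM p.2 (Ioo_subset_Icc_self hp.2)

/-- Multiplication `f(x,y) ↦ c(y) f(x,y)` by a continuous function of `y`. -/
def mulY (c : ℝ → ℝ) (hc : Continuous c) : L2Cell →ₗ[ℂ] L2Cell where
  toFun f := (memLp_mulY hc f).toLp _
  map_add' f g := by
    rw [← MemLp.toLp_add]
    refine MemLp.toLp_congr _ _ ?_
    filter_upwards [Lp.coeFn_add f g] with p hp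
    rw [hp]
    simp [mul_add]
  map_smul' a f := by
    rw [RingHom.id_apply, ← MemLp.toLp_const_smul]
    refine MemLp.toLp_congr _ _ ?_
    filter_upwards [Lp.coeFn_smul a f] with p hp
    rw [hp]
    simp [mul_left_comm]

/-- The Laplacian `∂²f/∂x² + ∂²f/∂y²`. -/
def laplacian (f : L2Cell) : L2Cell := weakDx (weakDx f) + weakDy (weakDy f)

/-- The linearization at `(U, 0)` before projection:
`(u, v) ↦ (-ν Δu + u_x U + v U', -ν Δv + v_x U)`. -/
def oseenExpr (ν C : ℝ) (w : VectorL2) : VectorL2 :=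
  WithLp.toLp 2
    (-((ν : ℂ) • laplacian w.fst) + mulY _ (continuous_poiseuille C) (weakDx w.fst) +
        mulY _ (continuous_deriv_poiseuille C) w.snd,
      -((ν : ℂ) • laplacian w.snd) + mulY _ (continuous_poiseuille C) (weakDx w.snd))

lemma MemH2.deriv_add {f g : L2Cell} (hf : MemH2 f) (hg : MemH2 g) :
    weakDx (f + g) = weakDx f + weakDx g ∧ laplacian (f + g) = laplacian f + laplacian g := by
  obtain ⟨_, _, _, _, _, a1, a2, a3, a4, a5⟩ := hf
  obtain ⟨_, _, _, _, _, b1, b2, b3, b4, b5⟩ := hg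
  simp only [laplacian, (a1.add b1).eq, (a2.add b2).eq, (a3.add b3).eq, (a5.add b5).eq, a1.eq,
    a2.eq, a3.eq, a5.eq, b1.eq, b2.eq, b3.eq, b5.eq, true_and]
  abel

lemma MemH2.deriv_smul {f : L2Cell} (c : ℂ) (hf : MemH2 f) :
    weakDx (c • f) = c • weakDx f ∧ laplacian (c • f) = c • laplacian f := by
  obtain ⟨_, _, _, _, _, a1, a2, a3, a4, a5⟩ := hf
  simp only [laplacian, (a1.smul c).eq, (a2.smul c).eq, (a3.smul c).eq, (a5.smul c).eq, a1.eq,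
    a2.eq, a3.eq, a5.eq, smul_add, and_self]

/-- The domain `D(𝒜)`: the fields in `H` that are in `H²` and vanish on both walls. -/
def oseenDomain : Submodule ℂ H where
  carrier := {w | (MemH2 (w : VectorL2).fst ∧ MemH2 (w : VectorL2).snd) ∧
    HasWallTrace (w : VectorL2).fst 0 0 ∧ HasWallTrace (w : VectorL2).snd 0 0}
  zero_mem' := ⟨⟨memH2_zero, memH2_zero⟩, hasWallTrace_zero, hasWallTrace_zero⟩
  add_mem' := fun ha hb => ⟨⟨ha.1.1.add hb.1.1, ha.1.2.add hb.1.2⟩, ha.2.1.add_zero hb.2.1,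
    ha.2.2.add_zero hb.2.2⟩
  smul_mem' := fun c _ ha => ⟨⟨ha.1.1.smul c, ha.1.2.smul c⟩, ha.2.1.smul_zero c,
    ha.2.2.smul_zero c⟩

/-- The operator `𝒜 : D(𝒜) ⊂ H → H`,
`𝒜(u, v) = Π (-ν Δu + u_x U + v U', -ν Δv + v_x U)`, where `Π` is the orthogonal (Leray)
projector onto `H` and `U` is the Poiseuille profile. -/
def oseen (ν C : ℝ) : H →ₗ.[ℂ] H where
  domain := oseenDomain
  toFun :=
    { toFun := fun w => H.orthogonalProjectionOnto (oseenExpr ν C ((w : H) : VectorL2))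
      map_add' := fun w z => by
        rw [← map_add]
        congr 1
        obtain ⟨⟨hw1, hw2⟩, -⟩ := w.2
        obtain ⟨⟨hz1, hz2⟩, -⟩ := z.2
        refine (WithLp.ofLp_injective 2) (Prod.ext ?_ ?_)
        · simp only [oseenExpr, Submodule.coe_add, WithLp.add_fst, WithLp.add_snd,
            (hw1.deriv_add hz1).1, (hw1.deriv_add hz1).2, map_add, smul_add, WithLp.ofLp_add,
            Prod.fst_add]
          abel
        · simp only [oseenExpr, Submodule.coe_add, WithLp.add_snd,
            (hw2.deriv_add hz2).1, (hw2.deriv_add hz2).2, map_add, smul_add, WithLp.ofLp_add,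
            Prod.snd_add]
          abel
      map_smul' := fun c w => by
        rw [RingHom.id_apply, ← map_smul]
        congr 1
        obtain ⟨⟨hw1, hw2⟩, -⟩ := w.2
        refine (WithLp.ofLp_injective 2) (Prod.ext ?_ ?_)
        · simp only [oseenExpr, Submodule.coe_smul, WithLp.smul_fst, WithLp.smul_snd,
            (hw1.deriv_smul c).1, (hw1.deriv_smul c).2, map_smul, WithLp.ofLp_smul,
            Prod.smul_fst, smul_add, smul_neg, smul_comm c (ν : ℂ)]
        · simp only [oseenExpr, Submodule.coe_smul, WithLp.smul_snd,
            (hw2.deriv_smul c).1, (hw2.deriv_smul c).2, map_smul, WithLp.ofLp_smul,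
            Prod.smul_snd, smul_add, smul_neg, smul_comm c (ν : ℂ)] }

/-- `w` is an eigenfunction of the operator `T` in `H` for the eigenvalue `μ`. -/
def IsEigenfunction (T : H →ₗ.[ℂ] H) (μ : ℂ) (w : H) : Prop :=
  w ≠ 0 ∧ ∃ hw : w ∈ T.domain, T ⟨w, hw⟩ = μ • w

end PeriodicChannel

end

/-! Expand an eigenfunction in Fourier modes in `x`. Since the mode `k = 0` is absent from `H` and
`ik u_k + v_k' = 0`, the field is determined by the `v_k` with `k ≠ 0`. Testing the eigenvalue
equation with solenoidal fields removes the pressure and leaves for `z = v_k` a clamped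
Orr–Sommerfeld equation. With `w = z'' - K²z` it reads `ν(w'' - K²w) = iKUw - iKU''z - μw` with `K =
k` for `𝒜`, and `ν(w'' - K²w) = iKUw + 2iKU'z' - μw` with `K = -k` for `𝒜*`. The parameter `σ ∈ {0,
1}` covers both.

Existence of the normal derivative. The real part of the equation against `z̄` bounds `(νK² -
|C|/2)(|z'|² + K²|z|²)`, integrated over the channel, by zero (`real_eq_zero_of_large`), because `Re
μ ≤ 0` and `|U'| ≤ |C|`. So only finitely many modes survive. The field is therefore a trigonometric
polynomial in `x` with smooth enough coefficients, and its normal derivative is classical.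

Nonvanishing. If the normal derivative of `u` vanishes, then `z'' = 0` at both walls, besides `z =
z' = 0`. For `𝒜`, test against `w̄`, which is now zero at the walls: `U'' = 2C` is constant and `∫ z
w̄` is real, so the term with `U''` has no real part. This leaves `ν∫|w'|² + (νK² - Re μ)∫|w|² = 0`,
hence `w = 0` and `z = 0` (`real_eq_zero_of_direct`). For `𝒜*`, write `μ = m + iKc` and `V = U - c`.
The equation is equivalent to `(D² - K²)Φ = -2iCK z` with `Φ = νw - iKVz + mz`, and `Φ` vanishes at
the walls. Since `∫ (D² - K²)Φ · Φ̄` is real, `Re ∫ z Φ̄ = 0`, which says `ν∫|z'|² + (νK² - m)∫|z|²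
= 0` (`real_eq_zero_of_adjoint`). Here `C ≠ 0` is essential.

Regularity. An element of the domain of `𝒜*` is a priori only in `L²`. Both eigenvalue problems are
therefore put in a very weak form, with all four derivatives on clamped test functions, and
`exists_classical_of_veryWeak` makes the solutions classical. Density of the domain
(`dense_oseenDomain`) makes the adjoint meaningful. -/

noncomputable section

namespace PeriodicChannel

/-! ### Primitives and test functions on the unit interval -/

/-- The primitive of `f` that vanishes at `0`. -/
def primitive (f : ℝ → ℂ) (y : ℝ) : ℂ := ∫ t in (0 : ℝ)..y, f t

@[simp]
lemma primitive_zero (f : ℝ → ℂ) : primitive f 0 = 0 := by simp [primitive]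

lemma hasDerivAt_primitive {f : ℝ → ℂ} (hf : Continuous f) (y : ℝ) :
    HasDerivAt (primitive f) (f y) y :=
  intervalIntegral.integral_hasDerivAt_right (hf.intervalIntegrable _ _)
    hf.stronglyMeasurable.stronglyMeasurableAtFilter hf.continuousAt

lemma deriv_primitive {f : ℝ → ℂ} (hf : Continuous f) : deriv (primitive f) = f :=
  funext fun y => (hasDerivAt_primitive hf y).deriv

lemma continuous_primitive {f : ℝ → ℂ} (hf : ∀ a b, IntervalIntegrable f volume a b) :
    Continuous (primitive f) :=
  intervalIntegral.continuous_primitive hf 0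

lemma contDiff_primitive {f : ℝ → ℂ} {n : ℕ∞} (hf : ContDiff ℝ n f) :
    ContDiff ℝ (n + 1) (primitive f) := by
  rw [contDiff_succ_iff_deriv]
  refine ⟨fun y => (hasDerivAt_primitive hf.continuous y).differentiableAt, by simp, ?_⟩
  rwa [deriv_primitive hf.continuous]

lemma contDiff_infty_primitive {f : ℝ → ℂ} (hf : ContDiff ℝ ∞ f) :
    ContDiff ℝ ∞ (primitive f) :=
  contDiff_primitive (n := ⊤) hf

lemma contDiff_deriv_infty {f : ℝ → ℂ} (hf : ContDiff ℝ ∞ f) : ContDiff ℝ ∞ (deriv f) :=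
  (contDiff_infty_iff_deriv.1 hf).2

lemma hasDerivAt_of_contDiff_infty {f : ℝ → ℂ} (hf : ContDiff ℝ ∞ f) (y : ℝ) :
    HasDerivAt f (deriv f y) y :=
  ((hf.differentiable (by simp)) y).hasDerivAt

/-- Smooth functions with compact support in the open unit interval. -/
structure IsCompactTest (η : ℝ → ℂ) : Prop where
  contDiff : ContDiff ℝ ∞ η
  support : ∃ a b : ℝ, 0 < a ∧ b < 1 ∧ ∀ y, y ∉ Icc a b → η y = 0

/-- Smooth functions that vanish to first order at the endpoints of the unit interval. -/
structure IsClamped (ψ : ℝ → ℂ) : Prop where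
  contDiff : ContDiff ℝ ∞ ψ
  zero : ψ 0 = 0
  one : ψ 1 = 0
  deriv_zero : deriv ψ 0 = 0
  deriv_one : deriv ψ 1 = 0

lemma IsCompactTest.eventually_zero {η : ℝ → ℂ} (h : IsCompactTest η) {y : ℝ}
    (hy : y ≤ 0 ∨ 1 ≤ y) : η =ᶠ[nhds y] 0 := by
  obtain ⟨a, b, ha, hb, hab⟩ := h.support
  have : (Icc a b)ᶜ ∈ nhds y := isClosed_Icc.isOpen_compl.mem_nhds fun h => by
    rcases hy with hy | hy
    · linarith [h.1]
    · linarith [h.2]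
  filter_upwards [this] with t ht using hab t ht

lemma IsCompactTest.isClamped {η : ℝ → ℂ} (h : IsCompactTest η) : IsClamped η := by
  have h0 := h.eventually_zero (y := 0) (by simp)
  have h1 := h.eventually_zero (y := 1) (by simp)
  exact ⟨h.contDiff, h0.eq_of_nhds, h1.eq_of_nhds, by rw [h0.deriv_eq]; simp,
    by rw [h1.deriv_eq]; simp⟩

lemma ae_eq_zero_of_compactTest {d : ℝ → ℂ} (hd : IntervalIntegrable d volume 0 1)
    (h : ∀ η, IsCompactTest η → ∫ y in (0 : ℝ)..1, d y * η y = 0) :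
    ∀ᵐ y ∂volume.restrict (Ioo (0 : ℝ) 1), d y = 0 := by
  have hi : IntegrableOn d (Ioo 0 1) := by
    rw [intervalIntegrable_iff_integrableOn_Ioo_of_le zero_le_one] at hd
    exact hd
  rw [ae_restrict_iff' measurableSet_Ioo]
  refine isOpen_Ioo.ae_eq_zero_of_integral_contDiff_smul_eq_zero hi.locallyIntegrableOn
    fun g hg hc hs => ?_
  have hK : ∃ a b : ℝ, 0 < a ∧ b < 1 ∧ ∀ y, y ∉ Icc a b → g y = 0 := by
    rcases (tsupport g).eq_empty_or_nonempty with he | hne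
    · refine ⟨1 / 2, 1 / 2, by norm_num, by norm_num, fun y _ => ?_⟩
      by_contra h
      have := subset_tsupport g h
      rw [he] at this
      exact this
    · obtain ⟨a, ha⟩ := hc.exists_isLeast hne
      obtain ⟨b, hb⟩ := hc.exists_isGreatest hne
      refine ⟨a, b, (hs ha.1).1, (hs hb.1).2, fun y hy => ?_⟩
      by_contra h
      exact hy ⟨ha.2 (subset_tsupport g h), hb.2 (subset_tsupport g h)⟩
  have ht : IsCompactTest fun y => (g y : ℂ) :=
    ⟨Complex.ofRealCLM.contDiff.comp hg, by
      obtain ⟨a, b, ha, hb, hab⟩ := hK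
      exact ⟨a, b, ha, hb, fun y hy => by simp [hab y hy]⟩⟩
  rw [← h _ ht, intervalIntegral.integral_of_le zero_le_one, integral_Ioc_eq_integral_Ioo,
    ← setIntegral_eq_integral_of_forall_compl_eq_zero (s := Ioo (0 : ℝ) 1)]
  · refine setIntegral_congr_fun measurableSet_Ioo fun y _ => ?_
    simp only [Complex.real_smul]
    ring
  · intro y hy
    have : g y = 0 := by
      by_contra h
      exact hy (hs (subset_tsupport g h))
    simp [this]

lemma ae_restrict_uIoc {P : ℝ → Prop} (h : ∀ᵐ y ∂volume.restrict (Ioo (0 : ℝ) 1), P y) {t : ℝ}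
    (ht : t ∈ Icc (0 : ℝ) 1) : ∀ᵐ y ∂volume, y ∈ uIoc 0 t → P y := by
  have h1 : ∀ᵐ y : ℝ, y ≠ 1 := by simp [ae_iff]
  rw [ae_restrict_iff' measurableSet_Ioo] at h
  filter_upwards [h, h1] with y hy hy1 hm
  rw [uIoc_of_le ht.1] at hm
  exact hy ⟨hm.1, lt_of_le_of_ne (hm.2.trans ht.2) hy1⟩

lemma intervalIntegral_congr_Ioo {f g : ℝ → ℂ}
    (h : ∀ᵐ y ∂volume.restrict (Ioo (0 : ℝ) 1), f y = g y) {t : ℝ} (ht : t ∈ Icc (0 : ℝ) 1) :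
    ∫ y in (0 : ℝ)..t, f y = ∫ y in (0 : ℝ)..t, g y :=
  intervalIntegral.integral_congr_ae (ae_restrict_uIoc h ht)

/-- Integration by parts for the primitive of an integrable function. -/
lemma integral_primitive_mul {G h h' : ℝ → ℂ} (hG : IntervalIntegrable G volume 0 1)
    (hh : ∀ y, HasDerivAt h (h' y) y) (hc : Continuous h') :
    ∫ y in (0 : ℝ)..1, primitive G y * h' y =
      primitive G 1 * h 1 - ∫ y in (0 : ℝ)..1, G y * h y := by
  have hi : IntegrableOn G (Ioc 0 1) := by
    rwa [intervalIntegrable_iff_integrableOn_Ioc_of_le zero_le_one] at hG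
  have hhi : IntegrableOn h' (Ioc 0 1) := (hc.integrableOn_Icc).mono_set Ioc_subset_Icc_self
  have hhc : Continuous h := continuous_iff_continuousAt.2 fun y => (hh y).continuousAt
  -- Since `G` is only integrable, its primitive need not be differentiable everywhere. The formula
  -- is instead Fubini's theorem on the triangle `t ≤ y`, with integrand `h'(y) G(t)`.
  set F : ℝ × ℝ → ℂ := {q : ℝ × ℝ | q.2 ≤ q.1}.indicator fun q => h' q.1 * G q.2 with hF
  have hm : MeasurableSet {q : ℝ × ℝ | q.2 ≤ q.1} := measurableSet_le measurable_snd measurable_fst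
  have hFi : Integrable F ((volume.restrict (Ioc (0 : ℝ) 1)).prod (volume.restrict (Ioc (0 : ℝ) 1))) :=
    (Integrable.mul_prod hhi hi).indicator hm
  have key := integral_integral_swap (f := fun y t => F (y, t)) hFi
  have e1 : ∀ y ∈ Ioc (0 : ℝ) 1, ∫ t in Ioc (0 : ℝ) 1, F (y, t) = primitive G y * h' y := by
    intro y hy
    have : ∀ t, F (y, t) = (Iic y).indicator (fun t => h' y * G t) t := fun t => by
      simp only [hF, indicator, mem_ofPred_eq, mem_Iic]
    simp only [this]
    rw [setIntegral_indicator measurableSet_Iic, integral_const_mul, primitive,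
      intervalIntegral.integral_of_le hy.1.le, mul_comm]
    congr 3
    ext t
    simp only [mem_inter_iff, mem_Ioc, mem_Iic]
    constructor
    · rintro ⟨h1, h2⟩
      exact ⟨h1.1, h2⟩
    · rintro ⟨h1, h2⟩
      exact ⟨⟨h1, h2.trans hy.2⟩, h2⟩
  have e2 : ∀ t ∈ Ioc (0 : ℝ) 1, ∫ y in Ioc (0 : ℝ) 1, F (y, t) = G t * h 1 - G t * h t := by
    intro t ht
    have : ∀ y, F (y, t) = (Ici t).indicator (fun y => h' y * G t) y := fun y => by
      simp only [hF, indicator, mem_ofPred_eq, mem_Ici]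
    simp only [this]
    rw [setIntegral_indicator measurableSet_Ici, integral_mul_const]
    have hs : Ioc (0 : ℝ) 1 ∩ Ici t = Icc t 1 := by
      ext y
      simp only [mem_inter_iff, mem_Ioc, mem_Ici, mem_Icc]
      constructor
      · rintro ⟨h1, h2⟩
        exact ⟨h2, h1.2⟩
      · rintro ⟨h1, h2⟩
        exact ⟨⟨ht.1.trans_le h1, h2⟩, h1⟩
    rw [hs, integral_Icc_eq_integral_Ioc, ← intervalIntegral.integral_of_le ht.2,
      intervalIntegral.integral_eq_sub_of_hasDerivAt (fun y _ => hh y) (hc.intervalIntegrable _ _)]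
    ring
  rw [setIntegral_congr_fun measurableSet_Ioc e1, setIntegral_congr_fun measurableSet_Ioc e2] at key
  have i2 : IntegrableOn (fun t => G t * h t) (Ioc 0 1) := by
    have := hG.mul_continuousOn (hhc.continuousOn (s := uIcc 0 1))
    rwa [intervalIntegrable_iff_integrableOn_Ioc_of_le zero_le_one] at this
  rw [integral_sub (hi.mul_const _) i2, integral_mul_const] at key
  rw [intervalIntegral.integral_of_le zero_le_one, intervalIntegral.integral_of_le zero_le_one, key,
    primitive, intervalIntegral.integral_of_le zero_le_one]

lemma integral_deriv_mul_Ioo {f f' g g' : ℝ → ℂ} (hf : ∀ y, HasDerivAt f (f' y) y)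
    (hg : ∀ y, HasDerivAt g (g' y) y) (hf' : Continuous f') (hg' : Continuous g') :
    ∫ y in (0 : ℝ)..1, f y * g' y = f 1 * g 1 - f 0 * g 0 - ∫ y in (0 : ℝ)..1, f' y * g y :=
  intervalIntegral.integral_mul_deriv_eq_deriv_mul (fun y _ => hf y) (fun y _ => hg y)
    (hf'.intervalIntegrable _ _) (hg'.intervalIntegrable _ _)

lemma IsCompactTest.sub_smul {η θ : ℝ → ℂ} (hη : IsCompactTest η) (hθ : IsCompactTest θ) (c : ℂ) :
    IsCompactTest fun y => η y - c * θ y := by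
  obtain ⟨a, b, ha, hb, h⟩ := hη.support
  obtain ⟨a', b', ha', hb', h'⟩ := hθ.support
  refine ⟨hη.contDiff.sub (contDiff_const.mul hθ.contDiff),
    min a a', max b b', lt_min ha ha', max_lt hb hb', fun y hy => ?_⟩
  rw [h y fun hm => hy ⟨(min_le_left _ _).trans hm.1, hm.2.trans (le_max_left _ _)⟩,
    h' y fun hm => hy ⟨(min_le_right _ _).trans hm.1, hm.2.trans (le_max_right _ _)⟩]
  simp

/-- To the left of the support the integral from `0` is zero. To the right it equals an integral
from `1`, because the total mass vanishes, and that integral is zero too. -/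
lemma IsCompactTest.primitive {η : ℝ → ℂ} (hη : IsCompactTest η)
    (h0 : ∫ y in (0 : ℝ)..1, η y = 0) : IsCompactTest (primitive η) := by
  obtain ⟨a, b, ha, hb, h⟩ := hη.support
  refine ⟨contDiff_infty_primitive hη.contDiff, a, b, ha, hb, fun y hy => ?_⟩
  have key : ∀ s : ℝ, (∀ t ∈ uIcc s y, t ∉ Icc a b) → ∫ t in s..y, η t = 0 := fun s hs => by
    rw [intervalIntegral.integral_congr fun t ht => h t (hs t ht)]
    simp
  rw [mem_Icc, not_and_or, not_le, not_le] at hy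
  rcases hy with hy | hy
  · exact key 0 fun t ht hm => by
      have := ht.2
      have : max 0 y < a := max_lt ha hy
      linarith [hm.1]
  · have := key 1 fun t ht hm => by
      have := ht.1
      have : b < min 1 y := lt_min hb hy
      linarith [hm.2]
    rw [PeriodicChannel.primitive, ← intervalIntegral.integral_add_adjacent_intervals
      (hη.contDiff.continuous.intervalIntegrable 0 1)
      (hη.contDiff.continuous.intervalIntegrable 1 y), h0, this, add_zero]

/-- If the integrals of `d` against all derivatives of compactly supported functions vanish, then
`d` is constant. -/
lemma ae_eq_const_of_compactTest {d : ℝ → ℂ} (hd : IntervalIntegrable d volume 0 1)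
    (h : ∀ η, IsCompactTest η → ∫ y in (0 : ℝ)..1, d y * deriv η y = 0) :
    ∃ c, ∀ᵐ y ∂volume.restrict (Ioo (0 : ℝ) 1), d y = c := by
  -- Du Bois-Reymond's argument: fix one test function of nonzero mean. If there were none, the
  -- constant `1` would be orthogonal to all test functions.
  obtain ⟨θ, hθ, hθ0⟩ : ∃ θ, IsCompactTest θ ∧ ∫ y in (0 : ℝ)..1, θ y ≠ 0 := by
    by_contra! hcon
    have := ae_eq_zero_of_compactTest (d := fun _ => 1) (by simp) fun η hη => by
      simpa using hcon η hη
    rw [ae_restrict_iff' measurableSet_Ioo] at this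
    have hv : volume (Ioo (0 : ℝ) 1) = 0 := by
      refine measure_mono_null (fun y hy => ?_) (ae_iff.1 this)
      simpa using hy
    simp at hv
  set c := (∫ y in (0 : ℝ)..1, d y * θ y) / ∫ y in (0 : ℝ)..1, θ y with hc
  refine ⟨c, ?_⟩
  have := ae_eq_zero_of_compactTest (d := fun y => d y - c) (hd.sub (by simp)) fun η hη => ?_
  · filter_upwards [this] with y hy using sub_eq_zero.1 hy
  -- Subtracting `m θ` from `η` leaves mean zero, so the difference is the derivative of a compactly
  -- supported function and `h` applies to it.
  set m := (∫ y in (0 : ℝ)..1, η y) / ∫ y in (0 : ℝ)..1, θ y with hm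
  have iη := hη.contDiff.continuous.intervalIntegrable (μ := volume) 0 1
  have iθ := hθ.contDiff.continuous.intervalIntegrable (μ := volume) 0 1
  have dη := hd.mul_continuousOn (hη.contDiff.continuous.continuousOn (s := uIcc 0 1))
  have dθ := hd.mul_continuousOn (hθ.contDiff.continuous.continuousOn (s := uIcc 0 1))
  have hs := hη.sub_smul hθ m
  have hp := h _ (hs.primitive (by
    rw [intervalIntegral.integral_sub iη (iθ.const_mul m), intervalIntegral.integral_const_mul, hm,
      div_mul_cancel₀ _ hθ0, sub_self]))
  rw [deriv_primitive hs.contDiff.continuous] at hp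
  simp only [mul_sub, sub_mul, mul_left_comm _ m] at hp ⊢
  rw [intervalIntegral.integral_sub dη (dθ.const_mul m), intervalIntegral.integral_const_mul] at hp
  rw [intervalIntegral.integral_sub dη (iη.const_mul c), intervalIntegral.integral_const_mul]
  rw [← hp, hc, hm]
  ring

/-! ### Regularity of very weak solutions of clamped fourth order equations -/

lemma natCast_le_infty (n : ℕ) : (n : WithTop ℕ∞) ≤ ∞ := by exact_mod_cast le_top

/-- The cubic polynomial that vanishes to first order at `0` and takes at `1` the value `-q` with
derivative `-d`. -/
def clampCubic (q d : ℂ) (y : ℝ) : ℂ := (d - 3 * q) * (y : ℂ) ^ 2 + (2 * q - d) * (y : ℂ) ^ 3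

/-- The derivative of `clampCubic`. -/
def clampCubic₁ (q d : ℂ) (y : ℝ) : ℂ :=
  2 * (d - 3 * q) * (y : ℂ) + 3 * (2 * q - d) * (y : ℂ) ^ 2

/-- The second derivative of `clampCubic`. -/
def clampCubic₂ (q d : ℂ) (y : ℝ) : ℂ := 2 * (d - 3 * q) + 6 * (2 * q - d) * (y : ℂ)

lemma hasDerivAt_ofReal_pow (n : ℕ) (y : ℝ) :
    HasDerivAt (fun y : ℝ => (y : ℂ) ^ n) (n * (y : ℂ) ^ (n - 1)) y := by
  simpa using (hasDerivAt_pow n y).ofReal_comp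

lemma hasDerivAt_ofReal (y : ℝ) : HasDerivAt (fun y : ℝ => (y : ℂ)) 1 y := by
  simpa using (hasDerivAt_id y).ofReal_comp

lemma hasDerivAt_clampCubic (q d : ℂ) (y : ℝ) :
    HasDerivAt (clampCubic q d) (clampCubic₁ q d y) y := by
  refine (((hasDerivAt_ofReal_pow 2 y).const_mul (d - 3 * q)).add
    ((hasDerivAt_ofReal_pow 3 y).const_mul (2 * q - d))).congr_deriv ?_
  simp [clampCubic₁]
  ring

lemma hasDerivAt_clampCubic₁ (q d : ℂ) (y : ℝ) :
    HasDerivAt (clampCubic₁ q d) (clampCubic₂ q d y) y := by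
  refine (((hasDerivAt_ofReal y).const_mul (2 * (d - 3 * q))).add
    ((hasDerivAt_ofReal_pow 2 y).const_mul (3 * (2 * q - d)))).congr_deriv ?_
  simp [clampCubic₂]
  ring

lemma hasDerivAt_clampCubic₂ (q d : ℂ) (y : ℝ) :
    HasDerivAt (clampCubic₂ q d) (6 * (2 * q - d)) y := by
  refine (((hasDerivAt_ofReal y).const_mul (6 * (2 * q - d))).const_add
    (2 * (d - 3 * q))).congr_deriv ?_
  simp

lemma contDiff_clampCubic (q d : ℂ) : ContDiff ℝ ∞ (clampCubic q d) :=
  (contDiff_const.mul (Complex.ofRealCLM.contDiff.pow 2)).add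
    (contDiff_const.mul (Complex.ofRealCLM.contDiff.pow 3))

lemma continuous_clampCubic₁ (q d : ℂ) : Continuous (clampCubic₁ q d) :=
  continuous_iff_continuousAt.2 fun y => (hasDerivAt_clampCubic₁ q d y).continuousAt

lemma continuous_clampCubic₂ (q d : ℂ) : Continuous (clampCubic₂ q d) :=
  continuous_iff_continuousAt.2 fun y => (hasDerivAt_clampCubic₂ q d y).continuousAt

/-- Every smooth function is the fourth derivative of a clamped function. -/
lemma exists_clamped_deriv_eq {h : ℝ → ℂ} (hh : ContDiff ℝ ∞ h) :
    ∃ ψ, IsClamped ψ ∧ deriv (deriv (deriv (deriv ψ))) = h := by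
  have c1 := contDiff_infty_primitive hh
  have c2 := contDiff_infty_primitive c1
  have c3 := contDiff_infty_primitive c2
  have c4 := contDiff_infty_primitive c3
  set g := primitive (primitive (primitive h)) with hg
  -- The fourfold primitive of `h` already vanishes to first order at `0`. Its value `q` and slope
  -- `d` at `1` are cancelled by a cubic, which the fourth derivative does not see.
  set q := primitive g 1 with hq
  set d := g 1 with hd
  have d1 : ∀ y, HasDerivAt (fun y => primitive g y + clampCubic q d y)
      (g y + clampCubic₁ q d y) y := fun y =>
    (hasDerivAt_primitive c3.continuous y).add (hasDerivAt_clampCubic q d y)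
  have d2 : ∀ y, HasDerivAt (fun y => g y + clampCubic₁ q d y)
      (primitive (primitive h) y + clampCubic₂ q d y) y := fun y =>
    (hasDerivAt_primitive c2.continuous y).add (hasDerivAt_clampCubic₁ q d y)
  have d3 : ∀ y, HasDerivAt (fun y => primitive (primitive h) y + clampCubic₂ q d y)
      (primitive h y + 6 * (2 * q - d)) y := fun y =>
    (hasDerivAt_primitive c1.continuous y).add (hasDerivAt_clampCubic₂ q d y)
  have d4 : ∀ y, HasDerivAt (fun y => primitive h y + 6 * (2 * q - d)) (h y) y := fun y =>
    (hasDerivAt_primitive hh.continuous y).add_const _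
  have e1 := funext fun y => (d1 y).deriv
  have e2 := funext fun y => (d2 y).deriv
  have e3 := funext fun y => (d3 y).deriv
  have e4 := funext fun y => (d4 y).deriv
  refine ⟨fun y => primitive g y + clampCubic q d y, ⟨c4.add (contDiff_clampCubic q d), ?_, ?_, ?_,
    ?_⟩, by rw [e1, e2, e3, e4]⟩
  · simp [clampCubic]
  · simp only [clampCubic, ← hq, Complex.ofReal_one]
    ring
  · rw [e1]
    simp [clampCubic₁, hg]
  · rw [e1]
    simp only [clampCubic₁, ← hd, Complex.ofReal_one]
    ring

/-- The function `F` for which `∫ f (p ψ'' + s ψ' + r ψ) = ∫ F ψ''` for all clamped `ψ`. -/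
def loadOf (p s r f : ℝ → ℂ) (y : ℝ) : ℂ :=
  p y * f y - primitive (fun t => s t * f t) y + primitive (primitive fun t => r t * f t) y

/-- A solution of `ζ'''' = (p f)'' - (s f)' + r f`. -/
def solveLoad (p s r : ℝ → ℂ) (q d : ℂ) (f : ℝ → ℂ) (y : ℝ) : ℂ :=
  primitive (primitive (loadOf p s r f)) y + clampCubic q d y

section
variable {p s r : ℝ → ℂ}

lemma intervalIntegrable_loadOf (hp : ContDiff ℝ ∞ p) (hs : ContDiff ℝ ∞ s) (hr : ContDiff ℝ ∞ r)
    {f : ℝ → ℂ} (hf : ∀ a b, IntervalIntegrable f volume a b) (a b : ℝ) :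
    IntervalIntegrable (loadOf p s r f) volume a b := by
  have key : ∀ {g : ℝ → ℂ}, Continuous g → ∀ a b, IntervalIntegrable (fun t => g t * f t) volume a b :=
    fun hg a b => (hf a b).continuousOn_mul hg.continuousOn
  have h1 := continuous_primitive (key hs.continuous)
  have h2 := continuous_primitive (fun a b =>
    (continuous_primitive (key hr.continuous)).intervalIntegrable (μ := volume) a b)
  exact ((key hp.continuous a b).sub (h1.intervalIntegrable a b)).add (h2.intervalIntegrable a b)

lemma contDiff_loadOf (hp : ContDiff ℝ ∞ p) (hs : ContDiff ℝ ∞ s) (hr : ContDiff ℝ ∞ r)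
    {f : ℝ → ℂ} {n : ℕ} (hf : ContDiff ℝ n f) : ContDiff ℝ n (loadOf p s r f) := by
  have hle := natCast_le_infty n
  have h1 : ContDiff ℝ (n + 1) (primitive fun t => s t * f t) :=
    contDiff_primitive (n := n) ((hs.of_le hle).mul hf)
  have h2 : ContDiff ℝ (n + 1) (primitive fun t => r t * f t) :=
    contDiff_primitive (n := n) ((hr.of_le hle).mul hf)
  have h3 : ContDiff ℝ (n + 1) (primitive (primitive fun t => r t * f t)) :=
    contDiff_primitive (n := n) (h2.of_le le_self_add)
  exact (((hp.of_le hle).mul hf).sub (h1.of_le le_self_add)).add (h3.of_le le_self_add)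

/-- The load is as smooth as `f`, so the two outer primitives gain two derivatives. This gain drives
the bootstrap below. -/
lemma contDiff_solveLoad (hp : ContDiff ℝ ∞ p) (hs : ContDiff ℝ ∞ s) (hr : ContDiff ℝ ∞ r)
    (q d : ℂ) {f : ℝ → ℂ} {n : ℕ} (hf : ContDiff ℝ n f) :
    ContDiff ℝ (n + 2 : ℕ) (solveLoad p s r q d f) := by
  have h1 : ContDiff ℝ (n + 1 : ℕ) (primitive (loadOf p s r f)) := by
    exact_mod_cast contDiff_primitive (n := n) (contDiff_loadOf hp hs hr hf)
  have h2 : ContDiff ℝ (n + 2 : ℕ) (primitive (primitive (loadOf p s r f))) := by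
    have := contDiff_primitive (n := (n + 1 : ℕ)) h1
    exact_mod_cast this
  exact h2.add ((contDiff_clampCubic q d).of_le (natCast_le_infty _))

lemma primitive_congr_Ioo {f g : ℝ → ℂ} (h : ∀ᵐ y ∂volume.restrict (Ioo (0 : ℝ) 1), f y = g y)
    {t : ℝ} (ht : t ∈ Icc (0 : ℝ) 1) : primitive f t = primitive g t :=
  intervalIntegral_congr_Ioo h ht

lemma ae_Ioo_of_forall_Icc {P : ℝ → Prop} (h : ∀ y ∈ Icc (0 : ℝ) 1, P y) :
    ∀ᵐ y ∂volume.restrict (Ioo (0 : ℝ) 1), P y :=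
  (ae_restrict_iff' measurableSet_Ioo).2 (.of_forall fun y hy => h y (Ioo_subset_Icc_self hy))

lemma loadOf_congr {f g : ℝ → ℂ} (h : ∀ᵐ y ∂volume.restrict (Ioo (0 : ℝ) 1), f y = g y) :
    ∀ᵐ y ∂volume.restrict (Ioo (0 : ℝ) 1), loadOf p s r f y = loadOf p s r g y := by
  have hs : ∀ y ∈ Icc (0 : ℝ) 1, primitive (fun t => s t * f t) y = primitive (fun t => s t * g t) y :=
    fun y hy => primitive_congr_Ioo (by filter_upwards [h] with t ht; rw [ht]) hy
  have hr : ∀ y ∈ Icc (0 : ℝ) 1, primitive (fun t => r t * f t) y = primitive (fun t => r t * g t) y :=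
    fun y hy => primitive_congr_Ioo (by filter_upwards [h] with t ht; rw [ht]) hy
  have hr' : ∀ y ∈ Icc (0 : ℝ) 1, primitive (primitive fun t => r t * f t) y =
      primitive (primitive fun t => r t * g t) y :=
    fun y hy => primitive_congr_Ioo (ae_Ioo_of_forall_Icc hr) hy
  filter_upwards [h, ae_Ioo_of_forall_Icc hs, ae_Ioo_of_forall_Icc hr'] with y h1 h2 h3
  simp only [loadOf, h1, h2, h3]

/-- Primitives see only almost everywhere classes on `(0, 1)`. Equality almost everywhere of the
data thus becomes equality at every point of the closed interval, walls included. -/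
lemma solveLoad_congr (q d : ℂ) {f g : ℝ → ℂ}
    (h : ∀ᵐ y ∂volume.restrict (Ioo (0 : ℝ) 1), f y = g y) {t : ℝ} (ht : t ∈ Icc (0 : ℝ) 1) :
    solveLoad p s r q d f t = solveLoad p s r q d g t := by
  have := primitive_congr_Ioo (ae_Ioo_of_forall_Icc fun y hy =>
    primitive_congr_Ioo (loadOf_congr (p := p) (s := s) (r := r) h) hy) ht
  simp only [solveLoad, this]

lemma intervalIntegrable_primitive {G : ℝ → ℂ} (hG : IntervalIntegrable G volume 0 1) :
    IntervalIntegrable (primitive G) volume 0 1 :=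
  (intervalIntegral.continuousOn_primitive_interval' hG (by simp)).intervalIntegrable

lemma IsClamped.continuous_deriv {ψ : ℝ → ℂ} (hψ : IsClamped ψ) : Continuous (deriv ψ) :=
  (contDiff_deriv_infty hψ.contDiff).continuous

lemma IsClamped.continuous_deriv₂ {ψ : ℝ → ℂ} (hψ : IsClamped ψ) : Continuous (deriv (deriv ψ)) :=
  (contDiff_deriv_infty (contDiff_deriv_infty hψ.contDiff)).continuous

/-- Integrate by parts once in the term with `s` and twice in the term with `r`, never
differentiating `f`. The boundary terms vanish at `0` because the primitives do, and at `1` because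
`ψ` is clamped. -/
lemma integral_load {f : ℝ → ℂ} (hp : ContDiff ℝ ∞ p) (hs : ContDiff ℝ ∞ s) (hr : ContDiff ℝ ∞ r)
    (hf : IntervalIntegrable f volume 0 1) {ψ : ℝ → ℂ} (hψ : IsClamped ψ) :
    ∫ y in (0 : ℝ)..1, f y * (p y * deriv (deriv ψ) y + s y * deriv ψ y + r y * ψ y) =
      ∫ y in (0 : ℝ)..1, loadOf p s r f y * deriv (deriv ψ) y := by
  have hmul : ∀ {g : ℝ → ℂ}, Continuous g → IntervalIntegrable (fun t => g t * f t) volume 0 1 :=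
    fun hg => hf.continuousOn_mul hg.continuousOn
  have hmul' : ∀ {g k : ℝ → ℂ}, IntervalIntegrable g volume 0 1 → Continuous k →
      IntervalIntegrable (fun t => g t * k t) volume 0 1 :=
    fun hg hk => hg.mul_continuousOn hk.continuousOn
  have c1 := hψ.continuous_deriv
  have c2 := hψ.continuous_deriv₂
  have b1 := integral_primitive_mul (hmul hs.continuous)
    (hasDerivAt_of_contDiff_infty (contDiff_deriv_infty hψ.contDiff)) c2
  have b2 := integral_primitive_mul (intervalIntegrable_primitive (hmul hr.continuous))
    (hasDerivAt_of_contDiff_infty (contDiff_deriv_infty hψ.contDiff)) c2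
  have b3 := integral_primitive_mul (hmul hr.continuous)
    (hasDerivAt_of_contDiff_infty hψ.contDiff) c1
  rw [hψ.deriv_one] at b1 b2
  rw [hψ.one] at b3
  simp only [loadOf, add_mul, sub_mul, mul_add]
  rw [intervalIntegral.integral_add, intervalIntegral.integral_add, intervalIntegral.integral_add,
    intervalIntegral.integral_sub, b1, b2, b3]
  · simp only [mul_zero, zero_sub, sub_neg_eq_add, zero_add, mul_left_comm (f _), mul_assoc]
  · exact hmul' (hmul hp.continuous) c2
  · exact hmul' (intervalIntegrable_primitive (hmul hs.continuous)) c2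
  · exact (hmul' (hmul hp.continuous) c2).sub
      (hmul' (intervalIntegrable_primitive (hmul hs.continuous)) c2)
  · exact hmul' (intervalIntegrable_primitive (intervalIntegrable_primitive (hmul hr.continuous))) c2
  · exact hmul' hf (hp.continuous.mul c2)
  · exact hmul' hf (hs.continuous.mul c1)
  · exact (hmul' hf (hp.continuous.mul c2)).add (hmul' hf (hs.continuous.mul c1))
  · exact hmul' hf (hr.continuous.mul hψ.contDiff.continuous)

/-- Four integrations by parts leave only terms at `y = 1`. They are opposite to the boundary terms
of `integral_primitive_primitive_mul`, which is why the cubic is added in `solveLoad`. -/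
lemma integral_clampCubic_mul (q d : ℂ) {ψ : ℝ → ℂ} (hψ : IsClamped ψ) :
    ∫ y in (0 : ℝ)..1, clampCubic q d y * deriv (deriv (deriv (deriv ψ))) y =
      d * deriv (deriv ψ) 1 - q * deriv (deriv (deriv ψ)) 1 := by
  have s1 := contDiff_deriv_infty hψ.contDiff
  have s2 := contDiff_deriv_infty s1
  have s3 := contDiff_deriv_infty s2
  have s4 := contDiff_deriv_infty s3
  rw [integral_deriv_mul_Ioo (hasDerivAt_clampCubic q d) (hasDerivAt_of_contDiff_infty s3)
      (continuous_clampCubic₁ q d) s4.continuous,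
    integral_deriv_mul_Ioo (hasDerivAt_clampCubic₁ q d) (hasDerivAt_of_contDiff_infty s2)
      (continuous_clampCubic₂ q d) s3.continuous,
    integral_deriv_mul_Ioo (hasDerivAt_clampCubic₂ q d) (hasDerivAt_of_contDiff_infty s1)
      continuous_const s2.continuous, intervalIntegral.integral_const_mul,
    intervalIntegral.integral_eq_sub_of_hasDerivAt
      (fun y _ => hasDerivAt_of_contDiff_infty hψ.contDiff y) (s1.continuous.intervalIntegrable _ _),
    hψ.zero, hψ.one, hψ.deriv_zero, hψ.deriv_one]
  simp [clampCubic, clampCubic₁]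
  ring

lemma integral_primitive_primitive_mul {F : ℝ → ℂ} (hF : IntervalIntegrable F volume 0 1)
    {ψ : ℝ → ℂ} (hψ : IsClamped ψ) :
    ∫ y in (0 : ℝ)..1, primitive (primitive F) y * deriv (deriv (deriv (deriv ψ))) y =
      primitive (primitive F) 1 * deriv (deriv (deriv ψ)) 1 - primitive F 1 * deriv (deriv ψ) 1 +
        ∫ y in (0 : ℝ)..1, F y * deriv (deriv ψ) y := by
  have s1 := contDiff_deriv_infty hψ.contDiff
  have s2 := contDiff_deriv_infty s1
  have s3 := contDiff_deriv_infty s2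
  have s4 := contDiff_deriv_infty s3
  rw [integral_primitive_mul (intervalIntegrable_primitive hF) (hasDerivAt_of_contDiff_infty s3)
    s4.continuous, integral_primitive_mul hF (hasDerivAt_of_contDiff_infty s2) s3.continuous]
  ring

/-- Very weak solutions of `z'''' = (p z)'' - (s z)' + r z` with clamped boundary conditions are
classical solutions. -/
theorem exists_classical_of_veryWeak (hp : ContDiff ℝ ∞ p) (hs : ContDiff ℝ ∞ s)
    (hr : ContDiff ℝ ∞ r) {z : ℝ → ℂ} (hz : IntervalIntegrable z volume 0 1)
    (h : ∀ ψ, IsClamped ψ → ∫ y in (0 : ℝ)..1, z y * deriv (deriv (deriv (deriv ψ))) y =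
      ∫ y in (0 : ℝ)..1, z y * (p y * deriv (deriv ψ) y + s y * deriv ψ y + r y * ψ y)) :
    ∃ Z : ℝ → ℂ, ContDiff ℝ 4 Z ∧ Z 0 = 0 ∧ Z 1 = 0 ∧ deriv Z 0 = 0 ∧ deriv Z 1 = 0 ∧
      (∀ᵐ y ∂volume.restrict (Ioo (0 : ℝ) 1), z y = Z y) ∧
      ∀ y ∈ Ioo (0 : ℝ) 1, deriv (deriv (deriv (deriv Z))) y =
        deriv (deriv fun t => p t * Z t) y - deriv (fun t => s t * Z t) y + r y * Z y := by
  have hz' : Integrable ((Ioo (0 : ℝ) 1).indicator z) := by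
    rw [integrable_indicator_iff measurableSet_Ioo]
    rwa [intervalIntegrable_iff_integrableOn_Ioo_of_le zero_le_one] at hz
  -- Extension by zero makes every primitive continuous on the whole line; `z` itself is controlled
  -- only on `(0, 1)`.
  set w := (Ioo (0 : ℝ) 1).indicator z with hw
  have hzw : ∀ᵐ y ∂volume.restrict (Ioo (0 : ℝ) 1), z y = w y :=
    (ae_restrict_iff' measurableSet_Ioo).2 (.of_forall fun y hy => by rw [hw, indicator_of_mem hy])
  have hwi : ∀ a b, IntervalIntegrable w volume a b := fun a b => hz'.intervalIntegrable
  have hFi := intervalIntegrable_loadOf hp hs hr hwi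
  -- Value and slope at `1` of the part of the solution without the cubic. The same pair serves for
  -- `f₁`, `f₂` and `f₃`, because the loads of `w`, `f₁` and `f₂` agree almost everywhere on `(0,
  -- 1)`.
  set q := primitive (primitive (loadOf p s r w)) 1 with hq
  set d := primitive (loadOf p s r w) 1 with hd
  set f₁ := solveLoad p s r q d w with hf₁
  set f₂ := solveLoad p s r q d f₁ with hf₂
  set f₃ := solveLoad p s r q d f₂ with hf₃
  have c₁ : Continuous f₁ :=
    (continuous_primitive fun a b => (continuous_primitive hFi).intervalIntegrable a b).add
      (contDiff_clampCubic q d).continuous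
  have e₁ : ∀ᵐ y ∂volume.restrict (Ioo (0 : ℝ) 1), z y = f₁ y := by
    have := ae_eq_zero_of_compactTest (d := fun y => z y - f₁ y)
      (hz.sub (c₁.intervalIntegrable _ _)) fun η hη => ?_
    · filter_upwards [this] with y hy using sub_eq_zero.1 hy
    -- Every test function is a fourth derivative of a clamped function. For such a `ψ` both `z` and
    -- `f₁` integrate to the same load against `ψ''`, so `z - f₁` is orthogonal to all test
    -- functions.
    obtain ⟨ψ, hψ, rfl⟩ := exists_clamped_deriv_eq hη.contDiff
    have cη := hη.contDiff.continuous
    have i₁ : IntervalIntegrable (fun y => f₁ y * deriv (deriv (deriv (deriv ψ))) y) volume 0 1 :=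
      (c₁.mul cη).intervalIntegrable _ _
    have i₂ : IntervalIntegrable
        (fun y => clampCubic q d y * deriv (deriv (deriv (deriv ψ))) y) volume 0 1 :=
      ((contDiff_clampCubic q d).continuous.mul cη).intervalIntegrable _ _
    simp only [sub_mul]
    rw [intervalIntegral.integral_sub (hz.mul_continuousOn cη.continuousOn) i₁, h ψ hψ,
      intervalIntegral_congr_Ioo (g := fun y => w y *
        (p y * deriv (deriv ψ) y + s y * deriv ψ y + r y * ψ y))
        (by filter_upwards [hzw] with y hy; rw [hy]) (by simp),
      integral_load hp hs hr (hwi 0 1) hψ]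
    simp only [hf₁, solveLoad, add_mul]
    rw [intervalIntegral.integral_add
      ((intervalIntegrable_primitive (intervalIntegrable_primitive (hFi 0 1))).mul_continuousOn
        cη.continuousOn) i₂,
      integral_clampCubic_mul q d hψ, integral_primitive_primitive_mul (hFi 0 1) hψ]
    ring
  have hw₁ : ∀ᵐ y ∂volume.restrict (Ioo (0 : ℝ) 1), w y = f₁ y := by
    filter_upwards [hzw, e₁] with y h1 h2
    rw [← h1, h2]
  -- The bootstrap: `f₁` is continuous, hence `f₂` is `C²` and `f₃` is `C⁴`, while all three are the
  -- same function on `[0, 1]`.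
  have e₂ : ∀ y ∈ Icc (0 : ℝ) 1, f₁ y = f₂ y := fun y hy => solveLoad_congr q d hw₁ hy
  have e₃ : ∀ y ∈ Icc (0 : ℝ) 1, f₂ y = f₃ y := fun y hy =>
    solveLoad_congr q d (ae_Ioo_of_forall_Icc e₂) hy
  have hw₂ : ∀ᵐ y ∂volume.restrict (Ioo (0 : ℝ) 1), w y = f₂ y := by
    filter_upwards [hw₁, ae_Ioo_of_forall_Icc e₂] with y h1 h2
    rw [h1, h2]
  have s₂ : ContDiff ℝ 2 f₂ := by
    have := contDiff_solveLoad hp hs hr q d (n := 0) (by exact_mod_cast contDiff_zero.2 c₁)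
    exact_mod_cast this
  have s₃ : ContDiff ℝ 4 f₃ := by
    have := contDiff_solveLoad hp hs hr q d (n := 2) (by exact_mod_cast s₂)
    exact_mod_cast this
  have cF : Continuous (loadOf p s r f₂) :=
    (contDiff_loadOf hp hs hr (n := 0) (by exact_mod_cast contDiff_zero.2 s₂.continuous)).continuous
  have cF' : Continuous (primitive (loadOf p s r f₂)) :=
    continuous_primitive fun a b => cF.intervalIntegrable a b
  have d1 : deriv f₃ = fun y => primitive (loadOf p s r f₂) y + clampCubic₁ q d y :=
    funext fun y => ((hasDerivAt_primitive cF' y).add (hasDerivAt_clampCubic q d y)).deriv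
  have d2 : deriv (fun y => primitive (loadOf p s r f₂) y + clampCubic₁ q d y) =
      fun y => loadOf p s r f₂ y + clampCubic₂ q d y :=
    funext fun y => ((hasDerivAt_primitive cF y).add (hasDerivAt_clampCubic₁ q d y)).deriv
  have hle : (2 : WithTop ℕ∞) ≤ ∞ := natCast_le_infty 2
  have sp : ContDiff ℝ 2 fun t => p t * f₂ t := (hp.of_le hle).mul s₂
  have ss : ContDiff ℝ 2 fun t => s t * f₂ t := (hs.of_le hle).mul s₂
  have sr : ContDiff ℝ 2 fun t => r t * f₂ t := (hr.of_le hle).mul s₂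
  have sp' : ContDiff ℝ 1 (deriv fun t => p t * f₂ t) :=
    (contDiff_succ_iff_deriv (n := 1).1 (by exact_mod_cast sp)).2.2
  have cr' : Continuous (primitive fun t => r t * f₂ t) :=
    continuous_primitive fun a b => sr.continuous.intervalIntegrable a b
  have d3 : deriv (fun y => loadOf p s r f₂ y + clampCubic₂ q d y) =
      fun y => deriv (fun t => p t * f₂ t) y - s y * f₂ y + primitive (fun t => r t * f₂ t) y +
        6 * (2 * q - d) :=
    funext fun y => (((((sp.differentiable (by simp)) y).hasDerivAt.sub
      (hasDerivAt_primitive ss.continuous y)).add (hasDerivAt_primitive cr' y)).add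
        (hasDerivAt_clampCubic₂ q d y)).deriv
  have d4 : ∀ y, deriv (fun y => deriv (fun t => p t * f₂ t) y - s y * f₂ y +
      primitive (fun t => r t * f₂ t) y + 6 * (2 * q - d)) y =
      deriv (deriv fun t => p t * f₂ t) y - deriv (fun t => s t * f₂ t) y + r y * f₂ y := fun y =>
    (((((sp'.differentiable (by simp)) y).hasDerivAt.sub
      ((ss.differentiable (by simp)) y).hasDerivAt).add
        (hasDerivAt_primitive sr.continuous y)).add_const _).deriv
  refine ⟨f₃, s₃, ?_, ?_, ?_, ?_, ?_, ?_⟩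
  · simp [hf₃, solveLoad, clampCubic]
  · rw [← e₃ 1 (by simp), ← e₂ 1 (by simp), hf₁, solveLoad, ← hq]
    simp only [clampCubic, Complex.ofReal_one]
    ring
  · rw [d1]
    simp [clampCubic₁]
  · rw [d1]
    have : primitive (loadOf p s r f₂) 1 = d :=
      (primitive_congr_Ioo (loadOf_congr hw₂) (by simp)).symm
    simp only [this, clampCubic₁, Complex.ofReal_one]
    ring
  · filter_upwards [e₁, ae_Ioo_of_forall_Icc e₂, ae_Ioo_of_forall_Icc e₃] with y h1 h2 h3
    rw [h1, h2, h3]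
  · intro y hy
    -- The derivatives of `f₃` are computed in terms of `f₂`. The two agree only on `[0, 1]`, so
    -- passing back to `f₃` under the derivatives needs an interior point.
    have ev : f₂ =ᶠ[nhds y] f₃ := by
      filter_upwards [isOpen_Ioo.mem_nhds hy] with t ht using e₃ t (Ioo_subset_Icc_self ht)
    have evp : (fun t => p t * f₂ t) =ᶠ[nhds y] fun t => p t * f₃ t := by
      filter_upwards [ev] with t ht
      rw [ht]
    have evs : (fun t => s t * f₂ t) =ᶠ[nhds y] fun t => s t * f₃ t := by
      filter_upwards [ev] with t ht
      rw [ht]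
    rw [d1, d2, d3, d4, evp.deriv.deriv_eq, evs.deriv_eq, ev.eq_of_nhds]

end

/-! ### Energy identities for the Orr–Sommerfeld equations -/

/-- Classical solutions of the clamped Orr–Sommerfeld equation (`σ = 0`) and of its
adjoint (`σ = 1`) for the Poiseuille profile. -/
structure IsOrrSommerfeld (ν C K σ : ℝ) (μ : ℂ) (Z : ℝ → ℂ) : Prop where
  contDiff : ContDiff ℝ 4 Z
  zero : Z 0 = 0
  one : Z 1 = 0
  deriv_zero : deriv Z 0 = 0
  deriv_one : deriv Z 1 = 0
  ode : ∀ y ∈ Ioo (0 : ℝ) 1,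
    (ν : ℂ) * (deriv (deriv (deriv (deriv Z))) y - 2 * K ^ 2 * deriv (deriv Z) y + K ^ 4 * Z y) =
      Complex.I * K * (C * (y ^ 2 - y)) * (deriv (deriv Z) y - K ^ 2 * Z y) +
        2 * Complex.I * K * σ * (C * (2 * y - 1)) * deriv Z y -
        Complex.I * K * (1 - σ) * (2 * C) * Z y - μ * (deriv (deriv Z) y - K ^ 2 * Z y)

/-- Stands in for integrating an energy identity: `B` collects the boundary terms and `D` is the
nonnegative density. A monotone function with equal end values is constant. The derivative is needed
only inside, where the differential equation holds. -/
lemma eq_zero_of_monotone_energy {B D : ℝ → ℝ} (hB : ∀ y, ContinuousAt B y)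
    (hD : ∀ y ∈ Ioo (0 : ℝ) 1, HasDerivAt B (D y) y) (h0 : ∀ y ∈ Ioo (0 : ℝ) 1, 0 ≤ D y)
    (hb : B 0 = B 1) : ∀ y ∈ Ioo (0 : ℝ) 1, D y = 0 := by
  have hm : MonotoneOn B (Icc 0 1) := by
    refine monotoneOn_of_deriv_nonneg (convex_Icc 0 1) (fun y _ => (hB y).continuousWithinAt) ?_ ?_
    · rw [interior_Icc]
      exact fun y hy => (hD y hy).differentiableAt.differentiableWithinAt
    · rw [interior_Icc]
      exact fun y hy => by rw [(hD y hy).deriv]; exact h0 y hy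
  have hc : ∀ y ∈ Icc (0 : ℝ) 1, B y = B 0 := fun y hy =>
    le_antisymm ((hm hy (by simp) hy.2).trans hb.ge) (hm (by simp) hy hy.1)
  intro y hy
  rw [← (hD y hy).deriv]
  have : B =ᶠ[nhds y] fun _ => B 0 := by
    filter_upwards [isOpen_Ioo.mem_nhds hy] with t ht using hc t (Ioo_subset_Icc_self ht)
  rw [this.deriv_eq]
  simp

/-- The first four derivatives of the real and imaginary parts of a `C⁴` function. -/
structure RealJet (x₀ x₁ x₂ x₃ x₄ : ℝ → ℝ) : Prop where
  h₀ : ∀ y, HasDerivAt x₀ (x₁ y) y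
  h₁ : ∀ y, HasDerivAt x₁ (x₂ y) y
  h₂ : ∀ y, HasDerivAt x₂ (x₃ y) y
  h₃ : ∀ y, HasDerivAt x₃ (x₄ y) y

lemma hasDerivAt_of_contDiff_four {Z : ℝ → ℂ} (h : ContDiff ℝ 4 Z) (y : ℝ) :
    HasDerivAt Z (deriv Z y) y ∧ HasDerivAt (deriv Z) (deriv (deriv Z) y) y ∧
      HasDerivAt (deriv (deriv Z)) (deriv (deriv (deriv Z)) y) y ∧
      HasDerivAt (deriv (deriv (deriv Z))) (deriv (deriv (deriv (deriv Z))) y) y := by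
  have h3 : ContDiff ℝ 3 (deriv Z) := (contDiff_succ_iff_deriv (n := 3).1 (by exact_mod_cast h)).2.2
  have h2 : ContDiff ℝ 2 (deriv (deriv Z)) :=
    (contDiff_succ_iff_deriv (n := 2).1 (by exact_mod_cast h3)).2.2
  have h1 : ContDiff ℝ 1 (deriv (deriv (deriv Z))) :=
    (contDiff_succ_iff_deriv (n := 1).1 (by exact_mod_cast h2)).2.2
  exact ⟨(h.differentiable (by simp) y).hasDerivAt, (h3.differentiable (by simp) y).hasDerivAt,
    (h2.differentiable (by simp) y).hasDerivAt, (h1.differentiable (by simp) y).hasDerivAt⟩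

lemma hasDerivAt_re {f : ℝ → ℂ} {f' : ℂ} {y : ℝ} (h : HasDerivAt f f' y) :
    HasDerivAt (fun t => (f t).re) f'.re y :=
  Complex.reCLM.hasFDerivAt.comp_hasDerivAt y h

lemma hasDerivAt_im {f : ℝ → ℂ} {f' : ℂ} {y : ℝ} (h : HasDerivAt f f' y) :
    HasDerivAt (fun t => (f t).im) f'.im y :=
  Complex.imCLM.hasFDerivAt.comp_hasDerivAt y h

section
variable {ν C K σ m l : ℝ} {x₀ x₁ x₂ x₃ x₄ y₀ y₁ y₂ y₃ y₄ : ℝ → ℝ}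

lemma hasDerivAt_profile (C y : ℝ) :
    HasDerivAt (fun t => C * (t ^ 2 - t)) (C * (2 * y - 1)) y := by
  simpa using (((hasDerivAt_pow 2 y).sub (hasDerivAt_id y)).const_mul C)

lemma hasDerivAt_profile₁ (C y : ℝ) :
    HasDerivAt (fun t => C * (2 * t - 1)) (2 * C) y := by
  have := (((hasDerivAt_id y).const_mul 2).sub_const 1).const_mul C
  refine this.congr_deriv ?_
  ring

/-- The real part of the equation. -/
def OdeRe (ν C K σ m l : ℝ) (x₀ x₂ x₄ y₀ y₁ y₂ : ℝ → ℝ) : Prop := ∀ t ∈ Ioo (0 : ℝ) 1,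
  ν * (x₄ t - 2 * K ^ 2 * x₂ t + K ^ 4 * x₀ t) =
    -(K * (C * (t ^ 2 - t)) * (y₂ t - K ^ 2 * y₀ t)) - 2 * K * σ * (C * (2 * t - 1)) * y₁ t +
      K * (1 - σ) * (2 * C) * y₀ t - m * (x₂ t - K ^ 2 * x₀ t) + l * (y₂ t - K ^ 2 * y₀ t)

/-- The imaginary part of the equation. -/
def OdeIm (ν C K σ m l : ℝ) (y₀ y₂ y₄ x₀ x₁ x₂ : ℝ → ℝ) : Prop := ∀ t ∈ Ioo (0 : ℝ) 1,
  ν * (y₄ t - 2 * K ^ 2 * y₂ t + K ^ 4 * y₀ t) =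
    K * (C * (t ^ 2 - t)) * (x₂ t - K ^ 2 * x₀ t) + 2 * K * σ * (C * (2 * t - 1)) * x₁ t -
      K * (1 - σ) * (2 * C) * x₀ t - m * (y₂ t - K ^ 2 * y₀ t) - l * (x₂ t - K ^ 2 * x₀ t)

/-- This is the real part of the equation against `z̄`, for `z = x₀ + i y₀`. The only term of no
definite sign is `(2σ - 1) K U' Im(z' z̄)`; the equation and its adjoint differ in its sign alone.
Diffusion dominates it once `νK² > |C|/2`. No condition on `z''` at the walls is used. -/
lemma real_eq_zero_of_large (hx : RealJet x₀ x₁ x₂ x₃ x₄) (hy : RealJet y₀ y₁ y₂ y₃ y₄)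
    (hν : 0 < ν) (hm : m ≤ 0) (hσ : |2 * σ - 1| ≤ 1) (hK : K ≠ 0) (hKν : |C| / 2 < ν * K ^ 2)
    (hre : OdeRe ν C K σ m l x₀ x₂ x₄ y₀ y₁ y₂) (him : OdeIm ν C K σ m l y₀ y₂ y₄ x₀ x₁ x₂)
    (b0 : x₀ 0 = 0) (b1 : x₀ 1 = 0) (b2 : x₁ 0 = 0) (b3 : x₁ 1 = 0)
    (c0 : y₀ 0 = 0) (c1 : y₀ 1 = 0) (c2 : y₁ 0 = 0) (c3 : y₁ 1 = 0) :
    ∀ t ∈ Ioo (0 : ℝ) 1, x₀ t = 0 ∧ y₀ t = 0 := by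
  set B : ℝ → ℝ := fun t =>
    -ν * ((x₃ t - K ^ 2 * x₁ t) * x₀ t + (y₃ t - K ^ 2 * y₁ t) * y₀ t -
      ((x₂ t - K ^ 2 * x₀ t) * x₁ t + (y₂ t - K ^ 2 * y₀ t) * y₁ t)) -
    (K * (C * (t ^ 2 - t)) - l) * (y₁ t * x₀ t - x₁ t * y₀ t) +
    (2 * ν * K ^ 2 - m) * (x₁ t * x₀ t + y₁ t * y₀ t) with hB
  set e : ℝ → ℝ := fun t => (x₁ t ^ 2 + y₁ t ^ 2) + K ^ 2 * (x₀ t ^ 2 + y₀ t ^ 2) with he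
  set J : ℝ → ℝ := fun t => y₁ t * x₀ t - x₁ t * y₀ t with hJ
  set D : ℝ → ℝ := fun t => ν * (x₂ t ^ 2 + y₂ t ^ 2) + ν * K ^ 2 * (x₁ t ^ 2 + y₁ t ^ 2) +
    (2 * σ - 1) * K * (C * (2 * t - 1)) * J t + ν * K ^ 2 * e t - m * e t with hD
  have hBd : ∀ t, HasDerivAt B _ t := fun t =>
    (((((((hx.h₃ t).sub ((hx.h₁ t).const_mul (K ^ 2))).mul (hx.h₀ t)).add
      (((hy.h₃ t).sub ((hy.h₁ t).const_mul (K ^ 2))).mul (hy.h₀ t))).sub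
      ((((hx.h₂ t).sub ((hx.h₀ t).const_mul (K ^ 2))).mul (hx.h₁ t)).add
      (((hy.h₂ t).sub ((hy.h₀ t).const_mul (K ^ 2))).mul (hy.h₁ t)))).const_mul (-ν)).sub
      ((((hasDerivAt_profile C t).const_mul K).sub_const l).mul
        (((hy.h₁ t).mul (hx.h₀ t)).sub ((hx.h₁ t).mul (hy.h₀ t))))).add
      ((((hx.h₁ t).mul (hx.h₀ t)).add ((hy.h₁ t).mul (hy.h₀ t))).const_mul (2 * ν * K ^ 2 - m))
  have hBD : ∀ t ∈ Ioo (0 : ℝ) 1, HasDerivAt B (D t) t := fun t ht => by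
    refine (hBd t).congr_deriv ?_
    simp only [hD, he, hJ, Pi.sub_apply, Pi.mul_apply]
    linear_combination (-x₀ t) * hre t ht + (-y₀ t) * him t ht
  have he0 : ∀ t, 0 ≤ e t := fun t => by positivity
  have hkey : ∀ t ∈ Ioo (0 : ℝ) 1, (ν * K ^ 2 - |C| / 2) * e t ≤ D t := fun t ht => by
    -- The inequality `2|K z' z̄| ≤ |z'|² + K²|z|²`, with each sign of `K J` obtained by completing
    -- squares.
    have h1 : |K * J t| ≤ e t / 2 := by
      rw [abs_le]
      simp only [hJ, he]
      constructor
      · nlinarith [sq_nonneg (y₁ t + K * x₀ t), sq_nonneg (x₁ t - K * y₀ t)]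
      · nlinarith [sq_nonneg (y₁ t - K * x₀ t), sq_nonneg (x₁ t + K * y₀ t)]
    have h2 : |2 * t - 1| ≤ 1 := abs_le.2 ⟨by linarith [ht.1], by linarith [ht.2]⟩
    have h3 : |(2 * σ - 1) * K * (C * (2 * t - 1)) * J t| ≤ |C| * (e t / 2) := by
      have : (2 * σ - 1) * K * (C * (2 * t - 1)) * J t =
        (2 * σ - 1) * (2 * t - 1) * (C * (K * J t)) := by ring
      rw [this, abs_mul, abs_mul, abs_mul]
      calc _ ≤ 1 * 1 * (|C| * (e t / 2)) := by gcongr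
        _ = _ := by ring
    have h4 := (abs_le.1 h3).1
    have h5 := mul_nonneg (neg_nonneg.2 hm) (he0 t)
    have h6 : 0 ≤ ν * (x₂ t ^ 2 + y₂ t ^ 2) := by positivity
    have h7 : 0 ≤ ν * K ^ 2 * (x₁ t ^ 2 + y₁ t ^ 2) := by positivity
    simp only [hD]
    nlinarith
  have hz := eq_zero_of_monotone_energy (fun t => (hBd t).continuousAt) hBD
    (fun t ht => (mul_nonneg (by linarith) (he0 t)).trans (hkey t ht))
    (by simp only [hB, b0, b1, b2, b3, c0, c1, c2, c3]; ring)
  intro t ht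
  have h1 := hkey t ht
  rw [hz t ht] at h1
  have h2 : e t = 0 := le_antisymm (by
    by_contra! h
    nlinarith [mul_pos (sub_pos.2 hKν) h]) (he0 t)
  have hK2 : 0 < K ^ 2 := by positivity
  simp only [he] at h2
  have h3 : x₀ t ^ 2 + y₀ t ^ 2 = 0 := by
    refine le_antisymm ?_ (by positivity)
    by_contra! h
    nlinarith [mul_pos hK2 h, sq_nonneg (x₁ t), sq_nonneg (y₁ t)]
  constructor
  · exact pow_eq_zero_iff (two_ne_zero) |>.1 (by nlinarith [sq_nonneg (x₀ t), sq_nonneg (y₀ t)])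
  · exact pow_eq_zero_iff (two_ne_zero) |>.1 (by nlinarith [sq_nonneg (x₀ t), sq_nonneg (y₀ t)])

end

/-! ### Overdetermined solutions of the direct and the adjoint equation -/

section
variable {ν C K m l : ℝ} {x₀ x₁ x₂ x₃ x₄ y₀ y₁ y₂ y₃ y₄ : ℝ → ℝ}

lemma real_eq_zero_of_sq_add_sq {a b : ℝ} (h : a ^ 2 + b ^ 2 = 0) : a = 0 ∧ b = 0 :=
  ⟨pow_eq_zero_iff (two_ne_zero) |>.1 (by nlinarith [sq_nonneg a, sq_nonneg b]),
    pow_eq_zero_iff (two_ne_zero) |>.1 (by nlinarith [sq_nonneg a, sq_nonneg b])⟩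

/-- An overdetermined solution of the Orr–Sommerfeld equation vanishes. -/
lemma real_eq_zero_of_direct (hx : RealJet x₀ x₁ x₂ x₃ x₄) (hy : RealJet y₀ y₁ y₂ y₃ y₄)
    (hν : 0 < ν) (hm : m ≤ 0) (hK : K ≠ 0)
    (hre : OdeRe ν C K 0 m l x₀ x₂ x₄ y₀ y₁ y₂) (him : OdeIm ν C K 0 m l y₀ y₂ y₄ x₀ x₁ x₂)
    (b0 : x₀ 0 = 0) (b1 : x₀ 1 = 0) (b2 : x₁ 0 = 0) (b3 : x₁ 1 = 0) (b4 : x₂ 0 = 0) (b5 : x₂ 1 = 0)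
    (c0 : y₀ 0 = 0) (c1 : y₀ 1 = 0) (c2 : y₁ 0 = 0) (c3 : y₁ 1 = 0) (c4 : y₂ 0 = 0)
    (c5 : y₂ 1 = 0) :
    ∀ t ∈ Ioo (0 : ℝ) 1, x₀ t = 0 ∧ y₀ t = 0 := by
  have hK2 : 0 < K ^ 2 := by positivity
  have hW : ∀ t ∈ Ioo (0 : ℝ) 1, x₂ t - K ^ 2 * x₀ t = 0 ∧ y₂ t - K ^ 2 * y₀ t = 0 := by
    -- The real part of the equation against `w̄`, where `w = z'' - K²z`. As `U'' = 2C` is constant,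
    -- its term is an exact derivative, by `Im(w z̄) = Im(z'' z̄) = (Im(z' z̄))'`. The conditions `z
    -- = z'' = 0` at the walls give `w = 0` there, so the boundary terms vanish.
    set B : ℝ → ℝ := fun t =>
      ν * ((x₃ t - K ^ 2 * x₁ t) * (x₂ t - K ^ 2 * x₀ t) +
        (y₃ t - K ^ 2 * y₁ t) * (y₂ t - K ^ 2 * y₀ t)) +
      K * (2 * C) * (y₁ t * x₀ t - x₁ t * y₀ t) with hB
    set D : ℝ → ℝ := fun t =>
      ν * ((x₃ t - K ^ 2 * x₁ t) ^ 2 + (y₃ t - K ^ 2 * y₁ t) ^ 2) +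
      (ν * K ^ 2 - m) * ((x₂ t - K ^ 2 * x₀ t) ^ 2 + (y₂ t - K ^ 2 * y₀ t) ^ 2) with hD
    have hBd : ∀ t, HasDerivAt B _ t := fun t =>
      (((((hx.h₃ t).sub ((hx.h₁ t).const_mul (K ^ 2))).mul
          ((hx.h₂ t).sub ((hx.h₀ t).const_mul (K ^ 2)))).add
        (((hy.h₃ t).sub ((hy.h₁ t).const_mul (K ^ 2))).mul
          ((hy.h₂ t).sub ((hy.h₀ t).const_mul (K ^ 2))))).const_mul ν).add
        ((((hy.h₁ t).mul (hx.h₀ t)).sub ((hx.h₁ t).mul (hy.h₀ t))).const_mul (K * (2 * C)))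
    have hBD : ∀ t ∈ Ioo (0 : ℝ) 1, HasDerivAt B (D t) t := fun t ht => by
      refine (hBd t).congr_deriv ?_
      simp only [hD, Pi.sub_apply]
      linear_combination (x₂ t - K ^ 2 * x₀ t) * hre t ht + (y₂ t - K ^ 2 * y₀ t) * him t ht
    have hc : 0 < ν * K ^ 2 - m := by nlinarith
    have hz := eq_zero_of_monotone_energy (fun t => (hBd t).continuousAt) hBD
      (fun t _ => by positivity)
      (by simp only [hB, b0, b1, b2, b3, b4, b5, c0, c1, c2, c3, c4, c5]; ring)
    intro t ht
    have h1 := hz t ht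
    simp only [hD] at h1
    refine real_eq_zero_of_sq_add_sq (le_antisymm ?_ (by positivity))
    by_contra! h
    have h2 : 0 ≤ ν * ((x₃ t - K ^ 2 * x₁ t) ^ 2 + (y₃ t - K ^ 2 * y₁ t) ^ 2) := by positivity
    linarith [mul_pos hc h]
  -- What remains is `z'' = K²z` with `z = 0` at the walls, tested against `z̄`.
  set B : ℝ → ℝ := fun t => x₁ t * x₀ t + y₁ t * y₀ t with hB
  set D : ℝ → ℝ := fun t => x₁ t ^ 2 + y₁ t ^ 2 + K ^ 2 * (x₀ t ^ 2 + y₀ t ^ 2) with hD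
  have hBd : ∀ t, HasDerivAt B _ t := fun t =>
    ((hx.h₁ t).mul (hx.h₀ t)).add ((hy.h₁ t).mul (hy.h₀ t))
  have hBD : ∀ t ∈ Ioo (0 : ℝ) 1, HasDerivAt B (D t) t := fun t ht => by
    refine (hBd t).congr_deriv ?_
    simp only [hD]
    linear_combination x₀ t * (hW t ht).1 + y₀ t * (hW t ht).2
  have hz := eq_zero_of_monotone_energy (fun t => (hBd t).continuousAt) hBD
    (fun t _ => by positivity) (by simp only [hB, b0, b1, b2, b3, c0, c1, c2, c3])
  intro t ht
  have h1 := hz t ht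
  simp only [hD] at h1
  refine real_eq_zero_of_sq_add_sq (le_antisymm ?_ (by positivity))
  by_contra! h
  linarith [mul_pos hK2 h, sq_nonneg (x₁ t), sq_nonneg (y₁ t)]

/-- An overdetermined solution of the adjoint Orr–Sommerfeld equation vanishes. -/
lemma real_eq_zero_of_adjoint (hx : RealJet x₀ x₁ x₂ x₃ x₄) (hy : RealJet y₀ y₁ y₂ y₃ y₄)
    (hν : 0 < ν) (hm : m ≤ 0) (hK : K ≠ 0) (hC : C ≠ 0)
    (hre : OdeRe ν C K 1 m l x₀ x₂ x₄ y₀ y₁ y₂) (him : OdeIm ν C K 1 m l y₀ y₂ y₄ x₀ x₁ x₂)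
    (b0 : x₀ 0 = 0) (b1 : x₀ 1 = 0) (b2 : x₁ 0 = 0) (b3 : x₁ 1 = 0) (b4 : x₂ 0 = 0) (b5 : x₂ 1 = 0)
    (c0 : y₀ 0 = 0) (c1 : y₀ 1 = 0) (c2 : y₁ 0 = 0) (c3 : y₁ 1 = 0) (c4 : y₂ 0 = 0)
    (c5 : y₂ 1 = 0) :
    ∀ t ∈ Ioo (0 : ℝ) 1, x₀ t = 0 ∧ y₀ t = 0 := by
  -- The imaginary part of the spectral parameter becomes a wave speed: it is absorbed into the
  -- profile through `V = U - c`, which has the same derivatives as `U`.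
  obtain ⟨c, rfl⟩ : ∃ c, l = K * c := ⟨l / K, by field_simp⟩
  have hV : ∀ t, HasDerivAt (fun t => C * (t ^ 2 - t) - c) (C * (2 * t - 1)) t := fun t =>
    (hasDerivAt_profile C t).sub_const c
  have hV' := hasDerivAt_profile₁ C
  have hwx : ∀ t, HasDerivAt (fun t => x₂ t - K ^ 2 * x₀ t) _ t := fun t =>
    (hx.h₂ t).sub ((hx.h₀ t).const_mul (K ^ 2))
  have hwy : ∀ t, HasDerivAt (fun t => y₂ t - K ^ 2 * y₀ t) _ t := fun t =>
    (hy.h₂ t).sub ((hy.h₀ t).const_mul (K ^ 2))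
  have hwx' : ∀ t, HasDerivAt (fun t => x₃ t - K ^ 2 * x₁ t) _ t := fun t =>
    (hx.h₃ t).sub ((hx.h₁ t).const_mul (K ^ 2))
  have hwy' : ∀ t, HasDerivAt (fun t => y₃ t - K ^ 2 * y₁ t) _ t := fun t =>
    (hy.h₃ t).sub ((hy.h₁ t).const_mul (K ^ 2))
  have hR : ∀ t, HasDerivAt (fun t => x₁ t * x₀ t + y₁ t * y₀ t) _ t := fun t =>
    ((hx.h₁ t).mul (hx.h₀ t)).add ((hy.h₁ t).mul (hy.h₀ t))
  have hJ : ∀ t, HasDerivAt (fun t => y₁ t * x₀ t - x₁ t * y₀ t) _ t := fun t =>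
    ((hy.h₁ t).mul (hx.h₀ t)).sub ((hx.h₁ t).mul (hy.h₀ t))
  have hN : ∀ t, HasDerivAt (fun t => x₀ t * x₀ t + y₀ t * y₀ t) _ t := fun t =>
    ((hx.h₀ t).mul (hx.h₀ t)).add ((hy.h₀ t).mul (hy.h₀ t))
  have hN' : ∀ t, HasDerivAt (fun t => x₁ t * x₁ t + y₁ t * y₁ t) _ t := fun t =>
    ((hx.h₁ t).mul (hx.h₁ t)).add ((hy.h₁ t).mul (hy.h₁ t))
  have hP : ∀ t, HasDerivAt (fun t =>
      (x₃ t - K ^ 2 * x₁ t) * x₀ t + (y₃ t - K ^ 2 * y₁ t) * y₀ t -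
        ((x₂ t - K ^ 2 * x₀ t) * x₁ t + (y₂ t - K ^ 2 * y₀ t) * y₁ t)) _ t := fun t =>
    (((hwx' t).mul (hx.h₀ t)).add ((hwy' t).mul (hy.h₀ t))).sub
      (((hwx t).mul (hx.h₁ t)).add ((hwy t).mul (hy.h₁ t)))
  have hQ : ∀ t, HasDerivAt (fun t =>
      (y₃ t - K ^ 2 * y₁ t) * x₀ t - (x₃ t - K ^ 2 * x₁ t) * y₀ t -
        ((y₂ t - K ^ 2 * y₀ t) * x₁ t - (x₂ t - K ^ 2 * x₀ t) * y₁ t)) _ t := fun t =>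
    (((hwy' t).mul (hx.h₀ t)).sub ((hwx' t).mul (hy.h₀ t))).sub
      (((hwy t).mul (hx.h₁ t)).sub ((hwx t).mul (hy.h₁ t)))
  have hS : ∀ t, HasDerivAt (fun t =>
      (x₂ t - K ^ 2 * x₀ t) * x₀ t + (y₂ t - K ^ 2 * y₀ t) * y₀ t) _ t := fun t =>
    ((hwx t).mul (hx.h₀ t)).add ((hwy t).mul (hy.h₀ t))
  have hT : ∀ t, HasDerivAt (fun t =>
      (y₃ t - K ^ 2 * y₁ t) * (x₂ t - K ^ 2 * x₀ t) -
        (x₃ t - K ^ 2 * x₁ t) * (y₂ t - K ^ 2 * y₀ t)) _ t := fun t =>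
    ((hwy' t).mul (hwx t)).sub ((hwx' t).mul (hwy t))
  set e : ℝ → ℝ := fun t => x₁ t ^ 2 + y₁ t ^ 2 with he
  set n : ℝ → ℝ := fun t => x₀ t ^ 2 + y₀ t ^ 2 with hn
  -- real part of the equation against `V z̄`, with `V = U - c`
  have h1 : ∀ t, HasDerivAt (fun t =>
      -m * ((C * (t ^ 2 - t) - c) * (x₁ t * x₀ t + y₁ t * y₀ t) -
        C * (2 * t - 1) * (x₀ t * x₀ t + y₀ t * y₀ t) / 2) -
      ν * ((C * (t ^ 2 - t) - c) * ((x₃ t - K ^ 2 * x₁ t) * x₀ t + (y₃ t - K ^ 2 * y₁ t) * y₀ t -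
          ((x₂ t - K ^ 2 * x₀ t) * x₁ t + (y₂ t - K ^ 2 * y₀ t) * y₁ t)) -
        C * (2 * t - 1) * ((x₂ t - K ^ 2 * x₀ t) * x₀ t + (y₂ t - K ^ 2 * y₀ t) * y₀ t) +
        C * (2 * t - 1) * ((x₁ t * x₁ t + y₁ t * y₁ t) - K ^ 2 * (x₀ t * x₀ t + y₀ t * y₀ t)) +
        2 * C * (x₁ t * x₀ t + y₁ t * y₀ t)) -
      K * ((C * (t ^ 2 - t) - c) * ((C * (t ^ 2 - t) - c) *
        (y₁ t * x₀ t - x₁ t * y₀ t)))) _ t := fun t =>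
    (((((hV t).mul (hR t)).sub (((hV' t).mul (hN t)).div_const 2)).const_mul (-m)).sub
      ((((((hV t).mul (hP t)).sub ((hV' t).mul (hS t))).add
        ((hV' t).mul ((hN' t).sub ((hN t).const_mul (K ^ 2))))).add
        ((hR t).const_mul (2 * C))).const_mul ν)).sub
      (((hV t).mul ((hV t).mul (hJ t))).const_mul K)
  -- imaginary part of the equation against `z̄`
  have h2 : ∀ t, HasDerivAt (fun t =>
      K * ((C * (t ^ 2 - t) - c) * (x₁ t * x₀ t + y₁ t * y₀ t) +
        C * (2 * t - 1) * (x₀ t * x₀ t + y₀ t * y₀ t) / 2) -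
      m * (y₁ t * x₀ t - x₁ t * y₀ t) -
      ν * ((y₃ t - K ^ 2 * y₁ t) * x₀ t - (x₃ t - K ^ 2 * x₁ t) * y₀ t -
        ((y₂ t - K ^ 2 * y₀ t) * x₁ t - (x₂ t - K ^ 2 * x₀ t) * y₁ t))) _ t := fun t =>
    (((((hV t).mul (hR t)).add (((hV' t).mul (hN t)).div_const 2)).const_mul K).sub
      ((hJ t).const_mul m)).sub ((hQ t).const_mul ν)
  -- imaginary part of the equation against `w̄`, with `w = z'' - K² z`
  have h3 : ∀ t, HasDerivAt (fun t =>
      ν * ((y₃ t - K ^ 2 * y₁ t) * (x₂ t - K ^ 2 * x₀ t) -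
        (x₃ t - K ^ 2 * x₁ t) * (y₂ t - K ^ 2 * y₀ t)) -
      K * (C * (2 * t - 1) *
        ((x₁ t * x₁ t + y₁ t * y₁ t) - K ^ 2 * (x₀ t * x₀ t + y₀ t * y₀ t)))) _ t :=
    fun t => ((hT t).const_mul ν).sub
      (((hV' t).mul ((hN' t).sub ((hN t).const_mul (K ^ 2)))).const_mul K)
  -- With `Φ = νw - iKVz + mz` the equation becomes `(D² - K²)Φ = -2iCK z`, and `Φ = 0` at the
  -- walls. This combination is the imaginary part of that identity against `Φ̄`: up to the factor
  -- `-2CK`, the multiplier of the original equation is `-iΦ`. The term with `V|z|²` drops out of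
  -- `Re(z Φ̄)`, so no sign of `U - c` is needed. The extra factor `-2CK` turns the coefficient into
  -- the square `(2CK)²`, whatever the sign of `K`.
  have h4 := fun t =>
    ((((h1 t).const_mul K).add ((h2 t).const_mul m)).sub ((h3 t).const_mul ν)).const_mul
      (-(2 * C) * K)
  set D : ℝ → ℝ := fun t => (2 * C * K) ^ 2 * (ν * e t + (ν * K ^ 2 - m) * n t) with hD
  have hc : 0 < ν * K ^ 2 - m := by
    have : 0 < ν * K ^ 2 := by positivity
    linarith
  have hz := eq_zero_of_monotone_energy (D := D) (fun t => (h4 t).continuousAt)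
    (fun t ht => by
      refine (h4 t).congr_deriv ?_
      simp only [hD, he, hn, Pi.sub_apply, Pi.mul_apply]
      linear_combination (-(2 * C) * K) * ((-K * (C * (t ^ 2 - t) - c) * x₀ t + m * y₀ t +
          ν * (y₂ t - K ^ 2 * y₀ t)) * hre t ht +
        (-K * (C * (t ^ 2 - t) - c) * y₀ t - m * x₀ t -
          ν * (x₂ t - K ^ 2 * x₀ t)) * him t ht))
    (fun t _ => by positivity)
    (by
      simp only [Pi.sub_apply, Pi.add_apply, b0, b1, b2, b3, b4, b5, c0, c1, c2, c3,
        c4, c5]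
      ring)
  intro t ht
  have h5 := hz t ht
  simp only [hD] at h5
  have h6 : ν * e t + (ν * K ^ 2 - m) * n t = 0 :=
    (mul_eq_zero.1 h5).resolve_left (by positivity)
  refine real_eq_zero_of_sq_add_sq (le_antisymm ?_ (by positivity))
  by_contra! h
  have h7 : 0 ≤ ν * e t := by positivity
  have h8 := mul_pos hc h
  simp only [hn] at h6
  linarith

end

/-! ### Vanishing and regularity for the complex Orr–Sommerfeld equations -/

section
variable {ν C K σ : ℝ} {μ : ℂ} {Z : ℝ → ℂ}

lemma realJet_re (h : ContDiff ℝ 4 Z) : RealJet (fun t => (Z t).re) (fun t => (deriv Z t).re)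
    (fun t => (deriv (deriv Z) t).re) (fun t => (deriv (deriv (deriv Z)) t).re)
    (fun t => (deriv (deriv (deriv (deriv Z))) t).re) :=
  ⟨fun y => hasDerivAt_re (hasDerivAt_of_contDiff_four h y).1, fun y => hasDerivAt_re (hasDerivAt_of_contDiff_four h y).2.1,
    fun y => hasDerivAt_re (hasDerivAt_of_contDiff_four h y).2.2.1,
    fun y => hasDerivAt_re (hasDerivAt_of_contDiff_four h y).2.2.2⟩

lemma realJet_im (h : ContDiff ℝ 4 Z) : RealJet (fun t => (Z t).im) (fun t => (deriv Z t).im)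
    (fun t => (deriv (deriv Z) t).im) (fun t => (deriv (deriv (deriv Z)) t).im)
    (fun t => (deriv (deriv (deriv (deriv Z))) t).im) :=
  ⟨fun y => hasDerivAt_im (hasDerivAt_of_contDiff_four h y).1, fun y => hasDerivAt_im (hasDerivAt_of_contDiff_four h y).2.1,
    fun y => hasDerivAt_im (hasDerivAt_of_contDiff_four h y).2.2.1,
    fun y => hasDerivAt_im (hasDerivAt_of_contDiff_four h y).2.2.2⟩

lemma IsOrrSommerfeld.odeRe (h : IsOrrSommerfeld ν C K σ μ Z) :
    OdeRe ν C K σ μ.re μ.im (fun t => (Z t).re) (fun t => (deriv (deriv Z) t).re)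
      (fun t => (deriv (deriv (deriv (deriv Z))) t).re) (fun t => (Z t).im)
      (fun t => (deriv Z t).im) (fun t => (deriv (deriv Z) t).im) := fun t ht => by
  have := congrArg Complex.re (h.ode t ht)
  simp [← Complex.ofReal_pow] at this
  simp
  linear_combination this

lemma IsOrrSommerfeld.odeIm (h : IsOrrSommerfeld ν C K σ μ Z) :
    OdeIm ν C K σ μ.re μ.im (fun t => (Z t).im) (fun t => (deriv (deriv Z) t).im)
      (fun t => (deriv (deriv (deriv (deriv Z))) t).im) (fun t => (Z t).re)
      (fun t => (deriv Z t).re) (fun t => (deriv (deriv Z) t).re) := fun t ht => by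
  have := congrArg Complex.im (h.ode t ht)
  simp [← Complex.ofReal_pow] at this
  simp
  linear_combination this

lemma IsOrrSommerfeld.eq_zero_of_Ioo (h : IsOrrSommerfeld ν C K σ μ Z)
    (h0 : ∀ t ∈ Ioo (0 : ℝ) 1, (Z t).re = 0 ∧ (Z t).im = 0) :
    ∀ t ∈ Icc (0 : ℝ) 1, Z t = 0 := fun t ht => by
  rcases eq_or_lt_of_le ht.1 with rfl | h1
  · exact h.zero
  rcases eq_or_lt_of_le ht.2 with rfl | h2
  · exact h.one
  exact Complex.ext (h0 t ⟨h1, h2⟩).1 (h0 t ⟨h1, h2⟩).2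

theorem IsOrrSommerfeld.eq_zero_of_large (h : IsOrrSommerfeld ν C K σ μ Z) (hν : 0 < ν)
    (hμ : μ.re ≤ 0) (hσ : |2 * σ - 1| ≤ 1) (hK : K ≠ 0) (hKν : |C| / 2 < ν * K ^ 2) :
    ∀ t ∈ Icc (0 : ℝ) 1, Z t = 0 :=
  h.eq_zero_of_Ioo (real_eq_zero_of_large (realJet_re h.contDiff) (realJet_im h.contDiff) hν hμ hσ hK
    hKν h.odeRe h.odeIm (by simp [h.zero]) (by simp [h.one]) (by simp [h.deriv_zero])
    (by simp [h.deriv_one]) (by simp [h.zero]) (by simp [h.one]) (by simp [h.deriv_zero])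
    (by simp [h.deriv_one]))

/-- Since the mode of `u` is proportional to `Z'`, the conditions on `Z''` express that the normal
derivative of `u` vanishes in this mode. -/
theorem IsOrrSommerfeld.eq_zero_of_overdetermined (h : IsOrrSommerfeld ν C K σ μ Z) (hν : 0 < ν)
    (hμ : μ.re ≤ 0) (hσ : σ = 0 ∨ σ = 1) (hC : C ≠ 0) (hK : K ≠ 0)
    (h0 : deriv (deriv Z) 0 = 0) (h1 : deriv (deriv Z) 1 = 0) :
    ∀ t ∈ Icc (0 : ℝ) 1, Z t = 0 := by
  rcases hσ with rfl | rfl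
  · exact h.eq_zero_of_Ioo (real_eq_zero_of_direct (realJet_re h.contDiff) (realJet_im h.contDiff) hν
      hμ hK h.odeRe h.odeIm (by simp [h.zero]) (by simp [h.one]) (by simp [h.deriv_zero])
      (by simp [h.deriv_one]) (by simp [h0]) (by simp [h1]) (by simp [h.zero]) (by simp [h.one])
      (by simp [h.deriv_zero]) (by simp [h.deriv_one]) (by simp [h0]) (by simp [h1]))
  · exact h.eq_zero_of_Ioo (real_eq_zero_of_adjoint (realJet_re h.contDiff) (realJet_im h.contDiff) hν
      hμ hK hC h.odeRe h.odeIm (by simp [h.zero]) (by simp [h.one]) (by simp [h.deriv_zero])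
      (by simp [h.deriv_one]) (by simp [h0]) (by simp [h1]) (by simp [h.zero]) (by simp [h.one])
      (by simp [h.deriv_zero]) (by simp [h.deriv_one]) (by simp [h0]) (by simp [h1]))

/-- The very weak form of the Orr–Sommerfeld equations. -/
def IsVeryWeakOrrSommerfeld (ν C K σ : ℝ) (μ : ℂ) (z : ℝ → ℂ) : Prop :=
  ∀ ψ, IsClamped ψ → (ν : ℂ) * ∫ y in (0 : ℝ)..1, z y * deriv (deriv (deriv (deriv ψ))) y =
    ∫ y in (0 : ℝ)..1, z y *
      ((2 * ν * K ^ 2 + Complex.I * K * (C * (y ^ 2 - y)) - μ) * deriv (deriv ψ) y +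
        2 * Complex.I * K * (1 - σ) * (C * (2 * y - 1)) * deriv ψ y +
        (-(2 * Complex.I * K * σ * C) - Complex.I * K ^ 3 * (C * (y ^ 2 - y)) + μ * K ^ 2 -
          ν * K ^ 4) * ψ y)

theorem IsVeryWeakOrrSommerfeld.exists_classical {z : ℝ → ℂ} (hν : 0 < ν)
    (hz : IntervalIntegrable z volume 0 1) (h : IsVeryWeakOrrSommerfeld ν C K σ μ z) :
    ∃ Z, IsOrrSommerfeld ν C K σ μ Z ∧ ∀ᵐ y ∂volume.restrict (Ioo (0 : ℝ) 1), z y = Z y := by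
  have hν' : (ν : ℂ) ≠ 0 := by exact_mod_cast hν.ne'
  set p : ℝ → ℂ := fun y => (2 * ν * K ^ 2 + Complex.I * K * (C * ((y : ℂ) ^ 2 - y)) - μ) / ν with hp
  set s : ℝ → ℂ := fun y => 2 * Complex.I * K * (1 - σ) * (C * (2 * (y : ℂ) - 1)) / ν with hs
  set r : ℝ → ℂ := fun y => (-(2 * Complex.I * K * σ * C) - Complex.I * K ^ 3 *
    (C * ((y : ℂ) ^ 2 - y)) + μ * K ^ 2 - ν * K ^ 4) / ν with hr
  have cy : ContDiff ℝ ∞ fun y : ℝ => (y : ℂ) := Complex.ofRealCLM.contDiff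
  have cp : ContDiff ℝ ∞ p := by
    simp only [hp, div_eq_mul_inv]
    fun_prop
  have cs : ContDiff ℝ ∞ s := by
    simp only [hs, div_eq_mul_inv]
    fun_prop
  have cr : ContDiff ℝ ∞ r := by
    simp only [hr, div_eq_mul_inv]
    fun_prop
  obtain ⟨Z, hZ, z0, z1, z2, z3, hae, hode⟩ := exists_classical_of_veryWeak cp cs cr hz fun ψ hψ => by
    have := h ψ hψ
    rw [← mul_right_inj' hν', this, ← intervalIntegral.integral_const_mul]
    refine intervalIntegral.integral_congr fun y _ => ?_
    simp only [hp, hs, hr]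
    field_simp
  -- It remains to expand `(pZ)'' - (sZ)' + rZ`. The terms with `U'Z'` carry `2 - 2(1 - σ) = 2σ`,
  -- and those with `U''Z` carry `1 - 2(1 - σ) - σ = -(1 - σ)`, as the strong form requires.
  refine ⟨Z, ⟨hZ, z0, z1, z2, z3, fun y hy => ?_⟩, hae⟩
  have dZ := fun y => (hasDerivAt_of_contDiff_four hZ y).1
  have dZ' := fun y => (hasDerivAt_of_contDiff_four hZ y).2.1
  have dp : ∀ y : ℝ, HasDerivAt p (Complex.I * K * (C * (2 * y - 1)) / ν) y := fun y => by
    have := ((((((hasDerivAt_ofReal_pow 2 y).sub (hasDerivAt_ofReal y)).const_mul (C : ℂ)).const_mul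
      (Complex.I * K)).const_add (2 * (ν : ℂ) * K ^ 2)).sub_const μ).div_const (ν : ℂ)
    simpa using this
  have dp' : ∀ y : ℝ, HasDerivAt (fun y : ℝ => Complex.I * K * (C * (2 * (y : ℂ) - 1)) / ν)
      (Complex.I * K * (C * 2) / ν) y := fun y => by
    have := (((((hasDerivAt_ofReal y).const_mul (2 : ℂ)).sub_const 1).const_mul (C : ℂ)).const_mul
      (Complex.I * K)).div_const (ν : ℂ)
    simpa using this
  have ds : ∀ y, HasDerivAt s (2 * Complex.I * K * (1 - σ) * (C * 2) / ν) y := fun y => by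
    have := (((((hasDerivAt_ofReal y).const_mul (2 : ℂ)).sub_const 1).const_mul (C : ℂ)).const_mul
      (2 * Complex.I * K * (1 - σ))).div_const (ν : ℂ)
    simpa using this
  have e1 : deriv (fun t => p t * Z t) = fun y =>
      Complex.I * K * (C * (2 * y - 1)) / ν * Z y + p y * deriv Z y :=
    funext fun y => ((dp y).mul (dZ y)).deriv
  have e2 : deriv (fun y : ℝ => Complex.I * K * (C * (2 * (y : ℂ) - 1)) / ν * Z y + p y * deriv Z y) y =
      Complex.I * K * (C * 2) / ν * Z y + Complex.I * K * (C * (2 * (y : ℂ) - 1)) / ν * deriv Z y +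
        (Complex.I * K * (C * (2 * (y : ℂ) - 1)) / ν * deriv Z y + p y * deriv (deriv Z) y) :=
    (((dp' y).mul (dZ y)).add ((dp y).mul (dZ' y))).deriv
  have e3 : deriv (fun t => s t * Z t) y =
      2 * Complex.I * K * (1 - σ) * (C * 2) / ν * Z y + s y * deriv Z y :=
    ((ds y).mul (dZ y)).deriv
  rw [hode y hy, e1, e2, e3]
  simp only [hp, hs, hr]
  field_simp
  ring

end

/-! ### Fourier modes in the channel -/

lemma isFiniteMeasure_cell : IsFiniteMeasure (volume.restrict cell) :=
  ⟨by
    rw [Measure.restrict_apply_univ]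
    exact (measure_mono (prod_mono Ioo_subset_Icc_self Ioo_subset_Icc_self)).trans_lt
      (isCompact_Icc.prod isCompact_Icc).measure_lt_top⟩

lemma volume_restrict_cell : (volume.restrict cell : Measure (ℝ × ℝ)) =
    (volume.restrict (Ioo 0 (2 * Real.pi))).prod (volume.restrict (Ioo 0 1)) := by
  rw [Measure.prod_restrict]
  rfl

lemma integrableOn_cell (f : L2Cell) : IntegrableOn f cell :=
  haveI := isFiniteMeasure_cell
  (Lp.memLp f).integrable (by norm_num)

lemma integrableOn_cell_of_continuous {F : ℝ × ℝ → ℂ} (hF : Continuous F) : IntegrableOn F cell :=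
  haveI := isFiniteMeasure_cell
  (memLp_of_continuous hF).integrable (by norm_num)

lemma integrableOn_cell_mul (f : L2Cell) {F : ℝ × ℝ → ℂ} (hF : Continuous F) :
    IntegrableOn (fun p => f p * F p) cell :=
  MemLp.integrable_mul (Lp.memLp f) (memLp_of_continuous hF)

/-- The character `e^{ikx}`. -/
def char (k : ℤ) (x : ℝ) : ℂ := Complex.exp (Complex.I * k * x)

lemma hasDerivAt_char (k : ℤ) (x : ℝ) : HasDerivAt (char k) (Complex.I * k * char k x) x := by
  have : HasDerivAt (char k) (Complex.exp (Complex.I * k * x) * (Complex.I * k * 1)) x :=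
    ((hasDerivAt_ofReal x).const_mul (Complex.I * (k : ℂ))).cexp
  exact this.congr_deriv (by simp [char, mul_comm])

lemma contDiff_char (k : ℤ) {n : WithTop ℕ∞} : ContDiff ℝ n (char k) :=
  (contDiff_const.mul Complex.ofRealCLM.contDiff).cexp

lemma continuous_char (k : ℤ) : Continuous (char k) := (contDiff_char k (n := 0)).continuous

lemma char_add_two_pi (k : ℤ) (x : ℝ) : char k (x + 2 * Real.pi) = char k x := by
  have : Complex.I * k * ((x + 2 * Real.pi : ℝ) : ℂ) =
      Complex.I * k * x + k * (2 * Real.pi * Complex.I) := by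
    push_cast
    ring
  rw [char, this, Complex.exp_add, Complex.exp_int_mul_two_pi_mul_I, mul_one, char]

lemma conj_char (k : ℤ) (x : ℝ) : conj (char k x) = char (-k) x := by
  rw [char, ← Complex.exp_conj, char]
  simp

lemma char_mul (j k : ℤ) (x : ℝ) : char j x * char k x = char (j + k) x := by
  rw [char, char, char, ← Complex.exp_add]
  push_cast
  ring_nf

@[simp]
lemma char_zero (x : ℝ) : char 0 x = 1 := by simp [char]

lemma integral_char (k : ℤ) :
    ∫ x in (0 : ℝ)..(2 * Real.pi), char k x = if k = 0 then (2 * Real.pi : ℂ) else 0 := by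
  split_ifs with h
  · subst h
    simp
  · have hk : Complex.I * (k : ℂ) ≠ 0 := mul_ne_zero Complex.I_ne_zero (by exact_mod_cast h)
    have : ∀ x, HasDerivAt (fun x => (Complex.I * k)⁻¹ * char k x) (char k x) x := fun x => by
      have := (hasDerivAt_char k x).const_mul (Complex.I * (k : ℂ))⁻¹
      rwa [inv_mul_cancel_left₀ hk] at this
    rw [intervalIntegral.integral_eq_sub_of_hasDerivAt (fun x _ => this x)
      ((continuous_char k).intervalIntegrable _ _)]
    have := char_add_two_pi k 0
    rw [zero_add] at this
    rw [this, sub_self]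

/-- The `k`-th Fourier coefficient in `x` (not normalized). -/
def coeff (f : ℝ × ℝ → ℂ) (k : ℤ) (y : ℝ) : ℂ :=
  ∫ x in Ioo 0 (2 * Real.pi), f (x, y) * char (-k) x

lemma setIntegral_cell {g : ℝ × ℝ → ℂ} (hg : IntegrableOn g cell) :
    ∫ p in cell, g p = ∫ y in (0 : ℝ)..1, ∫ x in Ioo 0 (2 * Real.pi), g (x, y) := by
  rw [IntegrableOn, volume_restrict_cell] at hg
  rw [volume_restrict_cell, integral_prod_symm _ hg, intervalIntegral.integral_of_le zero_le_one,
    integral_Ioc_eq_integral_Ioo]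

lemma intervalIntegrable_coeff {f : ℝ × ℝ → ℂ} (hf : IntegrableOn f cell) (k : ℤ) :
    IntervalIntegrable (coeff f k) volume 0 1 := by
  rw [intervalIntegrable_iff_integrableOn_Ioo_of_le zero_le_one]
  have : IntegrableOn (fun p : ℝ × ℝ => f p * char (-k) p.1) cell := by
    refine Integrable.mul_bdd (c := 1) hf
      ((continuous_char _).comp continuous_fst).aestronglyMeasurable (.of_forall fun p => ?_)
    simp [char, Complex.norm_exp]
  rw [IntegrableOn, volume_restrict_cell] at this
  exact this.integral_prod_right

lemma setIntegral_mul_char {f : ℝ × ℝ → ℂ} {η : ℝ → ℂ} {k : ℤ}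
    (hf : IntegrableOn (fun p => f p * (char (-k) p.1 * η p.2)) cell) :
    ∫ p in cell, f p * (char (-k) p.1 * η p.2) = ∫ y in (0 : ℝ)..1, coeff f k y * η y := by
  rw [setIntegral_cell hf]
  refine intervalIntegral.integral_congr fun y _ => ?_
  simp only [coeff]
  rw [← integral_mul_const]
  simp only [mul_assoc]

/-- The function `e^{ikx} η(y)`. -/
def modeFn (k : ℤ) (η : ℝ → ℂ) (p : ℝ × ℝ) : ℂ := char k p.1 * η p.2

lemma continuous_modeFn (k : ℤ) {η : ℝ → ℂ} (hη : Continuous η) : Continuous (modeFn k η) :=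
  ((continuous_char k).comp continuous_fst).mul (hη.comp continuous_snd)

lemma contDiff_modeFn (k : ℤ) {η : ℝ → ℂ} {n : WithTop ℕ∞} (hη : ContDiff ℝ n η) :
    ContDiff ℝ n (modeFn k η) :=
  ((contDiff_char k).comp contDiff_fst).mul (hη.comp contDiff_snd)

lemma setIntegral_mul_modeFn (f : L2Cell) {η : ℝ → ℂ} (hη : Continuous η) (k : ℤ) :
    ∫ p in cell, f p * modeFn (-k) η p = ∫ y in (0 : ℝ)..1, coeff f k y * η y :=
  setIntegral_mul_char (integrableOn_cell_mul f (continuous_modeFn (-k) hη))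

lemma dX_modeFn (k : ℤ) {η : ℝ → ℂ} (hη : Differentiable ℝ η) (p : ℝ × ℝ) :
    dX (modeFn k η) p = Complex.I * k * modeFn k η p := by
  have h1 : HasFDerivAt (fun p : ℝ × ℝ => char k p.1) _ p :=
    (hasDerivAt_char k p.1).hasFDerivAt.comp p hasFDerivAt_fst
  have h2 : HasFDerivAt (fun p : ℝ × ℝ => η p.2) _ p :=
    (hη p.2).hasDerivAt.hasFDerivAt.comp p hasFDerivAt_snd
  have h3 : HasFDerivAt (modeFn k η) _ p := h1.mul h2
  rw [dX, h3.fderiv]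
  simp [modeFn]
  ring

lemma dY_modeFn (k : ℤ) {η : ℝ → ℂ} (hη : Differentiable ℝ η) (p : ℝ × ℝ) :
    dY (modeFn k η) p = modeFn k (deriv η) p := by
  have h1 : HasFDerivAt (fun p : ℝ × ℝ => char k p.1) _ p :=
    (hasDerivAt_char k p.1).hasFDerivAt.comp p hasFDerivAt_fst
  have h2 : HasFDerivAt (fun p : ℝ × ℝ => η p.2) _ p :=
    (hη p.2).hasDerivAt.hasFDerivAt.comp p hasFDerivAt_snd
  have h3 : HasFDerivAt (modeFn k η) _ p := h1.mul h2
  rw [dY, h3.fderiv]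
  simp [modeFn]

lemma isPeriodicSmooth_modeFn (k : ℤ) {η : ℝ → ℂ} (hη : ContDiff ℝ ∞ η) :
    IsPeriodicSmooth (modeFn k η) :=
  ⟨contDiff_modeFn k hη, fun x y => by simp only [modeFn, char_add_two_pi]⟩

lemma isInteriorTest_modeFn (k : ℤ) {η : ℝ → ℂ} (hη : IsCompactTest η) :
    IsInteriorTest (modeFn k η) :=
  ⟨isPeriodicSmooth_modeFn k hη.contDiff, by
    obtain ⟨a, b, ha, hb, h⟩ := hη.support
    exact ⟨a, b, ha, hb, fun x y hy => by simp [modeFn, h y hy]⟩⟩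

/-- A function in `L²` all of whose Fourier coefficients vanish is zero. -/
theorem eq_zero_of_coeff_eq_zero {f : L2Cell}
    (h : ∀ k : ℤ, ∀ᵐ y ∂volume.restrict (Ioo (0 : ℝ) 1), coeff f k y = 0) : f = 0 := by
  have hpi := Real.two_pi_pos
  have hsq : Integrable (fun p => ‖f p‖ ^ 2) (volume.restrict cell) :=
    (memLp_two_iff_integrable_sq_norm (Lp.aestronglyMeasurable f)).1 (Lp.memLp f)
  have hsq' : Integrable (fun p => ‖f p‖ ^ 2)
      ((volume.restrict (Ioo 0 (2 * Real.pi))).prod (volume.restrict (Ioo 0 1))) :=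
    volume_restrict_cell ▸ hsq
  -- Parseval's identity on almost every horizontal line. The exceptional sets of the countably many
  -- frequencies have a null union.
  have hslice : ∀ᵐ y ∂volume.restrict (Ioo (0 : ℝ) 1),
      ∫ x in Ioo 0 (2 * Real.pi), ‖f (x, y)‖ ^ 2 = 0 := by
    filter_upwards [hsq'.prod_left_ae, ae_all_iff.2 h] with y hy hk
    have hm : MemLp (fun x => f (x, y)) 2 (volume.restrict (Ioc 0 (2 * Real.pi))) := by
      rw [← restrict_Ioo_eq_restrict_Ioc]
      refine (memLp_two_iff_integrable_sq_norm ?_).2 hy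
      exact ((Lp.stronglyMeasurable f).comp_measurable measurable_prodMk_right).aestronglyMeasurable
    have hs := hasSum_sq_fourierCoeffOn hpi hm
    have h0 : ∀ n : ℤ, fourierCoeffOn hpi (fun x => f (x, y)) n = 0 := fun n => by
      rw [fourierCoeffOn_eq_integral, intervalIntegral.integral_of_le hpi.le,
        integral_Ioc_eq_integral_Ioo]
      have : ∀ x : ℝ, (fourier (-n) (x : AddCircle (2 * Real.pi - 0)) : ℂ) = char (-n) x := fun x => by
        rw [fourier_coe_apply, char]
        congr 1
        push_cast
        have : (Real.pi : ℂ) ≠ 0 := by exact_mod_cast Real.pi_ne_zero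
        field_simp
        ring
      simp only [this, smul_eq_mul, mul_comm (char _ _)]
      rw [show ∫ x in Ioo 0 (2 * Real.pi), f (x, y) * char (-n) x = 0 from hk n]
      simp
    simp only [h0, norm_zero, ne_eq, OfNat.ofNat_ne_zero, not_false_eq_true, zero_pow] at hs
    have := hs.unique hasSum_zero
    rw [intervalIntegral.integral_of_le hpi.le, integral_Ioc_eq_integral_Ioo] at this
    simpa [hpi.ne', Real.pi_ne_zero] using this
  have htot : ∫ p in cell, ‖f p‖ ^ 2 = 0 := by
    have h1 : ∀ g : ℝ × ℝ → ℝ, ∫ p in cell, g p = ∫ p, g p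
        ∂(volume.restrict (Ioo 0 (2 * Real.pi))).prod (volume.restrict (Ioo 0 1)) := fun g => by
      rw [volume_restrict_cell]
    rw [h1, integral_prod_symm _ hsq', integral_congr_ae hslice]
    simp
  rw [integral_eq_zero_iff_of_nonneg (fun p => by positivity) hsq] at htot
  rw [Lp.eq_zero_iff_ae_eq_zero]
  filter_upwards [htot] with p hp
  simpa using hp

/-- The class of a continuous function in `L²`. -/
def fieldLp (F : ℝ × ℝ → ℂ) (hF : Continuous F) : L2Cell := (memLp_of_continuous hF).toLp F

lemma coeFn_fieldLp {F : ℝ × ℝ → ℂ} (hF : Continuous F) :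
    fieldLp F hF =ᵐ[volume.restrict cell] F := (memLp_of_continuous hF).coeFn_toLp

lemma setIntegral_fieldLp_mul {F : ℝ × ℝ → ℂ} (hF : Continuous F) (φ : ℝ × ℝ → ℂ) :
    ∫ p in cell, fieldLp F hF p * φ p = ∫ p in cell, F p * φ p := by
  refine integral_congr_ae ?_
  filter_upwards [coeFn_fieldLp hF] with p hp
  rw [hp]

/-- The trigonometric polynomial in `x` with coefficients `c k`, `k ∈ S`. -/
def trigPoly (S : Finset ℤ) (c : ℤ → ℝ → ℂ) (p : ℝ × ℝ) : ℂ :=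
  ∑ k ∈ S, modeFn k (c k) p

lemma continuous_trigPoly (S : Finset ℤ) {c : ℤ → ℝ → ℂ} (hc : ∀ k, Continuous (c k)) :
    Continuous (trigPoly S c) :=
  continuous_finsetSum _ fun k _ => continuous_modeFn k (hc k)

lemma integral_trigPoly_mul_char (S : Finset ℤ) (c : ℤ → ℝ → ℂ) (k : ℤ) (y : ℝ) :
    ∫ x in (0 : ℝ)..(2 * Real.pi), trigPoly S c (x, y) * char (-k) x =
      if k ∈ S then 2 * Real.pi * c k y else 0 := by
  have : ∀ x, trigPoly S c (x, y) * char (-k) x = ∑ j ∈ S, char (j + -k) x * c j y := fun x => by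
    simp only [trigPoly, modeFn, Finset.sum_mul, ← char_mul]
    exact Finset.sum_congr rfl fun j _ => by ring
  simp only [this]
  have hi : ∀ j ∈ S, IntervalIntegrable (fun x => char (j + -k) x * c j y) volume 0
      (2 * Real.pi) := fun j _ => ((continuous_char _).mul continuous_const).intervalIntegrable _ _
  rw [intervalIntegral.integral_finsetSum hi]
  simp only [intervalIntegral.integral_mul_const, integral_char, add_neg_eq_zero, ite_mul, zero_mul,
    Finset.sum_ite_eq']

lemma coeff_trigPoly (S : Finset ℤ) (c : ℤ → ℝ → ℂ) (k : ℤ) (y : ℝ) :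
    coeff (trigPoly S c) k y = if k ∈ S then 2 * Real.pi * c k y else 0 := by
  rw [coeff, ← integral_Ioc_eq_integral_Ioo,
    ← intervalIntegral.integral_of_le Real.two_pi_pos.le, integral_trigPoly_mul_char]

/-- A function with finitely many Fourier coefficients is a trigonometric polynomial in `x`. -/
theorem eq_trigPoly {f : L2Cell} (S : Finset ℤ) {c : ℤ → ℝ → ℂ} (hc : ∀ k, Continuous (c k))
    (h : ∀ k, ∀ᵐ y ∂volume.restrict (Ioo (0 : ℝ) 1),
      coeff f k y = if k ∈ S then 2 * Real.pi * c k y else 0) :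
    f = fieldLp (trigPoly S c) (continuous_trigPoly S hc) := by
  have hcont := continuous_trigPoly S hc
  rw [← sub_eq_zero]
  refine eq_zero_of_coeff_eq_zero fun k =>
    ae_eq_zero_of_compactTest (intervalIntegrable_coeff (integrableOn_cell _) k) fun η hη => ?_
  have cη := hη.contDiff.continuous
  rw [← setIntegral_mul_modeFn _ cη, show f - fieldLp (trigPoly S c) hcont =
      f + (-1 : ℂ) • fieldLp (trigPoly S c) hcont by rw [neg_one_smul, sub_eq_add_neg],
    pair_add (continuous_modeFn _ cη), pair_smul (continuous_modeFn _ cη), setIntegral_fieldLp_mul,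
    setIntegral_mul_modeFn _ cη]
  have := setIntegral_mul_char (f := trigPoly S c) (η := η) (k := k)
    (integrableOn_cell_of_continuous (hcont.mul (continuous_modeFn (-k) cη)))
  simp only [modeFn] at this ⊢
  rw [this, intervalIntegral_congr_Ioo (g := fun y => coeff (trigPoly S c) k y * η y) ?_ (by simp)]
  · ring
  · filter_upwards [h k] with y hy
    rw [hy, coeff_trigPoly]

/-! ### Integration by parts in the cell -/

lemma continuous_dX {G : ℝ × ℝ → ℂ} (hG : ContDiff ℝ 1 G) : Continuous (dX G) :=
  (hG.continuous_fderiv (by simp)).clm_apply continuous_const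

lemma continuous_dY {G : ℝ × ℝ → ℂ} (hG : ContDiff ℝ 1 G) : Continuous (dY G) :=
  (hG.continuous_fderiv (by simp)).clm_apply continuous_const

lemma hasDerivAt_slice_x {G : ℝ × ℝ → ℂ} (hG : ContDiff ℝ 1 G) (x y : ℝ) :
    HasDerivAt (fun t => G (t, y)) (dX G (x, y)) x := by
  have h := (hG.differentiable (by simp) (x, y)).hasFDerivAt
  exact h.comp_hasDerivAt x ((hasDerivAt_id x).prodMk (hasDerivAt_const x y))

lemma hasDerivAt_slice_y {G : ℝ × ℝ → ℂ} (hG : ContDiff ℝ 1 G) (x y : ℝ) :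
    HasDerivAt (fun t => G (x, t)) (dY G (x, y)) y := by
  have h := (hG.differentiable (by simp) (x, y)).hasFDerivAt
  exact h.comp_hasDerivAt y ((hasDerivAt_const y x).prodMk (hasDerivAt_id y))

lemma integral_dX {G : ℝ × ℝ → ℂ} (hG : ContDiff ℝ 1 G)
    (hp : ∀ x y, G (x + 2 * Real.pi, y) = G (x, y)) : ∫ p in cell, dX G p = 0 := by
  have hc := continuous_dX hG
  rw [setIntegral_cell (integrableOn_cell_of_continuous hc)]
  have : ∀ y, ∫ x in Ioo 0 (2 * Real.pi), dX G (x, y) = 0 := fun y => by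
    rw [← integral_Ioc_eq_integral_Ioo, ← intervalIntegral.integral_of_le Real.two_pi_pos.le,
      intervalIntegral.integral_eq_sub_of_hasDerivAt (fun x _ => hasDerivAt_slice_x hG x y)
        ((hc.comp (by fun_prop : Continuous fun x : ℝ => (x, y))).intervalIntegrable _ _)]
    have := hp 0 y
    rw [zero_add] at this
    rw [this, sub_self]
  simp [this]

lemma integral_dY {G : ℝ × ℝ → ℂ} (hG : ContDiff ℝ 1 G) :
    ∫ p in cell, dY G p = (∫ x in Ioo 0 (2 * Real.pi), G (x, 1)) -
      ∫ x in Ioo 0 (2 * Real.pi), G (x, 0) := by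
  have hc := continuous_dY hG
  have hi := integrableOn_cell_of_continuous hc
  have hs : ∀ y, IntegrableOn (fun x => G (x, y)) (Ioo 0 (2 * Real.pi)) := fun y =>
    ((hG.continuous.comp (by fun_prop : Continuous fun x : ℝ => (x, y))).integrableOn_Icc).mono_set
      Ioo_subset_Icc_self
  rw [← integral_sub (hs 1) (hs 0)]
  have : ∫ p in cell, dY G p = ∫ x in Ioo 0 (2 * Real.pi), ∫ y in Ioo 0 1, dY G (x, y) :=
    setIntegral_prod _ hi
  rw [this]
  refine integral_congr_ae (.of_forall fun x => ?_)
  simp only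
  rw [← integral_Ioc_eq_integral_Ioo, ← intervalIntegral.integral_of_le zero_le_one,
    intervalIntegral.integral_eq_sub_of_hasDerivAt (fun y _ => hasDerivAt_slice_y hG x y)
      ((hc.comp (by fun_prop : Continuous fun y : ℝ => (x, y))).intervalIntegrable _ _)]

/-- Continuously differentiable functions that are `2π`-periodic in `x`. -/
structure IsPeriodicC1 (F : ℝ × ℝ → ℂ) : Prop where
  contDiff : ContDiff ℝ 1 F
  periodic : ∀ x y, F (x + 2 * Real.pi, y) = F (x, y)

lemma IsPeriodicSmooth.isPeriodicC1 {φ : ℝ × ℝ → ℂ} (h : IsPeriodicSmooth φ) : IsPeriodicC1 φ :=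
  ⟨h.contDiff.of_le (by simp), h.periodic⟩

lemma dX_mul {F φ : ℝ × ℝ → ℂ} (hF : ContDiff ℝ 1 F) (hφ : ContDiff ℝ 1 φ) (p : ℝ × ℝ) :
    dX (fun p => F p * φ p) p = F p * dX φ p + dX F p * φ p := by
  have : HasFDerivAt (fun p => F p * φ p) _ p := (hF.differentiable (by simp) p).hasFDerivAt.mul
    (hφ.differentiable (by simp) p).hasFDerivAt
  rw [dX, this.fderiv]
  simp [dX, mul_comm]

lemma dY_mul {F φ : ℝ × ℝ → ℂ} (hF : ContDiff ℝ 1 F) (hφ : ContDiff ℝ 1 φ) (p : ℝ × ℝ) :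
    dY (fun p => F p * φ p) p = F p * dY φ p + dY F p * φ p := by
  have : HasFDerivAt (fun p => F p * φ p) _ p := (hF.differentiable (by simp) p).hasFDerivAt.mul
    (hφ.differentiable (by simp) p).hasFDerivAt
  rw [dY, this.fderiv]
  simp [dY, mul_comm]

lemma integral_mul_dX {F φ : ℝ × ℝ → ℂ} (hF : IsPeriodicC1 F) (hφ : IsPeriodicC1 φ) :
    ∫ p in cell, F p * dX φ p = -∫ p in cell, dX F p * φ p := by
  have h := integral_dX (hF.contDiff.mul hφ.contDiff) fun x y => by
    simp only [hF.periodic, hφ.periodic]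
  simp only [dX_mul hF.contDiff hφ.contDiff] at h
  rw [integral_add] at h
  · exact eq_neg_of_add_eq_zero_left h
  · exact integrableOn_cell_of_continuous (hF.contDiff.continuous.mul (continuous_dX hφ.contDiff))
  · exact integrableOn_cell_of_continuous ((continuous_dX hF.contDiff).mul hφ.contDiff.continuous)

lemma integral_mul_dY {F φ : ℝ × ℝ → ℂ} (hF : IsPeriodicC1 F) (hφ : IsPeriodicC1 φ) :
    (∫ p in cell, F p * dY φ p) + ∫ p in cell, dY F p * φ p =
      (∫ x in Ioo 0 (2 * Real.pi), F (x, 1) * φ (x, 1)) -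
        ∫ x in Ioo 0 (2 * Real.pi), F (x, 0) * φ (x, 0) := by
  have h := integral_dY (hF.contDiff.mul hφ.contDiff)
  simp only [dY_mul hF.contDiff hφ.contDiff] at h
  rw [integral_add] at h
  · exact h
  · exact integrableOn_cell_of_continuous (hF.contDiff.continuous.mul (continuous_dY hφ.contDiff))
  · exact integrableOn_cell_of_continuous ((continuous_dY hF.contDiff).mul hφ.contDiff.continuous)

lemma isWeakDx_fieldLp {F : ℝ × ℝ → ℂ} (hF : IsPeriodicC1 F) :
    IsWeakDx (fieldLp F hF.contDiff.continuous) (fieldLp (dX F) (continuous_dX hF.contDiff)) :=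
  fun φ hφ => by
    rw [setIntegral_fieldLp_mul, setIntegral_fieldLp_mul, integral_mul_dX hF hφ.isPeriodicC1]

lemma IsInteriorTest.eq_zero_wall {φ : ℝ × ℝ → ℂ} (hφ : IsInteriorTest φ) (x : ℝ) :
    φ (x, 0) = 0 ∧ φ (x, 1) = 0 := by
  obtain ⟨a, b, ha, hb, h⟩ := hφ.support
  exact ⟨h x 0 fun h => by linarith [h.1], h x 1 fun h => by linarith [h.2]⟩

lemma isWeakDy_fieldLp {F : ℝ × ℝ → ℂ} (hF : IsPeriodicC1 F) :
    IsWeakDy (fieldLp F hF.contDiff.continuous) (fieldLp (dY F) (continuous_dY hF.contDiff)) :=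
  fun φ hφ => by
    have h := integral_mul_dY hF hφ.isPeriodicC1
    simp only [(hφ.eq_zero_wall _).1, (hφ.eq_zero_wall _).2, mul_zero, integral_zero, sub_self] at h
    rw [setIntegral_fieldLp_mul, setIntegral_fieldLp_mul]
    exact eq_neg_of_add_eq_zero_left h

lemma memLp_wall {g : ℝ → ℂ} (hg : Continuous g) :
    MemLp g 2 (volume.restrict (Ioo (0 : ℝ) (2 * Real.pi))) := by
  obtain ⟨M, hM⟩ := (isCompact_Icc (a := (0 : ℝ)) (b := 2 * Real.pi)).exists_bound_of_continuousOn
    hg.continuousOn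
  refine MemLp.of_bound hg.aestronglyMeasurable M ?_
  filter_upwards [ae_restrict_mem measurableSet_Ioo] with p hp
  exact hM p (Ioo_subset_Icc_self hp)

/-- The class of a continuous function in `L²` of a wall. -/
def wallLp (g : ℝ → ℂ) (hg : Continuous g) : L2Wall := (memLp_wall hg).toLp g

lemma coeFn_wallLp {g : ℝ → ℂ} (hg : Continuous g) :
    wallLp g hg =ᵐ[volume.restrict (Ioo 0 (2 * Real.pi))] g := (memLp_wall hg).coeFn_toLp

lemma continuous_slice {F : ℝ × ℝ → ℂ} (hF : Continuous F) (y : ℝ) :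
    Continuous fun x => F (x, y) :=
  hF.comp (by fun_prop : Continuous fun x : ℝ => (x, y))

lemma hasWallTrace_fieldLp {F : ℝ × ℝ → ℂ} (hF : IsPeriodicC1 F) :
    HasWallTrace (fieldLp F hF.contDiff.continuous)
      (wallLp _ (continuous_slice hF.contDiff.continuous 0))
      (wallLp _ (continuous_slice hF.contDiff.continuous 1)) :=
  ⟨_, isWeakDy_fieldLp hF, fun φ hφ => by
    rw [setIntegral_fieldLp_mul, setIntegral_fieldLp_mul, integral_mul_dY hF hφ.isPeriodicC1]
    congr 1
    · refine integral_congr_ae ?_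
      filter_upwards [coeFn_wallLp (continuous_slice hF.contDiff.continuous 1)] with x hx
      rw [hx]
    · refine integral_congr_ae ?_
      filter_upwards [coeFn_wallLp (continuous_slice hF.contDiff.continuous 0)] with x hx
      rw [hx]⟩

/-! ### Pairing with Fourier modes -/

/-- The pairing of the `k`-th Fourier coefficient of `f` with a function of `y`. -/
def pairing (f : L2Cell) (k : ℤ) (η : ℝ → ℂ) : ℂ := ∫ y in (0 : ℝ)..1, coeff f k y * η y

lemma pairing_eq (f : L2Cell) (k : ℤ) {η : ℝ → ℂ} (hη : Continuous η) :
    pairing f k η = ∫ p in cell, f p * modeFn (-k) η p :=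
  (setIntegral_mul_modeFn f hη k).symm

lemma continuous_conj_comp {η : ℝ → ℂ} (hη : Continuous η) : Continuous fun y => conj (η y) :=
  Complex.continuous_conj.comp hη

lemma continuous_ofReal_mul {c : ℝ → ℝ} (hc : Continuous c) {η : ℝ → ℂ} (hη : Continuous η) :
    Continuous fun y => (c y : ℂ) * η y :=
  (Complex.continuous_ofReal.comp hc).mul hη

/-- The class of `e^{ikx} \overline{η(y)}`. -/
def cmode (k : ℤ) (η : ℝ → ℂ) (hη : Continuous η) : L2Cell :=
  fieldLp (modeFn k fun y => conj (η y))
    (continuous_modeFn k (continuous_conj_comp hη))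

lemma coeFn_cmode (k : ℤ) {η : ℝ → ℂ} (hη : Continuous η) :
    cmode k η hη =ᵐ[volume.restrict cell] modeFn k fun y => conj (η y) :=
  coeFn_fieldLp (continuous_modeFn k (continuous_conj_comp hη))

/-- The conjugate in `cmode` undoes the conjugate linearity of the first slot, so that scalar
products with test fields become bilinear pairings in `η`. -/
lemma inner_cmode (k : ℤ) {η : ℝ → ℂ} (hη : Continuous η) (f : L2Cell) :
    ⟪cmode k η hη, f⟫_ℂ = pairing f k η := by
  rw [pairing_eq f k hη, L2.inner_def]
  refine integral_congr_ae ?_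
  filter_upwards [coeFn_cmode k hη] with p hp
  rw [hp]
  simp [modeFn, conj_char]

lemma pairing_add (f : L2Cell) (k : ℤ) {η θ : ℝ → ℂ} (hη : Continuous η) (hθ : Continuous θ) :
    pairing f k (fun y => η y + θ y) = pairing f k η + pairing f k θ := by
  have hi := intervalIntegrable_coeff (integrableOn_cell f) k
  simp only [pairing, mul_add]
  exact intervalIntegral.integral_add (hi.mul_continuousOn hη.continuousOn)
    (hi.mul_continuousOn hθ.continuousOn)

lemma pairing_const_mul (f : L2Cell) (k : ℤ) (c : ℂ) (η : ℝ → ℂ) :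
    pairing f k (fun y => c * η y) = c * pairing f k η := by
  simp only [pairing, ← intervalIntegral.integral_const_mul]
  exact intervalIntegral.integral_congr fun y _ => mul_left_comm _ _ _

lemma hasDerivAt_conj {η : ℝ → ℂ} {η' : ℂ} {y : ℝ} (h : HasDerivAt η η' y) :
    HasDerivAt (fun y => conj (η y)) (conj η') y :=
  Complex.conjCLE.toContinuousLinearMap.hasFDerivAt.comp_hasDerivAt y h

lemma contDiff_conj {η : ℝ → ℂ} {n : WithTop ℕ∞} (h : ContDiff ℝ n η) :
    ContDiff ℝ n fun y => conj (η y) :=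
  Complex.conjCLE.contDiff.comp h

lemma isPeriodicC1_modeFn (k : ℤ) {η : ℝ → ℂ} (hη : ContDiff ℝ 1 η) :
    IsPeriodicC1 (modeFn k η) :=
  ⟨contDiff_modeFn k hη, fun x y => by simp only [modeFn, char_add_two_pi]⟩

lemma deriv_conj_eq {η : ℝ → ℂ} (hη : ContDiff ℝ 1 η) :
    deriv (fun y => conj (η y)) = fun y => conj (deriv η y) :=
  funext fun y => (hasDerivAt_conj (hη.differentiable (by simp) y).hasDerivAt).deriv

lemma continuous_deriv_of_contDiff {η : ℝ → ℂ} (hη : ContDiff ℝ 1 η) : Continuous (deriv η) :=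
  hη.continuous_deriv (by simp)

lemma fieldLp_congr {F G : ℝ × ℝ → ℂ} (hF : Continuous F) (hG : Continuous G)
    (h : ∀ p ∈ cell, F p = G p) : fieldLp F hF = fieldLp G hG :=
  MemLp.toLp_congr _ _
    ((ae_restrict_iff' (measurableSet_Ioo.prod measurableSet_Ioo)).2 (.of_forall h))

lemma smul_fieldLp (c : ℂ) {F : ℝ × ℝ → ℂ} (hF : Continuous F) :
    c • fieldLp F hF = fieldLp (fun p => c * F p) (continuous_const.mul hF) := by
  rw [fieldLp, ← MemLp.toLp_const_smul]
  rfl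

lemma isWeakDx_cmode (k : ℤ) {η : ℝ → ℂ} (hη : ContDiff ℝ 1 η) :
    IsWeakDx (cmode k η hη.continuous) ((Complex.I * k : ℂ) • cmode k η hη.continuous) := by
  have hc := contDiff_conj hη
  have h := isWeakDx_fieldLp (isPeriodicC1_modeFn k hc)
  rw [cmode, smul_fieldLp]
  convert h using 1
  exact fieldLp_congr _ _ fun p _ => (dX_modeFn k (hc.differentiable (by simp)) p).symm

lemma isWeakDy_cmode (k : ℤ) {η : ℝ → ℂ} (hη : ContDiff ℝ 1 η) :
    IsWeakDy (cmode k η hη.continuous) (cmode k (deriv η) (continuous_deriv_of_contDiff hη)) := by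
  have hc := contDiff_conj hη
  have h := isWeakDy_fieldLp (isPeriodicC1_modeFn k hc)
  rw [cmode, cmode]
  convert h using 1
  exact fieldLp_congr _ _ fun p _ => by
    rw [dY_modeFn k (hc.differentiable (by simp)) p, deriv_conj_eq hη]

lemma wallLp_zero {g : ℝ → ℂ} (hg : Continuous g) (h : ∀ x, g x = 0) : wallLp g hg = 0 := by
  rw [Lp.eq_zero_iff_ae_eq_zero]
  filter_upwards [coeFn_wallLp hg] with x hx
  rw [hx, h, Pi.zero_apply]

lemma hasWallTrace_cmode (k : ℤ) {η : ℝ → ℂ} (hη : ContDiff ℝ 1 η) (h0 : η 0 = 0) (h1 : η 1 = 0) :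
    HasWallTrace (cmode k η hη.continuous) 0 0 := by
  have h := hasWallTrace_fieldLp (isPeriodicC1_modeFn k (contDiff_conj hη))
  rwa [wallLp_zero _ fun x => by simp [modeFn, h0], wallLp_zero _ fun x => by simp [modeFn, h1]] at h

lemma coeFn_mulY {c : ℝ → ℝ} (hc : Continuous c) (f : L2Cell) :
    mulY c hc f =ᵐ[volume.restrict cell] fun p => (c p.2 : ℂ) * f p :=
  (memLp_mulY hc f).coeFn_toLp

lemma mulY_cmode {c : ℝ → ℝ} (hc : Continuous c) (k : ℤ) {η : ℝ → ℂ} (hη : Continuous η) :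
    mulY c hc (cmode k η hη) =
      cmode k (fun y => c y * η y) (continuous_ofReal_mul hc hη) := by
  refine Lp.ext ?_
  filter_upwards [coeFn_mulY hc (cmode k η hη),
    coeFn_cmode k hη, coeFn_cmode k (continuous_ofReal_mul hc hη)] with p h1 h2 h3
  rw [h1, h2, h3]
  simp [modeFn]
  ring

lemma pairing_mulY {c : ℝ → ℝ} (hc : Continuous c) (f : L2Cell) (k : ℤ) {η : ℝ → ℂ}
    (hη : Continuous η) : pairing (mulY c hc f) k η = pairing f k fun y => c y * η y := by
  rw [pairing_eq _ _ hη, pairing_eq _ _ (continuous_ofReal_mul hc hη)]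
  refine integral_congr_ae ?_
  filter_upwards [coeFn_mulY hc f] with p hp
  rw [hp]
  simp [modeFn]
  ring

lemma pairing_add_left (f g : L2Cell) (k : ℤ) {η : ℝ → ℂ} (hη : Continuous η) :
    pairing (f + g) k η = pairing f k η + pairing g k η := by
  rw [← inner_cmode k hη, inner_add_right, inner_cmode, inner_cmode]

lemma pairing_smul_left (c : ℂ) (f : L2Cell) (k : ℤ) {η : ℝ → ℂ} (hη : Continuous η) :
    pairing (c • f) k η = c * pairing f k η := by
  rw [← inner_cmode k hη, inner_smul_right, inner_cmode]

lemma pairing_neg_left (f : L2Cell) (k : ℤ) {η : ℝ → ℂ} (hη : Continuous η) :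
    pairing (-f) k η = -pairing f k η := by
  rw [← inner_cmode k hη, inner_neg_right, inner_cmode]

/-! ### Weak derivatives of Fourier coefficients -/

/-- Periodicity leaves no boundary terms in `x`. The relation holds between the coefficients almost
everywhere, so nothing is asked of `η`. -/
lemma IsWeakDx.pairing {f g : L2Cell} (h : IsWeakDx f g) (k : ℤ) (η : ℝ → ℂ) :
    pairing g k η = Complex.I * k * pairing f k η := by
  have hf := intervalIntegrable_coeff (integrableOn_cell f) k
  have hg := intervalIntegrable_coeff (integrableOn_cell g) k
  have key := ae_eq_zero_of_compactTest (d := fun y => coeff g k y - Complex.I * k * coeff f k y)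
    (hg.sub (hf.const_mul _)) fun θ hθ => by
      have cθ := hθ.contDiff.continuous
      have h1 := h _ (isInteriorTest_modeFn (-k) hθ)
      simp only [dX_modeFn (-k) (hθ.contDiff.differentiable (by simp)), mul_left_comm _
        (Complex.I * _)] at h1
      rw [integral_const_mul, setIntegral_mul_modeFn f cθ, setIntegral_mul_modeFn g cθ] at h1
      simp only [sub_mul, mul_assoc]
      rw [intervalIntegral.integral_sub (hg.mul_continuousOn cθ.continuousOn)
        (((hf.mul_continuousOn cθ.continuousOn).const_mul _).const_mul _),
        intervalIntegral.integral_const_mul, intervalIntegral.integral_const_mul]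
      push_cast at h1
      linear_combination h1
  rw [PeriodicChannel.pairing, PeriodicChannel.pairing, ← intervalIntegral.integral_const_mul]
  refine intervalIntegral_congr_Ioo ?_ (by simp)
  filter_upwards [key] with y hy
  linear_combination η y * hy

/-- Here the wall terms vanish on account of `f`, so `η` may be arbitrary at the walls. -/
lemma IsWeakDy.pairing_of_trace {f g : L2Cell} (h : IsWeakDy f g) (ht : HasWallTrace f 0 0) (k : ℤ)
    {η : ℝ → ℂ} (hη : ContDiff ℝ ∞ η) : pairing g k η = -pairing f k (deriv η) := by
  obtain ⟨g', hg', h'⟩ := ht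
  obtain rfl : g = g' := h.eq.symm.trans hg'.eq
  have h1 := h' _ (isPeriodicSmooth_modeFn (-k) hη)
  rw [wallPair_zero, wallPair_zero, sub_zero] at h1
  simp only [dY_modeFn (-k) (hη.differentiable (by simp))] at h1
  rw [pairing_eq g k hη.continuous, pairing_eq f k (contDiff_deriv_infty hη).continuous]
  exact eq_neg_of_add_eq_zero_right h1

/-- Here the wall terms vanish on account of `η`, and nothing is known of a trace of `f`. The
definition of `IsWeakDy` admits only tests supported away from the walls. It still shows that the
coefficient of `f` is a primitive of that of `g` plus a constant, and the constant is invisible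
because `∫ η' = 0`. -/
lemma IsWeakDy.pairing_of_vanish {f g : L2Cell} (h : IsWeakDy f g) (k : ℤ) {η : ℝ → ℂ}
    (hη : ContDiff ℝ ∞ η) (h0 : η 0 = 0) (h1 : η 1 = 0) :
    pairing g k η = -pairing f k (deriv η) := by
  have hf := intervalIntegrable_coeff (integrableOn_cell f) k
  have hg := intervalIntegrable_coeff (integrableOn_cell g) k
  have hp := intervalIntegrable_primitive hg
  have hparts : ∀ θ : ℝ → ℂ, ContDiff ℝ ∞ θ → θ 1 = 0 →
      ∫ y in (0 : ℝ)..1, primitive (coeff g k) y * deriv θ y =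
        -∫ y in (0 : ℝ)..1, coeff g k y * θ y := fun θ hθ hθ1 => by
    rw [integral_primitive_mul hg (hasDerivAt_of_contDiff_infty hθ)
      (contDiff_deriv_infty hθ).continuous, hθ1, mul_zero, zero_sub]
  obtain ⟨c, hc⟩ := ae_eq_const_of_compactTest
    (d := fun y => coeff f k y - primitive (coeff g k) y) (hf.sub hp) fun θ hθ => by
      have cθ := (contDiff_deriv_infty hθ.contDiff).continuous
      have e1 := h _ (isInteriorTest_modeFn (-k) hθ)
      simp only [dY_modeFn (-k) (hθ.contDiff.differentiable (by simp))] at e1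
      rw [setIntegral_mul_modeFn f cθ, setIntegral_mul_modeFn g hθ.contDiff.continuous] at e1
      simp only [sub_mul]
      rw [intervalIntegral.integral_sub (hf.mul_continuousOn cθ.continuousOn)
        (hp.mul_continuousOn cθ.continuousOn), hparts θ hθ.contDiff hθ.isClamped.one, e1]
      ring
  have cη := (contDiff_deriv_infty hη).continuous
  have e2 : PeriodicChannel.pairing f k (deriv η) =
      ∫ y in (0 : ℝ)..1, (primitive (coeff g k) y * deriv η y + c * deriv η y) := by
    refine intervalIntegral_congr_Ioo ?_ (by simp)
    filter_upwards [hc] with y hy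
    linear_combination deriv η y * hy
  have e3 : ∫ y in (0 : ℝ)..1, deriv η y = 0 := by
    rw [intervalIntegral.integral_eq_sub_of_hasDerivAt
      (fun y _ => hasDerivAt_of_contDiff_infty hη y) (cη.intervalIntegrable _ _), h0, h1, sub_self]
  rw [e2, intervalIntegral.integral_add (hp.mul_continuousOn cη.continuousOn)
    ((cη.intervalIntegrable _ _).const_mul _), intervalIntegral.integral_const_mul, e3,
    hparts η hη h1, PeriodicChannel.pairing]
  ring

/-- Orthogonality to the gradient of `e^{-ikx} η(y)`. As `η` is free at the walls, this contains
both `ik u_k + v_k' = 0` and the vanishing of `v_k` there. -/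
lemma pairing_div {w : VectorL2} (hw : w ∈ H) (k : ℤ) {η : ℝ → ℂ} (hη : ContDiff ℝ ∞ η) :
    pairing w.snd k (deriv η) = Complex.I * k * pairing w.fst k η := by
  have h := hw.1 _ (isPeriodicSmooth_modeFn (-k) hη)
  simp only [dX_modeFn (-k) (hη.differentiable (by simp)),
    dY_modeFn (-k) (hη.differentiable (by simp)), mul_left_comm _ (Complex.I * _)] at h
  rw [integral_const_mul, ← pairing_eq _ _ hη.continuous,
    ← pairing_eq _ _ (contDiff_deriv_infty hη).continuous] at h
  push_cast at h
  linear_combination h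

lemma coeff_zero_of_mem_H {w : VectorL2} (hw : w ∈ H) :
    (∀ᵐ y ∂volume.restrict (Ioo (0 : ℝ) 1), coeff w.fst 0 y = 0) ∧
      ∀ᵐ y ∂volume.restrict (Ioo (0 : ℝ) 1), coeff w.snd 0 y = 0 := by
  constructor
  · refine ae_eq_zero_of_compactTest (intervalIntegrable_coeff (integrableOn_cell _) 0) fun η hη => ?_
    rw [← setIntegral_mul_modeFn _ hη.contDiff.continuous, ← (hw.2 η hη.contDiff).1]
    simp [modeFn]
  · refine ae_eq_zero_of_compactTest (intervalIntegrable_coeff (integrableOn_cell _) 0) fun η hη => ?_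
    rw [← setIntegral_mul_modeFn _ hη.contDiff.continuous, ← (hw.2 η hη.contDiff).2]
    simp [modeFn]

/-! ### Orthogonality to the compactly supported solenoidal fields -/

/-- In one Fourier mode `h1` says that the field `(a, b)` is irrotational, `a' = iκ b`, and `h2`
that it is solenoidal and tangent to the walls, `b' = -iκ a` with `b = 0` at the ends. Then `(κ Im(a
b̄))' = κ²(|a|² + |b|²)` has vanishing boundary terms. -/
lemma ae_eq_zero_of_solenoidal_orthogonal_aux {a b : ℝ → ℂ} {κ : ℝ} (hκ : κ ≠ 0)
    (ha : ∀ s t, IntervalIntegrable a volume s t) (hb : ∀ s t, IntervalIntegrable b volume s t)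
    (h1 : ∀ ψ, IsCompactTest ψ →
      (∫ y in (0 : ℝ)..1, a y * deriv ψ y) + Complex.I * κ * ∫ y in (0 : ℝ)..1, b y * ψ y = 0)
    (h2 : ∀ η, ContDiff ℝ ∞ η →
      ∫ y in (0 : ℝ)..1, b y * deriv η y = Complex.I * κ * ∫ y in (0 : ℝ)..1, a y * η y) :
    (∀ᵐ y ∂volume.restrict (Ioo (0 : ℝ) 1), a y = 0) ∧
      ∀ᵐ y ∂volume.restrict (Ioo (0 : ℝ) 1), b y = 0 := by
  have hpb := continuous_primitive hb
  have hpa := continuous_primitive ha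
  obtain ⟨c, hc⟩ := ae_eq_const_of_compactTest
    (d := fun y => a y - Complex.I * κ * primitive b y)
    ((ha 0 1).sub ((hpb.intervalIntegrable 0 1).const_mul _)) fun ψ hψ => by
      have cψ := (contDiff_deriv_infty hψ.contDiff).continuous
      have e := integral_primitive_mul (hb 0 1) (hasDerivAt_of_contDiff_infty hψ.contDiff) cψ
      simp only [sub_mul, mul_assoc]
      have i1 : IntervalIntegrable (fun y => primitive b y * deriv ψ y) volume 0 1 :=
        (hpb.mul cψ).intervalIntegrable _ _
      rw [intervalIntegral.integral_sub ((ha 0 1).mul_continuousOn cψ.continuousOn)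
        ((i1.const_mul _).const_mul _), intervalIntegral.integral_const_mul,
        intervalIntegral.integral_const_mul, e, hψ.isClamped.one]
      linear_combination h1 ψ hψ
  -- The constant test function yields the wall condition at `y = 1`; the one at `y = 0` is built
  -- into the primitive.
  have ha1 : primitive a 1 = 0 := by
    have := h2 (fun _ => 1) contDiff_const
    simp only [deriv_const', mul_zero, mul_one, intervalIntegral.integral_zero] at this
    exact (mul_eq_zero.1 this.symm).resolve_left
      (mul_ne_zero Complex.I_ne_zero (by exact_mod_cast hκ))
  have hbN : ∀ᵐ y ∂volume.restrict (Ioo (0 : ℝ) 1), b y = -(Complex.I * κ) * primitive a y := by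
    have := ae_eq_zero_of_compactTest (d := fun y => b y - -(Complex.I * κ) * primitive a y)
      ((hb 0 1).sub ((hpa.intervalIntegrable 0 1).const_mul _)) fun θ hθ => by
        have cθ := hθ.contDiff.continuous
        have e1 := h2 _ (contDiff_infty_primitive hθ.contDiff)
        have e2 := integral_primitive_mul (ha 0 1) (hasDerivAt_primitive cθ) cθ
        rw [deriv_primitive cθ] at e1
        rw [ha1] at e2
        simp only [sub_mul, mul_assoc]
        have i1 : IntervalIntegrable (fun y => primitive a y * θ y) volume 0 1 :=
          (hpa.mul cθ).intervalIntegrable _ _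
        rw [intervalIntegral.integral_sub ((hb 0 1).mul_continuousOn cθ.continuousOn)
          (i1.const_mul _), intervalIntegral.integral_const_mul, e1, e2]
        ring
    filter_upwards [this] with y hy using sub_eq_zero.1 hy
  -- The classes `a` and `b` are replaced by representatives that satisfy the first order system
  -- classically. `N₀` is the one obtained from `a`, and `N` is the differentiable one obtained from
  -- `A`; they agree on `[0, 1]`.
  set N₀ : ℝ → ℂ := fun y => -(Complex.I * κ) * primitive a y with hN₀
  have cN₀ : Continuous N₀ := continuous_const.mul hpa
  set A : ℝ → ℂ := fun y => c + Complex.I * κ * primitive N₀ y with hA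
  have dA : ∀ y, HasDerivAt A (Complex.I * κ * N₀ y) y := fun y =>
    ((hasDerivAt_primitive cN₀ y).const_mul _).const_add _
  have cA : Continuous A := continuous_iff_continuousAt.2 fun y => (dA y).continuousAt
  have haA : ∀ᵐ y ∂volume.restrict (Ioo (0 : ℝ) 1), a y = A y := by
    filter_upwards [hc, ae_Ioo_of_forall_Icc fun y hy => primitive_congr_Ioo hbN hy] with y h3 h4
    have h5 : primitive b y = primitive N₀ y := h4
    simp only [hA, ← h5]
    linear_combination h3
  set N : ℝ → ℂ := fun y => -(Complex.I * κ) * primitive A y with hN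
  have dN : ∀ y, HasDerivAt N (-(Complex.I * κ) * A y) y := fun y =>
    (hasDerivAt_primitive cA y).const_mul _
  have hNN : ∀ y ∈ Icc (0 : ℝ) 1, N₀ y = N y := fun y hy => by
    simp only [hN₀, hN, primitive_congr_Ioo haA hy]
  have hBd : ∀ y, HasDerivAt (fun y => κ * (A y * conj (N y)).im) _ y := fun y =>
    (hasDerivAt_im ((dA y).mul (hasDerivAt_conj (dN y)))).const_mul κ
  have hz := eq_zero_of_monotone_energy (D := fun y => κ ^ 2 * (Complex.normSq (N y) +
    Complex.normSq (A y))) (fun y => (hBd y).continuousAt) (fun y hy => by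
      refine (hBd y).congr_deriv ?_
      rw [hNN y (Ioo_subset_Icc_self hy)]
      simp [Complex.normSq_apply]
      ring) (fun y _ => mul_nonneg (sq_nonneg _)
        (add_nonneg (Complex.normSq_nonneg _) (Complex.normSq_nonneg _)))
    (by
      have e1 : N 1 = 0 := by
        rw [← hNN 1 (by simp)]
        simp [hN₀, ha1]
      have e0 : N 0 = 0 := by simp [hN]
      rw [e0, e1]
      simp)
  have hAN : ∀ y ∈ Ioo (0 : ℝ) 1, A y = 0 ∧ N y = 0 := fun y hy => by
    have h3 := (mul_eq_zero.1 (hz y hy)).resolve_left (by positivity)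
    have h4 := Complex.normSq_nonneg (N y)
    have h5 := Complex.normSq_nonneg (A y)
    exact ⟨Complex.normSq_eq_zero.1 (by linarith), Complex.normSq_eq_zero.1 (by linarith)⟩
  have hm := ae_restrict_mem (μ := volume) (measurableSet_Ioo (a := (0 : ℝ)) (b := 1))
  constructor
  · filter_upwards [haA, hm] with y h3 h4
    rw [h3, (hAN y h4).1]
  · filter_upwards [hbN, hm] with y h3 h4
    rw [h3]
    exact (hNN y (Ioo_subset_Icc_self h4)).trans (hAN y h4).2

lemma ae_eq_zero_of_solenoidal_orthogonal {a b : ℝ → ℂ} {κ : ℝ} (hκ : κ ≠ 0)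
    (ha : IntervalIntegrable a volume 0 1) (hb : IntervalIntegrable b volume 0 1)
    (h1 : ∀ ψ, IsCompactTest ψ →
      (∫ y in (0 : ℝ)..1, a y * deriv ψ y) + Complex.I * κ * ∫ y in (0 : ℝ)..1, b y * ψ y = 0)
    (h2 : ∀ η, ContDiff ℝ ∞ η →
      ∫ y in (0 : ℝ)..1, b y * deriv η y = Complex.I * κ * ∫ y in (0 : ℝ)..1, a y * η y) :
    (∀ᵐ y ∂volume.restrict (Ioo (0 : ℝ) 1), a y = 0) ∧
      ∀ᵐ y ∂volume.restrict (Ioo (0 : ℝ) 1), b y = 0 := by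
  have hi : ∀ {f : ℝ → ℂ}, IntervalIntegrable f volume 0 1 → ∀ s t,
      IntervalIntegrable ((Ioo (0 : ℝ) 1).indicator f) volume s t := fun hf s t => by
    refine Integrable.intervalIntegrable ?_
    rw [integrable_indicator_iff measurableSet_Ioo]
    rwa [intervalIntegrable_iff_integrableOn_Ioo_of_le zero_le_one] at hf
  have he : ∀ f : ℝ → ℂ, ∀ᵐ y ∂volume.restrict (Ioo (0 : ℝ) 1), (Ioo (0 : ℝ) 1).indicator f y = f y :=
    fun f => (ae_restrict_iff' measurableSet_Ioo).2
      (.of_forall fun y hy => by rw [indicator_of_mem hy])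
  have hI : ∀ f η : ℝ → ℂ, ∫ y in (0 : ℝ)..1, (Ioo (0 : ℝ) 1).indicator f y * η y =
      ∫ y in (0 : ℝ)..1, f y * η y := fun f η =>
    intervalIntegral_congr_Ioo (by filter_upwards [he f] with y hy; rw [hy]) (by simp)
  obtain ⟨h3, h4⟩ := ae_eq_zero_of_solenoidal_orthogonal_aux hκ (hi ha) (hi hb)
    (fun ψ hψ => by rw [hI, hI]; exact h1 ψ hψ) (fun η hη => by rw [hI, hI]; exact h2 η hη)
  constructor
  · filter_upwards [h3, he a] with y h5 h6
    rw [← h6, h5]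
  · filter_upwards [h4, he b] with y h5 h6
    rw [← h6, h5]

/-! ### Solenoidal test fields -/

lemma memH2_cmode (k : ℤ) {η : ℝ → ℂ} (hη : ContDiff ℝ ∞ η) : MemH2 (cmode k η hη.continuous) := by
  have h0 := hη.of_le (m := 1) (by simp)
  have h1 := (contDiff_deriv_infty hη).of_le (m := 1) (by simp)
  exact ⟨_, _, _, _, _, isWeakDx_cmode k h0, isWeakDy_cmode k h0, (isWeakDx_cmode k h0).smul _,
    (isWeakDy_cmode k h0).smul _, isWeakDy_cmode k h1⟩

lemma laplacian_cmode (k : ℤ) {η : ℝ → ℂ} (hη : ContDiff ℝ ∞ η) :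
    laplacian (cmode k η hη.continuous) =
      (Complex.I * k : ℂ) • (Complex.I * k : ℂ) • cmode k η hη.continuous +
        cmode k (deriv (deriv η)) (contDiff_deriv_infty (contDiff_deriv_infty hη)).continuous := by
  have h0 := hη.of_le (m := 1) (by simp)
  have h1 := (contDiff_deriv_infty hη).of_le (m := 1) (by simp)
  rw [laplacian, (isWeakDx_cmode k h0).eq, ((isWeakDx_cmode k h0).smul _).eq,
    (isWeakDy_cmode k h0).eq, (isWeakDy_cmode k h1).eq]

/-- The solenoidal field with stream function `e^{ikx} \overline{ψ(y)}`. -/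
def streamField (k : ℤ) {ψ : ℝ → ℂ} (hψ : IsClamped ψ) : VectorL2 :=
  WithLp.toLp 2 (cmode k (deriv ψ) hψ.continuous_deriv,
    (-(Complex.I * k) : ℂ) • cmode k ψ hψ.contDiff.continuous)

/-- The divergence vanishes identically, the normal component vanishes at the walls with `ψ`, and `k
≠ 0` gives zero mean in `x`. -/
lemma streamField_mem_H {k : ℤ} (hk : k ≠ 0) {ψ : ℝ → ℂ} (hψ : IsClamped ψ) :
    streamField k hψ ∈ H := by
  have h0 := hψ.contDiff.of_le (m := 1) (by simp)
  have h1 := (contDiff_deriv_infty hψ.contDiff).of_le (m := 1) (by simp)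
  refine ⟨fun q hq => ?_, fun η hη => ?_⟩
  · have e1 := integral_mul_dX (isPeriodicC1_modeFn k (contDiff_conj h1)) hq.isPeriodicC1
    have e2 := integral_mul_dY (isPeriodicC1_modeFn k (contDiff_conj h0)) hq.isPeriodicC1
    simp only [dX_modeFn k ((contDiff_conj h1).differentiable (by simp)), mul_assoc] at e1
    simp only [dY_modeFn k ((contDiff_conj h0).differentiable (by simp)), deriv_conj_eq h0] at e2
    rw [integral_const_mul, integral_const_mul] at e1
    simp only [modeFn, hψ.zero, hψ.one, map_zero, mul_zero, zero_mul, integral_zero, sub_self] at e2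
    rw [show (streamField k hψ).fst = cmode k (deriv ψ) hψ.continuous_deriv from rfl,
      show (streamField k hψ).snd = (-(Complex.I * k) : ℂ) • cmode k ψ hψ.contDiff.continuous from rfl,
      pair_smul hq.continuous_dY, cmode, cmode, setIntegral_fieldLp_mul, setIntegral_fieldLp_mul, e1]
    simp only [modeFn]
    linear_combination -(Complex.I * k) * e2
  · have hc : Continuous fun p : ℝ × ℝ => η p.2 := hη.continuous.comp continuous_snd
    have key : ∀ {θ : ℝ → ℂ} (hθ : Continuous θ), ∫ p in cell, cmode k θ hθ p * η p.2 = 0 := by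
      intro θ hθ
      have hm := continuous_modeFn k (continuous_conj_comp hθ)
      have hi : IntegrableOn (fun p : ℝ × ℝ => modeFn k (fun y => conj (θ y)) p * η p.2) cell :=
        integrableOn_cell_of_continuous (hm.mul hc)
      rw [cmode, setIntegral_fieldLp_mul, setIntegral_cell hi]
      have : ∀ y, ∫ x in Ioo 0 (2 * Real.pi), modeFn k (fun y => conj (θ y)) (x, y) * η y = 0 :=
        fun y => by
          simp only [modeFn, mul_assoc]
          rw [integral_mul_const, ← integral_Ioc_eq_integral_Ioo,
            ← intervalIntegral.integral_of_le Real.two_pi_pos.le, integral_char, if_neg hk, zero_mul]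
      simp [this]
    refine ⟨key hψ.continuous_deriv, ?_⟩
    rw [show (streamField k hψ).snd = (-(Complex.I * k) : ℂ) • cmode k ψ hψ.contDiff.continuous from
      rfl, pair_smul hc, key, mul_zero]

lemma streamField_mem_domain {k : ℤ} (hk : k ≠ 0) {ψ : ℝ → ℂ} (hψ : IsClamped ψ) :
    (⟨streamField k hψ, streamField_mem_H hk hψ⟩ : H) ∈ oseenDomain :=
  ⟨⟨memH2_cmode k (contDiff_deriv_infty hψ.contDiff), (memH2_cmode k hψ.contDiff).smul _⟩,
    hasWallTrace_cmode k ((contDiff_deriv_infty hψ.contDiff).of_le (by simp)) hψ.deriv_zero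
      hψ.deriv_one,
    (hasWallTrace_cmode k (hψ.contDiff.of_le (by simp)) hψ.zero hψ.one).smul_zero _⟩

lemma inner_streamField (k : ℤ) {ψ : ℝ → ℂ} (hψ : IsClamped ψ) (f : VectorL2) :
    ⟪streamField k hψ, f⟫_ℂ = pairing f.fst k (deriv ψ) + Complex.I * k * pairing f.snd k ψ := by
  rw [WithLp.prod_inner_apply]
  simp only [streamField]
  rw [inner_smul_left, inner_cmode, inner_cmode]
  simp

/-- The domain of the Oseen operator is dense. -/
theorem dense_oseenDomain : Dense (oseenDomain : Set H) := by
  rw [Submodule.dense_iff_topologicalClosure_eq_top, Submodule.topologicalClosure_eq_top_iff,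
    Submodule.eq_bot_iff]
  intro φ hφ
  -- A field of `H` orthogonal to the domain is orthogonal to the stream fields with compactly
  -- supported `ψ`, hence irrotational in each mode. It is also solenoidal and tangent to the walls,
  -- so every mode vanishes.
  have hk : ∀ k : ℤ, (∀ᵐ y ∂volume.restrict (Ioo (0 : ℝ) 1), coeff (φ : VectorL2).fst k y = 0) ∧
      ∀ᵐ y ∂volume.restrict (Ioo (0 : ℝ) 1), coeff (φ : VectorL2).snd k y = 0 := fun k => by
    rcases eq_or_ne k 0 with rfl | hk
    · exact coeff_zero_of_mem_H φ.2
    refine ae_eq_zero_of_solenoidal_orthogonal (κ := k) (by exact_mod_cast hk)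
      (intervalIntegrable_coeff (integrableOn_cell _) k)
      (intervalIntegrable_coeff (integrableOn_cell _) k) (fun ψ hψ => ?_) fun η hη => ?_
    · have h := (Submodule.mem_orthogonal _ _).1 hφ _ (streamField_mem_domain hk hψ.isClamped)
      rw [Submodule.coe_inner, inner_streamField] at h
      exact_mod_cast h
    · exact_mod_cast pairing_div φ.2 k hη
  have hu := eq_zero_of_coeff_eq_zero fun k => (hk k).1
  have hv := eq_zero_of_coeff_eq_zero fun k => (hk k).2
  exact Subtype.ext (WithLp.ofLp_injective 2 (Prod.ext hu hv))

/-! ### The very weak form of the eigenvalue equations -/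

lemma hasDerivAt_poiseuille (C y : ℝ) : HasDerivAt (poiseuille C) (C * (2 * y - 1)) y :=
  hasDerivAt_profile C y

lemma deriv_poiseuille (C : ℝ) : deriv (poiseuille C) = fun y => C * (2 * y - 1) :=
  funext fun y => (hasDerivAt_poiseuille C y).deriv

lemma contDiff_deriv_poiseuille (C : ℝ) : ContDiff ℝ ∞ (deriv (poiseuille C)) :=
  (contDiff_infty_iff_deriv.1 (contDiff_poiseuille C)).2

lemma contDiff_ofReal_mul {c : ℝ → ℝ} (hc : ContDiff ℝ ∞ c) {η : ℝ → ℂ} (hη : ContDiff ℝ ∞ η) :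
    ContDiff ℝ ∞ fun y => (c y : ℂ) * η y :=
  (Complex.ofRealCLM.contDiff.comp hc).mul hη

lemma deriv_poiseuille_mul (C : ℝ) {η : ℝ → ℂ} (hη : ContDiff ℝ ∞ η) :
    deriv (fun y => (poiseuille C y : ℂ) * η y) =
      fun y => ((deriv (poiseuille C) y : ℝ) : ℂ) * η y + (poiseuille C y : ℂ) * deriv η y := by
  funext y
  rw [deriv_poiseuille]
  exact ((hasDerivAt_poiseuille C y).ofReal_comp.mul (hasDerivAt_of_contDiff_infty hη y)).deriv

lemma deriv_deriv_poiseuille_mul (C : ℝ) {η : ℝ → ℂ} (hη : ContDiff ℝ ∞ η) :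
    deriv (fun y => ((deriv (poiseuille C) y : ℝ) : ℂ) * η y) =
      fun y => 2 * C * η y + ((deriv (poiseuille C) y : ℝ) : ℂ) * deriv η y := by
  funext y
  rw [deriv_poiseuille]
  have := ((hasDerivAt_profile₁ C y).ofReal_comp.mul (hasDerivAt_of_contDiff_infty hη y)).deriv
  push_cast at this ⊢
  exact this

/-- The very weak form split into separate pairings, so that both eigenvalue equations can be
brought to it by linear algebra alone. -/
lemma isVeryWeakOrrSommerfeld_of_pairing {ν C K σ : ℝ} {μ : ℂ} {f : L2Cell} {k : ℤ}
    (h : ∀ ψ, IsClamped ψ → ν * pairing f k (deriv (deriv (deriv (deriv ψ)))) =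
      (2 * ν * K ^ 2 - μ) * pairing f k (deriv (deriv ψ)) +
        Complex.I * K * pairing f k (fun y => (poiseuille C y : ℂ) * deriv (deriv ψ) y) +
        2 * Complex.I * K * (1 - σ) * pairing f k (fun y => ((deriv (poiseuille C) y : ℝ) : ℂ) * deriv ψ y) +
        (-(2 * Complex.I * K * σ * C) + μ * K ^ 2 - ν * K ^ 4) * pairing f k ψ -
        Complex.I * K ^ 3 * pairing f k (fun y => (poiseuille C y : ℂ) * ψ y)) :
    IsVeryWeakOrrSommerfeld ν C K σ μ (coeff f k) := fun ψ hψ => by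
  have c0 := hψ.contDiff.continuous
  have c1 := hψ.continuous_deriv
  have c2 := hψ.continuous_deriv₂
  have cU := continuous_poiseuille C
  have cU' := continuous_deriv_poiseuille C
  have i1 : Continuous fun y => (2 * ν * K ^ 2 - μ) * deriv (deriv ψ) y := by fun_prop
  have i2 : Continuous fun y => Complex.I * K * ((poiseuille C y : ℂ) * deriv (deriv ψ) y) :=
    continuous_const.mul (continuous_ofReal_mul cU c2)
  have i3 : Continuous fun y =>
      2 * Complex.I * K * (1 - σ) * (((deriv (poiseuille C) y : ℝ) : ℂ) * deriv ψ y) :=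
    continuous_const.mul (continuous_ofReal_mul cU' c1)
  have i4 : Continuous fun y => (-(2 * Complex.I * K * σ * C) + μ * K ^ 2 - ν * K ^ 4) * ψ y := by
    fun_prop
  have i5 : Continuous fun y => -(Complex.I * K ^ 3) * ((poiseuille C y : ℂ) * ψ y) :=
    continuous_const.mul (continuous_ofReal_mul cU c0)
  have e : pairing f k (fun y => (2 * ν * K ^ 2 - μ) * deriv (deriv ψ) y +
      Complex.I * K * ((poiseuille C y : ℂ) * deriv (deriv ψ) y) +
      2 * Complex.I * K * (1 - σ) * (((deriv (poiseuille C) y : ℝ) : ℂ) * deriv ψ y) +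
      (-(2 * Complex.I * K * σ * C) + μ * K ^ 2 - ν * K ^ 4) * ψ y +
      -(Complex.I * K ^ 3) * ((poiseuille C y : ℂ) * ψ y)) =
      (2 * ν * K ^ 2 - μ) * pairing f k (deriv (deriv ψ)) +
        Complex.I * K * pairing f k (fun y => (poiseuille C y : ℂ) * deriv (deriv ψ) y) +
        2 * Complex.I * K * (1 - σ) *
          pairing f k (fun y => ((deriv (poiseuille C) y : ℝ) : ℂ) * deriv ψ y) +
        (-(2 * Complex.I * K * σ * C) + μ * K ^ 2 - ν * K ^ 4) * pairing f k ψ +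
        -(Complex.I * K ^ 3) * pairing f k (fun y => (poiseuille C y : ℂ) * ψ y) := by
    have i12 : Continuous fun y => (2 * ν * K ^ 2 - μ) * deriv (deriv ψ) y +
      Complex.I * K * ((poiseuille C y : ℂ) * deriv (deriv ψ) y) := i1.add i2
    have i123 : Continuous fun y => (2 * ν * K ^ 2 - μ) * deriv (deriv ψ) y +
      Complex.I * K * ((poiseuille C y : ℂ) * deriv (deriv ψ) y) +
      2 * Complex.I * K * (1 - σ) * (((deriv (poiseuille C) y : ℝ) : ℂ) * deriv ψ y) := i12.add i3
    have i1234 : Continuous fun y => (2 * ν * K ^ 2 - μ) * deriv (deriv ψ) y +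
      Complex.I * K * ((poiseuille C y : ℂ) * deriv (deriv ψ) y) +
      2 * Complex.I * K * (1 - σ) * (((deriv (poiseuille C) y : ℝ) : ℂ) * deriv ψ y) +
      (-(2 * Complex.I * K * σ * C) + μ * K ^ 2 - ν * K ^ 4) * ψ y := i123.add i4
    rw [pairing_add f k i1234 i5, pairing_add f k i123 i4, pairing_add f k i12 i3,
      pairing_add f k i1 i2, pairing_const_mul, pairing_const_mul, pairing_const_mul,
      pairing_const_mul, pairing_const_mul]
  rw [neg_mul, ← sub_eq_add_neg] at e
  refine ((h ψ hψ).trans e.symm).trans (intervalIntegral.integral_congr fun y _ => ?_)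
  simp only [deriv_poiseuille, poiseuille]
  push_cast
  ring

/-- All derivatives fall on the smooth stream field, so `f` need only be in `L²`. This is what makes
the adjoint problem accessible. -/
lemma inner_oseenExpr_streamField (ν C : ℝ) (k : ℤ) {ψ : ℝ → ℂ} (hψ : IsClamped ψ) (f : VectorL2) :
    ⟪oseenExpr ν C (streamField k hψ), f⟫_ℂ =
      -ν * (-k ^ 2 * pairing f.fst k (deriv ψ) + pairing f.fst k (deriv (deriv (deriv ψ)))) -
      Complex.I * k * pairing f.fst k (fun y => (poiseuille C y : ℂ) * deriv ψ y) +
      Complex.I * k * pairing f.fst k (fun y => ((deriv (poiseuille C) y : ℝ) : ℂ) * ψ y) -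
      ν * (Complex.I * k) * (-k ^ 2 * pairing f.snd k ψ + pairing f.snd k (deriv (deriv ψ))) +
      k ^ 2 * pairing f.snd k (fun y => (poiseuille C y : ℂ) * ψ y) := by
  have h1 := (contDiff_deriv_infty hψ.contDiff).of_le (m := 1) (by simp)
  have h0 := hψ.contDiff.of_le (m := 1) (by simp)
  have h0' := hψ.contDiff.continuous
  change ⟪-((ν : ℂ) • laplacian (cmode k (deriv ψ) hψ.continuous_deriv)) +
      mulY _ (continuous_poiseuille C) (weakDx (cmode k (deriv ψ) hψ.continuous_deriv)) +
      mulY _ (continuous_deriv_poiseuille C) ((-(Complex.I * k) : ℂ) • cmode k ψ h0'), f.fst⟫_ℂ +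
    ⟪-((ν : ℂ) • laplacian ((-(Complex.I * k) : ℂ) • cmode k ψ h0')) +
      mulY _ (continuous_poiseuille C) (weakDx ((-(Complex.I * k) : ℂ) • cmode k ψ h0')),
      f.snd⟫_ℂ = _
  rw [((memH2_cmode k hψ.contDiff).deriv_smul _).1, ((memH2_cmode k hψ.contDiff).deriv_smul _).2,
    laplacian_cmode k hψ.contDiff, laplacian_cmode k (contDiff_deriv_infty hψ.contDiff),
    (isWeakDx_cmode k h0).eq, (isWeakDx_cmode k h1).eq]
  simp only [map_smul, mulY_cmode, inner_add_left, inner_neg_left, inner_smul_left, inner_cmode,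
    map_neg, map_mul, Complex.conj_I, Complex.conj_ofReal, map_intCast]
  linear_combination (-ν * k ^ 2 * pairing f.fst k (deriv ψ) -
    ν * k ^ 3 * Complex.I * pairing f.snd k ψ -
    k ^ 2 * pairing f.snd k (fun y => (poiseuille C y : ℂ) * ψ y)) * Complex.I_sq

lemma inner_smul_right_H {w : VectorL2} (hw : w ∈ H) (μ : ℂ) (φ : H) :
    ⟪(⟨w, hw⟩ : H), μ • φ⟫_ℂ = μ * ⟪w, (φ : VectorL2)⟫_ℂ := by
  rw [Submodule.coe_inner, Submodule.coe_smul]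
  exact inner_smul_right _ _ _

lemma oseen_apply (ν C : ℝ) {w : VectorL2} (hw : w ∈ H) (hd : (⟨w, hw⟩ : H) ∈ (oseen ν C).domain) :
    oseen ν C ⟨⟨w, hw⟩, hd⟩ = H.orthogonalProjectionOnto (oseenExpr ν C w) := rfl

/-- The projector disappears against an element of `H`; this is the elimination of the pressure. -/
lemma inner_oseen_left (ν C : ℝ) {w : VectorL2} (hw : w ∈ H) (hd : (⟨w, hw⟩ : H) ∈ (oseen ν C).domain)
    (φ : H) : ⟪oseen ν C ⟨⟨w, hw⟩, hd⟩, φ⟫_ℂ = ⟪oseenExpr ν C w, (φ : VectorL2)⟫_ℂ := by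
  rw [oseen_apply]
  exact Submodule.inner_orthogonalProjectionOnto_eq_of_mem_right _ _

/-- Eigenfunctions of the adjoint satisfy the adjoint Orr–Sommerfeld equation. -/
theorem isVeryWeakOrrSommerfeld_of_adjoint {ν C : ℝ} {μ : ℂ} {φ : H}
    (hφ : IsEigenfunction (oseen ν C).adjoint μ φ) {k : ℤ} (hk : k ≠ 0) :
    IsVeryWeakOrrSommerfeld ν C (-(k : ℝ)) 1 μ (coeff (φ : VectorL2).snd k) := by
  refine isVeryWeakOrrSommerfeld_of_pairing fun ψ hψ => ?_
  obtain ⟨-, hd, he⟩ := hφ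
  have hw : (⟨streamField k hψ, streamField_mem_H hk hψ⟩ : H) ∈ (oseen ν C).domain :=
    streamField_mem_domain hk hψ
  have h := LinearPMap.adjoint_isFormalAdjoint (T := oseen ν C) dense_oseenDomain ⟨φ, hd⟩
    ⟨⟨streamField k hψ, streamField_mem_H hk hψ⟩, hw⟩
  rw [he] at h
  have h' : μ * ⟪streamField k hψ, (φ : VectorL2)⟫_ℂ =
      ⟪oseenExpr ν C (streamField k hψ), (φ : VectorL2)⟫_ℂ := by
    rw [← inner_smul_right_H (streamField_mem_H hk hψ), ← inner_oseen_left ν C _ hw]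
    exact (inner_conj_symm _ _).symm.trans ((congrArg conj h).trans (inner_conj_symm _ _))
  rw [inner_streamField, inner_oseenExpr_streamField] at h'
  have s0 := hψ.contDiff
  have s1 := contDiff_deriv_infty s0
  have s2 := contDiff_deriv_infty s1
  have s3 := contDiff_deriv_infty s2
  -- The divergence condition, tested with `ψ'`, `ψ'''`, `Uψ'` and `U'ψ`, turns each pairing with
  -- `u` into a pairing with `v`, once the tested equation is multiplied by `ik`. Conjugation on the
  -- first slot reverses the advection term, whence the frequency `-k`.
  have d1 := pairing_div φ.2 k s1
  have d3 := pairing_div φ.2 k s3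
  have dU := pairing_div φ.2 k (contDiff_ofReal_mul (contDiff_poiseuille C) s1)
  have dU' := pairing_div φ.2 k (contDiff_ofReal_mul (contDiff_deriv_poiseuille C) s0)
  rw [deriv_poiseuille_mul C s1, pairing_add _ _
    (continuous_ofReal_mul (continuous_deriv_poiseuille C) s1.continuous)
    (continuous_ofReal_mul (continuous_poiseuille C) s2.continuous)] at dU
  rw [deriv_deriv_poiseuille_mul C s0, pairing_add _ _
    (by fun_prop : Continuous fun y => 2 * (C : ℂ) * ψ y)
    (continuous_ofReal_mul (continuous_deriv_poiseuille C) s1.continuous), pairing_const_mul] at dU'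
  push_cast
  linear_combination (ν : ℂ) * d3 + (μ - ν * k ^ 2) * d1 + Complex.I * k * dU -
    Complex.I * k * dU' + Complex.I * k * h' +
    ((ν * k ^ 4 - μ * k ^ 2) * pairing (φ : VectorL2).snd k ψ -
      ν * k ^ 2 * pairing (φ : VectorL2).snd k (deriv (deriv ψ))) * Complex.I_sq

lemma pairing_weakDx {f : L2Cell} (hf : MemH2 f) (k : ℤ) (η : ℝ → ℂ) :
    pairing (weakDx f) k η = Complex.I * k * pairing f k η := by
  obtain ⟨fx, _, _, _, _, h1, -⟩ := hf
  rw [h1.eq, h1.pairing]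

/-- The two integrations by parts in `y` have different reasons: in the first `η` vanishes at the
walls, in the second `f` does. Hence `η'` is unrestricted at the walls, as is needed for `η = ψ'`
with `ψ` clamped. -/
lemma pairing_laplacian {f : L2Cell} (hf : MemH2 f) (ht : HasWallTrace f 0 0) (k : ℤ) {η : ℝ → ℂ}
    (hη : ContDiff ℝ ∞ η) (h0 : η 0 = 0) (h1 : η 1 = 0) :
    pairing (laplacian f) k η = -k ^ 2 * pairing f k η + pairing f k (deriv (deriv η)) := by
  obtain ⟨fx, fy, fxx, fxy, fyy, a1, a2, a3, a4, a5⟩ := hf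
  rw [laplacian, a1.eq, a3.eq, a2.eq, a5.eq, pairing_add_left _ _ _ hη.continuous, a3.pairing,
    a1.pairing, a5.pairing_of_vanish k hη h0 h1, a2.pairing_of_trace ht k (contDiff_deriv_infty hη)]
  linear_combination k ^ 2 * pairing f k η * Complex.I_sq

/-- Eigenfunctions satisfy the Orr–Sommerfeld equation. -/
theorem isVeryWeakOrrSommerfeld_of_direct {ν C : ℝ} {μ : ℂ} {φ : H}
    (hφ : IsEigenfunction (oseen ν C) μ φ) {k : ℤ} (hk : k ≠ 0) :
    IsVeryWeakOrrSommerfeld ν C k 0 μ (coeff (φ : VectorL2).snd k) := by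
  refine isVeryWeakOrrSommerfeld_of_pairing fun ψ hψ => ?_
  obtain ⟨-, hd, he⟩ := hφ
  -- The stream field lies in `H`, so the projector can be dropped. Although `φ` is in `H²`, the
  -- derivatives are then moved onto `ψ`, so that the regularity theorem used for the adjoint
  -- applies here as well.
  have e1 : ⟪(⟨streamField k hψ, streamField_mem_H hk hψ⟩ : H), oseen ν C ⟨φ, hd⟩⟫_ℂ =
      ⟪streamField k hψ, oseenExpr ν C (φ : VectorL2)⟫_ℂ :=
    Submodule.inner_orthogonalProjectionOnto_eq_of_mem_left _ _
  rw [he, inner_smul_right_H, inner_streamField, inner_streamField] at e1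
  obtain ⟨⟨hu, hv⟩, htu, htv⟩ := hd
  have s0 := hψ.contDiff
  have s1 := contDiff_deriv_infty s0
  have s2 := contDiff_deriv_infty s1
  have s3 := contDiff_deriv_infty s2
  change _ = pairing (-((ν : ℂ) • laplacian (φ : VectorL2).fst) +
      mulY _ (continuous_poiseuille C) (weakDx (φ : VectorL2).fst) +
      mulY _ (continuous_deriv_poiseuille C) (φ : VectorL2).snd) k (deriv ψ) +
    Complex.I * k * pairing (-((ν : ℂ) • laplacian (φ : VectorL2).snd) +
      mulY _ (continuous_poiseuille C) (weakDx (φ : VectorL2).snd)) k ψ at e1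
  rw [pairing_add_left _ _ _ s1.continuous, pairing_add_left _ _ _ s1.continuous,
    pairing_add_left _ _ _ s0.continuous, pairing_neg_left _ _ s1.continuous,
    pairing_neg_left _ _ s0.continuous, pairing_smul_left _ _ _ s1.continuous,
    pairing_smul_left _ _ _ s0.continuous, pairing_laplacian hu htu k s1 hψ.deriv_zero hψ.deriv_one,
    pairing_laplacian hv htv k s0 hψ.zero hψ.one, pairing_mulY _ _ _ s1.continuous,
    pairing_mulY _ _ _ s1.continuous, pairing_mulY _ _ _ s0.continuous, pairing_weakDx hu,
    pairing_weakDx hv] at e1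
  have d1 := pairing_div φ.2 k s1
  have d3 := pairing_div φ.2 k s3
  have dU := pairing_div φ.2 k (contDiff_ofReal_mul (contDiff_poiseuille C) s1)
  rw [deriv_poiseuille_mul C s1, pairing_add _ _
    (continuous_ofReal_mul (continuous_deriv_poiseuille C) s1.continuous)
    (continuous_ofReal_mul (continuous_poiseuille C) s2.continuous)] at dU
  push_cast
  linear_combination (ν : ℂ) * d3 + (μ - ν * k ^ 2) * d1 - Complex.I * k * dU +
    Complex.I * k * e1 +
    ((ν * k ^ 4 - μ * k ^ 2) * pairing (φ : VectorL2).snd k ψ -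
      ν * k ^ 2 * pairing (φ : VectorL2).snd k (deriv (deriv ψ)) +
      Complex.I * k ^ 3 * pairing (φ : VectorL2).snd k (fun y => (poiseuille C y : ℂ) * ψ y)) *
        Complex.I_sq

/-! ### Normal derivatives of trigonometric polynomials -/

lemma isPeriodicC1_trigPoly (S : Finset ℤ) {c : ℤ → ℝ → ℂ} (hc : ∀ k, ContDiff ℝ 1 (c k)) :
    IsPeriodicC1 (trigPoly S c) :=
  ⟨ContDiff.sum fun k _ => contDiff_modeFn k (hc k), fun x y => by
    simp only [trigPoly, modeFn, char_add_two_pi]⟩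

lemma dY_trigPoly (S : Finset ℤ) {c : ℤ → ℝ → ℂ} (hc : ∀ k, ContDiff ℝ 1 (c k)) (p : ℝ × ℝ) :
    dY (trigPoly S c) p = trigPoly S (fun k => deriv (c k)) p := by
  have h : HasFDerivAt (trigPoly S c) _ p := HasFDerivAt.fun_sum fun k _ =>
    ((contDiff_modeFn k (hc k)).differentiable (by simp) p).hasFDerivAt
  rw [dY, h.fderiv, sum_apply]
  exact Finset.sum_congr rfl fun k _ => dY_modeFn k ((hc k).differentiable (by simp)) p

lemma isWeakDy_trigPoly (S : Finset ℤ) {c : ℤ → ℝ → ℂ} (hc : ∀ k, ContDiff ℝ 1 (c k)) :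
    IsWeakDy (fieldLp (trigPoly S c) (continuous_trigPoly S fun k => (hc k).continuous))
      (fieldLp (trigPoly S fun k => deriv (c k))
        (continuous_trigPoly S fun k => continuous_deriv_of_contDiff (hc k))) := by
  have h := isWeakDy_fieldLp (isPeriodicC1_trigPoly S hc)
  convert h using 1
  exact fieldLp_congr _ _ fun p _ => (dY_trigPoly S hc p).symm

lemma eq_zero_of_wallLp_trigPoly (S : Finset ℤ) {c : ℤ → ℝ → ℂ} (hc : ∀ k, Continuous (c k)) {y : ℝ}
    (h : wallLp (fun x => trigPoly S c (x, y)) (continuous_slice (continuous_trigPoly S hc) y) = 0)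
    {k : ℤ} (hk : k ∈ S) : c k y = 0 := by
  have hz := coeFn_wallLp (continuous_slice (continuous_trigPoly S hc) y)
  rw [h] at hz
  have e := integral_trigPoly_mul_char S c k y
  have e0 : ∫ x in Ioo 0 (2 * Real.pi), trigPoly S c (x, y) * char (-k) x = 0 := by
    rw [← wallPair_zero (char (-k))]
    refine integral_congr_ae ?_
    filter_upwards [hz] with x hx
    rw [hx]
  rw [if_pos hk, intervalIntegral.integral_of_le Real.two_pi_pos.le, integral_Ioc_eq_integral_Ioo,
    e0] at e
  exact (mul_eq_zero.1 e.symm).resolve_left (by exact_mod_cast Real.two_pi_pos.ne')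

/-! ### The main argument -/

/-- The first component is determined by the second one. -/
lemma coeff_fst_eq {w : VectorL2} (hw : w ∈ H) {k : ℤ} (hk : k ≠ 0) {Z : ℝ → ℂ}
    (hZ : ContDiff ℝ 1 Z)
    (h : ∀ᵐ y ∂volume.restrict (Ioo (0 : ℝ) 1), coeff w.snd k y = Z y) :
    ∀ᵐ y ∂volume.restrict (Ioo (0 : ℝ) 1), coeff w.fst k y = -(Complex.I * k)⁻¹ * deriv Z y := by
  have hk' : Complex.I * (k : ℂ) ≠ 0 := mul_ne_zero Complex.I_ne_zero (by exact_mod_cast hk)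
  have cZ := continuous_deriv_of_contDiff hZ
  have hu := intervalIntegrable_coeff (integrableOn_cell w.fst) k
  have key := ae_eq_zero_of_compactTest
    (d := fun y => coeff w.fst k y - -(Complex.I * k)⁻¹ * deriv Z y)
    (hu.sub ((continuous_const.mul cZ).intervalIntegrable _ _)) fun η hη => by
      have cη := contDiff_deriv_infty hη.contDiff
      have e1 := pairing_div hw k hη.contDiff
      have e2 : pairing w.snd k (deriv η) = ∫ y in (0 : ℝ)..1, Z y * deriv η y :=
        intervalIntegral_congr_Ioo (by filter_upwards [h] with y hy; rw [hy]) (by simp)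
      have e3 := intervalIntegral.integral_mul_deriv_eq_deriv_mul (a := 0) (b := 1)
        (fun y _ => (hZ.differentiable (by simp) y).hasDerivAt)
        (fun y _ => hasDerivAt_of_contDiff_infty hη.contDiff y) (cZ.intervalIntegrable _ _)
        (cη.continuous.intervalIntegrable _ _)
      rw [hη.isClamped.zero, hη.isClamped.one] at e3
      have i1 : IntervalIntegrable (fun y => deriv Z y * η y) volume 0 1 :=
        (cZ.mul hη.contDiff.continuous).intervalIntegrable _ _
      simp only [sub_mul, mul_assoc]
      rw [intervalIntegral.integral_sub (hu.mul_continuousOn hη.contDiff.continuous.continuousOn)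
        (i1.const_mul _),
        intervalIntegral.integral_const_mul]
      rw [e2, e3, PeriodicChannel.pairing] at e1
      field_simp
      linear_combination -e1
  filter_upwards [key] with y hy using sub_eq_zero.1 hy

lemma deriv_eq_zero_of_Icc {Z : ℝ → ℂ} (h : ∀ t ∈ Icc (0 : ℝ) 1, Z t = 0) {y : ℝ}
    (hy : y ∈ Ioo (0 : ℝ) 1) : deriv Z y = 0 := by
  have : Z =ᶠ[nhds y] fun _ => 0 :=
    Filter.eventuallyEq_of_mem (Icc_mem_nhds hy.1 hy.2) h
  rw [this.deriv_eq, deriv_const]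

/-- A nonzero solenoidal field whose Fourier coefficients solve Orr–Sommerfeld equations has
a normal derivative which does not vanish identically on the walls. -/
theorem exists_normalDeriv_ne_zero {ν C σ : ℝ} {μ : ℂ} (hν : 0 < ν) (hC : C ≠ 0) (hμ : μ.re ≤ 0)
    (hσ : σ = 0 ∨ σ = 1) {κ : ℤ → ℝ} (hκ : ∀ k, κ k ^ 2 = (k : ℝ) ^ 2) {φ : H} (hφ : φ ≠ 0)
    (h : ∀ k : ℤ, k ≠ 0 → IsVeryWeakOrrSommerfeld ν C (κ k) σ μ (coeff (φ : VectorL2).snd k)) :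
    ∃ g₀ g₁ : L2Wall × L2Wall, HasNormalDeriv φ g₀ g₁ ∧ ¬ (g₀ = 0 ∧ g₁ = 0) := by
  have hκ0 : ∀ k : ℤ, k ≠ 0 → κ k ≠ 0 := fun k hk h0 => by
    have := hκ k
    rw [h0] at this
    exact hk (by exact_mod_cast pow_eq_zero_iff (two_ne_zero) |>.1 (by linarith : (k : ℝ) ^ 2 = 0))
  have hex : ∀ k : ℤ, ∃ Z, ContDiff ℝ 4 Z ∧ (k ≠ 0 → IsOrrSommerfeld ν C (κ k) σ μ Z) ∧
      (k = 0 → Z = fun _ => 0) ∧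
      (∀ᵐ y ∂volume.restrict (Ioo (0 : ℝ) 1), coeff (φ : VectorL2).snd k y = Z y) ∧
      ∀ᵐ y ∂volume.restrict (Ioo (0 : ℝ) 1),
        coeff (φ : VectorL2).fst k y = -(Complex.I * k)⁻¹ * deriv Z y := fun k => by
    -- For `k = 0` both coefficients vanish by the definition of `H`. The inverse of `Complex.I * 0`
    -- is `0`, so the formula for the first coefficient stays correct.
    rcases eq_or_ne k 0 with rfl | hk
    · have h0 := coeff_zero_of_mem_H φ.2
      exact ⟨fun _ => 0, contDiff_const, fun h => absurd rfl h, fun _ => rfl, h0.2, by simpa using h0.1⟩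
    · obtain ⟨Z, hZ, he⟩ := (h k hk).exists_classical hν
        (intervalIntegrable_coeff (integrableOn_cell _) k)
      exact ⟨Z, hZ.contDiff, fun _ => hZ, fun h => absurd h hk, he,
        coeff_fst_eq φ.2 hk (hZ.contDiff.of_le (by norm_num)) he⟩
  choose Z hZ hos hZ0 hv hu using hex
  -- For `|k| > N` one has `νk² ≥ ν|k| ≥ νN > |C|/2`, the threshold beyond which a mode vanishes by
  -- the energy estimate.
  obtain ⟨N, hN⟩ := exists_nat_gt (|C| / 2 / ν)
  set S : Finset ℤ := Finset.Icc (-(N : ℤ)) N with hS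
  have hout : ∀ k ∉ S, ∀ t ∈ Icc (0 : ℝ) 1, Z k t = 0 := fun k hk => by
    have hk0 : k ≠ 0 := fun h => hk (by simp [hS, h])
    refine (hos k hk0).eq_zero_of_large hν hμ (by rcases hσ with rfl | rfl <;> norm_num) (hκ0 k hk0) ?_
    have hN1 : (N : ℤ) < |k| := by
      by_contra hle
      exact hk (Finset.mem_Icc.2 (abs_le.1 (not_lt.1 hle)))
    have hN2 : (N : ℝ) ≤ |(k : ℝ)| := by exact_mod_cast hN1.le
    have hk1 : (1 : ℝ) ≤ |(k : ℝ)| := by exact_mod_cast Int.one_le_abs hk0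
    rw [hκ, ← sq_abs, mul_comm, ← div_lt_iff₀ hν]
    nlinarith
  have hpi : (2 * Real.pi : ℂ) ≠ 0 := by exact_mod_cast Real.two_pi_pos.ne'
  -- Amplitudes of the modes of `u` and `v`. The factor `(2π)⁻¹` compensates for the coefficients
  -- not being normalized.
  set a : ℤ → ℝ → ℂ := fun k y => (2 * Real.pi : ℂ)⁻¹ * (-(Complex.I * k)⁻¹ * deriv (Z k) y) with ha
  set b : ℤ → ℝ → ℂ := fun k y => (2 * Real.pi : ℂ)⁻¹ * Z k y with hb
  have cdZ : ∀ k, ContDiff ℝ 3 (deriv (Z k)) := fun k =>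
    (contDiff_succ_iff_deriv (n := 3).1 (by exact_mod_cast hZ k)).2.2
  have ca : ∀ k, ContDiff ℝ 2 (a k) := fun k =>
    contDiff_const.mul (contDiff_const.mul ((cdZ k).of_le (by norm_num)))
  have cb : ∀ k, ContDiff ℝ 2 (b k) := fun k =>
    contDiff_const.mul ((hZ k).of_le (by norm_num))
  have ca1 : ∀ k, ContDiff ℝ 1 (a k) := fun k => (ca k).of_le (by norm_num)
  have cb1 : ∀ k, ContDiff ℝ 1 (b k) := fun k => (cb k).of_le (by norm_num)
  have cda : ∀ k, ContDiff ℝ 1 (deriv (a k)) := fun k =>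
    (contDiff_succ_iff_deriv (n := 1).1 (by exact_mod_cast ca k)).2.2
  have cdb : ∀ k, ContDiff ℝ 1 (deriv (b k)) := fun k =>
    (contDiff_succ_iff_deriv (n := 1).1 (by exact_mod_cast cb k)).2.2
  have hm := ae_restrict_mem (μ := volume) (measurableSet_Ioo (a := (0 : ℝ)) (b := 1))
  have eu := eq_trigPoly (f := (φ : VectorL2).fst) S (fun k => (ca k).continuous) fun k => by
    filter_upwards [hu k, hm] with y hy hy1
    rw [hy]
    split_ifs with hk
    · rw [ha, mul_inv_cancel_left₀ hpi]
    · rw [deriv_eq_zero_of_Icc (hout k hk) hy1, mul_zero]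
  have ev := eq_trigPoly (f := (φ : VectorL2).snd) S (fun k => (cb k).continuous) fun k => by
    filter_upwards [hv k, hm] with y hy hy1
    rw [hy]
    split_ifs with hk
    · rw [hb, mul_inv_cancel_left₀ hpi]
    · exact hout k hk y (Ioo_subset_Icc_self hy1)
  have cA := continuous_trigPoly S fun k => (cda k).continuous
  have cB := continuous_trigPoly S fun k => (cdb k).continuous
  -- The sign at `y = 0` comes from the outward normal, which points in the direction `-y` there.
  refine ⟨(-wallLp _ (continuous_slice cA 0), -wallLp _ (continuous_slice cB 0)),
    (wallLp _ (continuous_slice cA 1), wallLp _ (continuous_slice cB 1)),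
    ⟨_, _, by rw [eu]; exact isWeakDy_trigPoly S ca1, by rw [ev]; exact isWeakDy_trigPoly S cb1,
      by rw [neg_neg]; exact hasWallTrace_fieldLp (isPeriodicC1_trigPoly S cda),
      by rw [neg_neg]; exact hasWallTrace_fieldLp (isPeriodicC1_trigPoly S cdb)⟩, ?_⟩
  rintro ⟨hg0, hg1⟩
  -- Only the tangential component is needed: `u_k'` is a nonzero multiple of `Z_k''`, so its
  -- vanishing supplies the extra wall condition.
  have hw0 : wallLp _ (continuous_slice cA 0) = 0 := neg_eq_zero.1 (congrArg Prod.fst hg0)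
  have hw1 : wallLp _ (continuous_slice cA 1) = 0 := congrArg Prod.fst hg1
  have hda : ∀ k y, deriv (a k) y =
      (2 * Real.pi : ℂ)⁻¹ * (-(Complex.I * k)⁻¹ * deriv (deriv (Z k)) y) := fun k y =>
    (((hasDerivAt_of_contDiff_four (hZ k) y).2.1.const_mul _).const_mul _).deriv
  have hz : ∀ k, ∀ t ∈ Icc (0 : ℝ) 1, Z k t = 0 := fun k => by
    rcases eq_or_ne k 0 with hk0 | hk0
    · rw [hZ0 k hk0]
      exact fun _ _ => rfl
    by_cases hk : k ∈ S
    · have hk' : -(Complex.I * (k : ℂ))⁻¹ ≠ 0 :=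
        neg_ne_zero.2 (inv_ne_zero (mul_ne_zero Complex.I_ne_zero (by exact_mod_cast hk0)))
      have hd : ∀ {y}, deriv (a k) y = 0 → deriv (deriv (Z k)) y = 0 := fun {y} h0 => by
        rw [hda] at h0
        exact (mul_eq_zero.1 ((mul_eq_zero.1 h0).resolve_left (inv_ne_zero hpi))).resolve_left hk'
      exact (hos k hk0).eq_zero_of_overdetermined hν hμ hσ hC (hκ0 k hk0)
        (hd (eq_zero_of_wallLp_trigPoly S (fun k => (cda k).continuous) hw0 hk))
        (hd (eq_zero_of_wallLp_trigPoly S (fun k => (cda k).continuous) hw1 hk))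
    · exact hout k hk
  have hu0 : (φ : VectorL2).fst = 0 := eq_zero_of_coeff_eq_zero fun k => by
    filter_upwards [hu k, hm] with y hy hy1
    rw [hy, deriv_eq_zero_of_Icc (hz k) hy1, mul_zero]
  have hv0 : (φ : VectorL2).snd = 0 := eq_zero_of_coeff_eq_zero fun k => by
    filter_upwards [hv k, hm] with y hy hy1
    rw [hy, hz k y (Ioo_subset_Icc_self hy1)]
  exact hφ (Subtype.ext (WithLp.ofLp_injective 2 (Prod.ext hu0 hv0)))

end PeriodicChannel

end

theorem lemma1 (ν C : ℝ) (hν : 0 < ν) (hC : C < 0) (lam : ℂ) (hlam : lam.re ≤ 0) :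
    (∀ φ : PeriodicChannel.H,
      PeriodicChannel.IsEigenfunction (PeriodicChannel.oseen ν C) lam φ →
      ∃ g₀ g₁ : PeriodicChannel.L2Wall × PeriodicChannel.L2Wall,
        PeriodicChannel.HasNormalDeriv φ g₀ g₁ ∧ ¬ (g₀ = 0 ∧ g₁ = 0)) ∧
    (∀ φ' : PeriodicChannel.H,
      PeriodicChannel.IsEigenfunction (PeriodicChannel.oseen ν C).adjoint (conj lam) φ' →
      ∃ g₀ g₁ : PeriodicChannel.L2Wall × PeriodicChannel.L2Wall,
        PeriodicChannel.HasNormalDeriv φ' g₀ g₁ ∧ ¬ (g₀ = 0 ∧ g₁ = 0)) :=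
  ⟨fun _ hφ => PeriodicChannel.exists_normalDeriv_ne_zero hν hC.ne hlam (Or.inl rfl)
      (κ := fun k => (k : ℝ)) (fun _ => rfl) hφ.1
      fun _ hk => PeriodicChannel.isVeryWeakOrrSommerfeld_of_direct hφ hk,
    fun _ hφ => PeriodicChannel.exists_normalDeriv_ne_zero hν hC.ne (by simpa using hlam)
      (Or.inr rfl) (κ := fun k => -(k : ℝ)) (fun _ => neg_sq _) hφ.1
      fun _ hk => PeriodicChannel.isVeryWeakOrrSommerfeld_of_adjoint hφ hk⟩
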